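/- Let $M,N\ge 1$ be integers and let $\mathbb T=\mathbb R/2\pi\mathbb Z$ carry the measure $\frac{dx}{2\pi}$. For $U\in L^2(\mathbb T;\mathbb C^{M\times N})$ write $\hat U(n)=\frac1{2\pi}\int_0^{2\pi}U(x)e^{-inx}\,dx$, $n\in\mathbb Z$, and let $\Pi_{\ge 0}U=\sum_{n\ge 0}\hat U(n)e^{inx}$ be the Szegő projector. For $s\ge 0$ let $H^s_+(\mathbb T;\mathbb C^{M\times N})=\Pi_{\ge0}(H^s(\mathbb T;\mathbb C^{M\times N}))$ be the space of all $U\in L^2(\mathbb T;\mathbb C^{M\times N})$ with $\hat U(n)=0$ for $n<0$ and $\|U\|_{H^s}^2=\sum_{k=1}^M\sum_{j=1}^N\sum_{n\in\mathbb Z}(1+n^2)^s|\hat U_{kj}(n)|^2<\infty$. Consider the cubic matrix Szegő equation $$ i\,\partial_tU=\Pi_{\ge0}(UU^*U),\qquad (t,x)\in\mathbb R\times\mathbb T, $$ where a function $U\in C(\mathbb R;H^{1/2}_+(\mathbb T;\mathbb C^{M\times N}))$ is said to solve the equation if for every $t\in\mathbb R$ the function $U(t)U(t)^*U(t)$ is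 in $L^2(\mathbb T;\mathbb C^{M\times N})$, and $U$ is differentiable at $t$ as a map with values in $L^2(\mathbb T;\mathbb C^{M\times N})$, with $i\,\partial_tU(t)=\Pi_{\ge0}(U(t)U(t)^*U(t))$. (1) For every $U_0\in H^{1/2}_+(\mathbb T;\mathbb C^{M\times N})$ there exists a unique $U\in C(\mathbb R;H^{1/2}_+(\mathbb T;\mathbb C^{M\times N}))$ that solves the equation and satisfies $U(0)=U_0$. (2) For every $T>0$ the flow map $\Phi:U_0\in H^{1/2}_+(\mathbb T;\mathbb C^{M\times N})\mapsto U|_{[-T,T]}\in C([-T,T];H^{1/2}_+(\mathbb T;\mathbb C^{M\times N}))$, where $U$ is the solution in (1), is continuous (for the topology of uniform convergence on $[-T,T]$). (3) If moreover $U_0\in H^s_+(\mathbb T;\mathbb C^{M\times N})$ for some $s>\frac12$, then the solution $U$ in (1) belongs to $C^\infty(\mathbb R;H^s_+(\mathbb T;\mathbb C^{M\times N}))$. -/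

import Mathlib

open MeasureTheory Matrix
open scoped ContDiff ENNReal

noncomputable section

namespace MatrixSzego

/-- The torus `ℝ / 2πℤ`. -/
abbrev Torus : Type := AddCircle (2 * Real.pi)

instance fact_two_pi_pos : Fact (0 < 2 * Real.pi) := ⟨Real.two_pi_pos⟩

/-- The scalar space `L²(𝕋; ℂ)` for the normalized measure `dx / 2π`. -/
abbrev L2 : Type := Lp ℂ 2 (AddCircle.haarAddCircle : Measure Torus)

/-- The Fourier coefficient `f̂(n) = (1 / 2π) ∫ f(x) e^{-inx} dx`. -/
def coeff (f : L2) (n : ℤ) : ℂ := fourierCoeff (f : Torus → ℂ) n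

theorem repr_eq_coeff (f : L2) (n : ℤ) : fourierBasis.repr f n = coeff f n :=
  fourierBasis_repr f n

theorem coeff_add (f g : L2) (n : ℤ) : coeff (f + g) n = coeff f n + coeff g n := by
  simp [← repr_eq_coeff]

theorem coeff_smul (c : ℂ) (f : L2) (n : ℤ) : coeff (c • f) n = c * coeff f n := by
  simp [← repr_eq_coeff]

theorem coeff_zero (n : ℤ) : coeff 0 n = 0 := by
  simp [← repr_eq_coeff]

theorem coeff_ext {f g : L2} (h : ∀ n, coeff f n = coeff g n) : f = g := by
  apply fourierBasis.repr.injective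
  ext n
  simpa [repr_eq_coeff] using h n

/-! ### The Szegő projector -/

theorem memlp_nonneg_modes (f : L2) :
    Memℓp (fun n : ℤ => if 0 ≤ n then coeff f n else 0) 2 := by
  have h : Memℓp (fun n : ℤ => coeff f n) 2 := by
    have h' := lp.memℓp (fourierBasis.repr f)
    have e : (fun n : ℤ => coeff f n) = ⇑(fourierBasis.repr f) := by
      funext n; exact (repr_eq_coeff f n).symm
    rw [e]; exact h'
  have h2 : 0 < (2 : ℝ≥0∞).toReal := by norm_num
  refine (memℓp_gen_iff h2).mpr (((memℓp_gen_iff h2).mp h).of_nonneg_of_le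
    (fun n => by positivity) fun n => ?_)
  split_ifs
  · exact le_rfl
  · simp

/-- The scalar Szegő projector `Π_{≥0} : ∑ f̂(n) e^{inx} ↦ ∑_{n ≥ 0} f̂(n) e^{inx}`. -/
def szego (f : L2) : L2 :=
  fourierBasis.repr.symm ⟨fun n : ℤ => if 0 ≤ n then coeff f n else 0, memlp_nonneg_modes f⟩

theorem coeff_szego (f : L2) (n : ℤ) :
    coeff (szego f) n = if 0 ≤ n then coeff f n else 0 := by
  rw [← repr_eq_coeff, szego, LinearIsometryEquiv.apply_symm_apply]

/-! ### Scalar Sobolev spaces -/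

/-- The weighted Fourier coefficients `(1 + n²)^{s/2} f̂(n)`. -/
def wcoeff (s : ℝ) (f : L2) (n : ℤ) : ℂ := (((1 + (n : ℝ) ^ 2) ^ (s / 2) : ℝ) : ℂ) * coeff f n

/-- For `s ≥ 0`, the Sobolev space `H^s(𝕋; ℂ)` as a subspace of `L²(𝕋; ℂ)`:
the functions whose weighted Fourier coefficients are square summable. -/
def sobolev (s : ℝ) : Submodule ℂ L2 where
  carrier := {f | Memℓp (wcoeff s f) 2}
  add_mem' {f g} hf hg := by
    have : wcoeff s (f + g) = wcoeff s f + wcoeff s g := by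
      funext n; simp [wcoeff, coeff_add, mul_add]
    simp only [Set.mem_ofPred_eq, this]
    exact hf.add hg
  zero_mem' := by
    have : wcoeff s 0 = 0 := by
      funext n; simp [wcoeff, coeff_zero]
    simp only [Set.mem_ofPred_eq, this]
    exact zero_memℓp
  smul_mem' c f hf := by
    have : wcoeff s (c • f) = c • wcoeff s f := by
      funext n; simp [wcoeff, coeff_smul]; ring
    simp only [Set.mem_ofPred_eq, this]
    exact hf.const_smul c

/-- The space `H^s(𝕋; ℂ)` as a type of its own, to carry the `H^s` norm. -/
def Hs (s : ℝ) : Type := sobolev s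

instance (s : ℝ) : AddCommGroup (Hs s) := inferInstanceAs (AddCommGroup (sobolev s))

instance (s : ℝ) : Module ℂ (Hs s) := inferInstanceAs (Module ℂ (sobolev s))

/-- The inclusion `H^s ⊆ L²`. -/
def Hs.toL2 {s : ℝ} : Hs s →ₗ[ℂ] L2 := (sobolev s).subtype

/-- The linear map from `H^s` to `ℓ²(ℤ)` given by the weighted Fourier coefficients. -/
def Hs.toSeq (s : ℝ) : Hs s →ₗ[ℂ] lp (fun _ : ℤ => ℂ) 2 where
  toFun f := ⟨wcoeff s f.toL2, f.2⟩
  map_add' f g := by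
    ext n
    change wcoeff s (Hs.toL2 (f + g)) n = wcoeff s f.toL2 n + wcoeff s g.toL2 n
    simp [wcoeff, coeff_add, mul_add]
  map_smul' c f := by
    ext n
    change wcoeff s (Hs.toL2 (c • f)) n = c • wcoeff s f.toL2 n
    simp only [wcoeff, map_smul, coeff_smul, smul_eq_mul]
    ring

theorem Hs.toSeq_injective (s : ℝ) : Function.Injective (Hs.toSeq s) := by
  intro f g h
  apply Subtype.ext
  apply coeff_ext
  intro n
  have hn : wcoeff s f.toL2 n = wcoeff s g.toL2 n := congrArg (fun a => a.1 n) h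
  have hpos : (((1 + (n : ℝ) ^ 2) ^ (s / 2) : ℝ) : ℂ) ≠ 0 :=
    Complex.ofReal_ne_zero.mpr (Real.rpow_pos_of_pos (by positivity) _).ne'
  exact mul_left_cancel₀ hpos hn

/-- The norm `‖f‖_{H^s}² = ∑ (1 + n²)^s |f̂(n)|²`. -/
instance (s : ℝ) : NormedAddCommGroup (Hs s) :=
  NormedAddCommGroup.induced (Hs s) (lp (fun _ : ℤ => ℂ) 2) (Hs.toSeq s) (Hs.toSeq_injective s)

instance (s : ℝ) : NormedSpace ℂ (Hs s) :=
  NormedSpace.induced ℂ (Hs s) (lp (fun _ : ℤ => ℂ) 2) (Hs.toSeq s)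

theorem Hs.norm_sq_eq {s : ℝ} (f : Hs s) :
    ‖f‖ ^ 2 = ∑' n : ℤ, (1 + (n : ℝ) ^ 2) ^ s * ‖coeff f.toL2 n‖ ^ 2 := by
  have h := lp.norm_rpow_eq_tsum (p := 2) (by norm_num) (Hs.toSeq s f)
  simp only [ENNReal.toReal_ofNat, Real.rpow_two] at h
  change ‖Hs.toSeq s f‖ ^ 2 = _
  rw [h]
  refine tsum_congr fun n => ?_
  change ‖wcoeff s f.toL2 n‖ ^ 2 = _
  have hp : (0 : ℝ) < 1 + (n : ℝ) ^ 2 := by positivity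
  rw [wcoeff, norm_mul, Complex.norm_real, Real.norm_of_nonneg (Real.rpow_nonneg hp.le _), mul_pow,
    ← Real.rpow_natCast, ← Real.rpow_mul hp.le]
  norm_num

/-- The filtered Sobolev space `H^s_+ = Π_{≥0}(H^s)`: the elements of `H^s` whose negative Fourier
modes vanish (see `mem_range_szego_iff`), with the norm of `H^s`. -/
def HsPlus (s : ℝ) : Submodule ℂ (Hs s) where
  carrier := {f | ∀ n < 0, coeff f.toL2 n = 0}
  add_mem' hf hg n hn := by simp [coeff_add, hf n hn, hg n hn]
  zero_mem' n _ := by simp [coeff_zero]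
  smul_mem' c f hf n hn := by simp [coeff_smul, hf n hn]

theorem mem_range_szego_iff (s : ℝ) (f : L2) :
    f ∈ szego '' (sobolev s) ↔ ∃ g ∈ HsPlus s, Hs.toL2 g = f := by
  constructor
  · rintro ⟨g, hg, rfl⟩
    have hmem : szego g ∈ sobolev s := by
      have h2 : 0 < (2 : ℝ≥0∞).toReal := by norm_num
      have hg' : Memℓp (wcoeff s g) 2 := hg
      change Memℓp (wcoeff s (szego g)) 2
      refine (memℓp_gen_iff h2).mpr (((memℓp_gen_iff h2).mp hg').of_nonneg_of_le
        (fun n => by positivity) fun n => ?_)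
      simp only [wcoeff, coeff_szego]
      split_ifs
      · exact le_rfl
      · rw [mul_zero, norm_zero, Real.zero_rpow h2.ne']
        positivity
    refine ⟨⟨szego g, hmem⟩, fun n hn => ?_, rfl⟩
    change coeff (szego g) n = 0
    rw [coeff_szego, if_neg (not_le.mpr hn)]
  · rintro ⟨g, hg, rfl⟩
    refine ⟨g.toL2, g.2, coeff_ext fun n => ?_⟩
    rw [coeff_szego]
    split_ifs with h
    · rfl
    · exact (hg n (not_le.mp h)).symm

/-! ### Matrix-valued spaces -/

/-- The space `L²(𝕋; ℂ^{M×N})`: matrices of `L²` functions, with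
`‖U‖² = ∑ ‖U_{kj}‖²`. -/
abbrev L2Mat (M N : ℕ) : Type := PiLp 2 (fun _ : Fin M × Fin N => L2)

/-- The space `H^s_+(𝕋; ℂ^{M×N})`: matrices of `H^s_+` functions, with
`‖U‖² = ∑ ‖U_{kj}‖²` for the `H^s` norms of the entries. -/
abbrev HsPlusMat (M N : ℕ) (s : ℝ) : Type := PiLp 2 (fun _ : Fin M × Fin N => HsPlus s)

/-- The inclusion `H^s_+(𝕋; ℂ^{M×N}) ⊆ L²(𝕋; ℂ^{M×N})`. -/
def toL2Mat {M N : ℕ} {s : ℝ} (U : HsPlusMat M N s) : L2Mat M N :=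
  WithLp.toLp 2 fun p => Hs.toL2 (U p : Hs s)

/-- The matrix `U(x)`. -/
def evalMat {M N : ℕ} (U : L2Mat M N) (x : Torus) : Matrix (Fin M) (Fin N) ℂ :=
  Matrix.of fun k j => U (k, j) x

/-- The pointwise matrix product `U(x) U(x)^* U(x)`. -/
def cubic {M N : ℕ} (U : L2Mat M N) (x : Torus) : Matrix (Fin M) (Fin N) ℂ :=
  evalMat U x * (evalMat U x)ᴴ * evalMat U x

/-- A matrix function belongs to `L²` when all its entries do. -/
def MemL2Mat {M N : ℕ} (F : Torus → Matrix (Fin M) (Fin N) ℂ) : Prop :=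
  ∀ p : Fin M × Fin N, MemLp (fun x => F x p.1 p.2) 2 AddCircle.haarAddCircle

/-- The class in `L²(𝕋; ℂ^{M×N})` of a square integrable matrix function. -/
def MemL2Mat.toL2Mat {M N : ℕ} {F : Torus → Matrix (Fin M) (Fin N) ℂ} (h : MemL2Mat F) :
    L2Mat M N :=
  WithLp.toLp 2 fun p => (h p).toLp

/-- The Szegő projector on `L²(𝕋; ℂ^{M×N})`, which acts on each entry. -/
def szegoMat {M N : ℕ} (F : L2Mat M N) : L2Mat M N :=
  WithLp.toLp 2 fun p => szego (F p)

/-- `U` solves `i ∂_t U = Π_{≥0}(U U^* U)`: at every time the cubic term is square integrable, and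
`U`, as a function of time with values in `L²`, has a derivative that satisfies the equation. -/
def IsSolution {M N : ℕ} {s : ℝ} (U : ℝ → HsPlusMat M N s) : Prop :=
  ∀ t : ℝ, ∃ (h : MemL2Mat (cubic (toL2Mat (U t)))) (D : L2Mat M N),
    HasDerivAt (fun τ => toL2Mat (U τ)) D t ∧ Complex.I • D = szegoMat h.toL2Mat

end MatrixSzego

end

/-!
The proof works with the energy `∑ (1 + |n|) |Û(n)|²`, whose square root is equivalent to the norm
of `H^{1/2}`. It is conserved because in the quartic form of the equation the weight can be moved
between the four frequencies, and the weights balance when the frequencies `n + m₂ = m₁ + m₃`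
resonate (`im_sum_star_mul_coeff_cubicL2`).

Although `H^{1/2}` does not embed into `L^∞`, it embeds into `L⁶`, so that the nonlinearity is a
smooth map from `H^{1/2}` to `L²` (`contDiff_cubicL2`), and the supremum norm of a function with
frequencies below `K` costs only a factor `√(1 + log K)`. Hence the `L²` distance `d` of two
trajectories of bounded energy satisfies `|(d²)'| ≤ C (1 + log K) d² + C K^{-1/2}` for every `K`,
and Grönwall's inequality on a short time interval, followed by the limit `K → ∞`, gives stability in
`L²` that depends only on the energy (`exists_stability`); it holds also between truncations of the
equation.

Galerkin approximations exist globally and conserve the energy. By stability they converge in `L²`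
at each time. Fatou's lemma shows that the limit has no larger energy than the data, and running the
approximations backwards in time from the limit shows that the energies agree
(`IsGalerkinSeq.energy_limit_eq`). Since convergence of the Fourier coefficients and of the energy
imply convergence in `H^{1/2}` (`tendsto_of_tendsto_energy`), the Galerkin approximations converge
in `H^{1/2}`, the limit solves the equation, and it is continuous in time. The same principle,
with stability, gives uniqueness and joint continuity in the data and in time (`tendsto_flow`).

For `s > 1/2`, `H^s` is an algebra with the tame estimate
`‖U U^* U‖_{H^s} ≤ C ‖U‖_A² ‖U‖_{H^s}` in terms of the Wiener norm `‖U‖_A = ∑ |Û(n)|`, and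
`‖U‖_A² ≤ C (1 + log ‖U‖_{H^s})` on sets of bounded energy. A barrier argument bounds the `H^s` norm
of the Galerkin approximations by a double exponential of time, so that the solution stays in `H^s`
(`exists_toL2Mat_eq_flow`). There the equation is an ordinary differential equation for a smooth
vector field, and the solution is smooth in time (`exists_contDiff_flow`).
-/

noncomputable section

open Filter Topology
open scoped NNReal

namespace MatrixSzego

/-! ### Weighted sums of squares -/

/-- The Cauchy–Schwarz inequality for series in `[0, ∞]`. -/
theorem ENNReal_tsum_mul_sq_le {ι : Type*} (x y : ι → ℝ≥0∞) :
    (∑' i, x i * y i) ^ 2 ≤ (∑' i, x i ^ 2) * ∑' i, y i ^ 2 := by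
  have h : ∑' i, x i * y i ≤ ((∑' i, x i ^ 2) ^ (1 / 2 : ℝ)) * (∑' i, y i ^ 2) ^ (1 / 2 : ℝ) := by
    rw [ENNReal.tsum_eq_iSup_sum]
    refine iSup_le fun s => ?_
    refine (ENNReal.inner_le_Lp_mul_Lq s x y Real.HolderConjugate.two_two).trans ?_
    simp only [ENNReal.rpow_ofNat]
    gcongr <;> exact ENNReal.sum_le_tsum s
  calc (∑' i, x i * y i) ^ 2
      ≤ (((∑' i, x i ^ 2) ^ (1 / 2 : ℝ)) * (∑' i, y i ^ 2) ^ (1 / 2 : ℝ)) ^ 2 := by gcongr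
    _ = _ := by
        rw [mul_pow, ← ENNReal.rpow_natCast, ← ENNReal.rpow_mul, ← ENNReal.rpow_natCast,
          ← ENNReal.rpow_mul]
        norm_num

theorem enorm_add_sq_le {E : Type*} [SeminormedAddCommGroup E] (a b : E) :
    ‖a + b‖ₑ ^ 2 ≤ 2 * (‖a‖ₑ ^ 2 + ‖b‖ₑ ^ 2) := by
  have h : ‖a + b‖₊ ^ 2 ≤ 2 * (‖a‖₊ ^ 2 + ‖b‖₊ ^ 2) :=
    (pow_le_pow_left₀ (zero_le) (nnnorm_add_le a b) 2).trans add_sq_le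
  simp only [enorm_eq_nnnorm]
  exact_mod_cast h

theorem enorm_sub_sq_le {E : Type*} [SeminormedAddCommGroup E] (a b : E) :
    ‖a - b‖ₑ ^ 2 ≤ 2 * (‖a‖ₑ ^ 2 + ‖b‖ₑ ^ 2) := by
  simpa [sub_eq_add_neg] using enorm_add_sq_le a (-b)

theorem tendsto_of_enorm_sub_sq {E α : Type*} [SeminormedAddCommGroup E] {l : Filter α} {u : α → E}
    {v : E} (h : Tendsto (fun a => ‖u a - v‖ₑ ^ 2) l (𝓝 0)) : Tendsto u l (𝓝 v) := by
  have h3 : Tendsto (fun a => ‖u a - v‖ₑ) l (𝓝 0) := by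
    have := (ENNReal.continuous_rpow_const (y := (1 / 2 : ℝ))).continuousAt.tendsto.comp h
    have e : (0 : ℝ≥0∞) ^ (1 / 2 : ℝ) = 0 := by norm_num
    rw [e] at this
    refine this.congr fun a => ?_
    simp only [Function.comp_def]
    rw [← ENNReal.rpow_natCast, ← ENNReal.rpow_mul]
    norm_num
  rw [tendsto_iff_norm_sub_tendsto_zero]
  have h4 := (ENNReal.tendsto_toReal ENNReal.zero_ne_top).comp h3
  simpa [Function.comp_def] using h4

section weighted

variable {ι α : Type*} {c : ι → ℝ≥0} {l : Filter α}

theorem tendsto_weighted_sum {x : α → ι → ℂ} {x₀ : ι → ℂ}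
    (hx : ∀ i, Tendsto (fun a => x a i) l (𝓝 (x₀ i))) (s : Finset ι) :
    Tendsto (fun a => ∑ i ∈ s, (c i : ℝ≥0∞) * ‖x a i‖ₑ ^ 2) l
      (𝓝 (∑ i ∈ s, (c i : ℝ≥0∞) * ‖x₀ i‖ₑ ^ 2)) := by
  refine tendsto_finsetSum _ fun i _ => ?_
  exact ENNReal.Tendsto.const_mul (ENNReal.Tendsto.pow (hx i).enorm) (Or.inr ENNReal.coe_ne_top)

/-- Fatou's lemma for weighted `ℓ²` norms. -/
theorem weighted_tsum_le_of_tendsto [l.NeBot] {x : α → ι → ℂ} {x₀ : ι → ℂ}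
    (hx : ∀ i, Tendsto (fun a => x a i) l (𝓝 (x₀ i))) {B : ℝ≥0∞}
    (hB : ∀ᶠ a in l, ∑' i, (c i : ℝ≥0∞) * ‖x a i‖ₑ ^ 2 ≤ B) :
    ∑' i, (c i : ℝ≥0∞) * ‖x₀ i‖ₑ ^ 2 ≤ B := by
  rw [ENNReal.tsum_eq_iSup_sum]
  refine iSup_le fun s => ?_
  refine le_of_tendsto (tendsto_weighted_sum hx s) ?_
  filter_upwards [hB] with a ha
  exact (ENNReal.sum_le_tsum s).trans ha

/-- Lower semicontinuity of weighted `ℓ²` norms along coordinatewise convergence. -/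
theorem weighted_eventually_le_add {x : α → ι → ℂ} {x₀ : ι → ℂ}
    (hx : ∀ i, Tendsto (fun a => x a i) l (𝓝 (x₀ i)))
    (h0 : ∑' i, (c i : ℝ≥0∞) * ‖x₀ i‖ₑ ^ 2 ≠ ⊤) {ε : ℝ≥0∞} (hε : 0 < ε) :
    ∀ᶠ a in l, ∑' i, (c i : ℝ≥0∞) * ‖x₀ i‖ₑ ^ 2 ≤ ∑' i, (c i : ℝ≥0∞) * ‖x a i‖ₑ ^ 2 + ε := by
  rcases eq_or_ne (∑' i, (c i : ℝ≥0∞) * ‖x₀ i‖ₑ ^ 2) 0 with hz | hz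
  · simp [hz]
  have hlt := ENNReal.sub_lt_self h0 hz hε.ne'
  nth_rewrite 2 [ENNReal.tsum_eq_iSup_sum] at hlt
  obtain ⟨s, hs⟩ := lt_iSup_iff.mp hlt
  filter_upwards [(tendsto_weighted_sum hx s).eventually_const_lt hs] with a ha
  exact tsub_le_iff_right.mp (ha.le.trans (ENNReal.sum_le_tsum s))

/-- The Radon–Riesz property of weighted `ℓ²` norms: coordinatewise convergence together with
convergence of the norms is convergence in norm. -/
theorem weighted_tendsto_of_tendsto {x : α → ι → ℂ} {x₀ : ι → ℂ}
    (hx : ∀ i, Tendsto (fun a => x a i) l (𝓝 (x₀ i)))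
    (h0 : ∑' i, (c i : ℝ≥0∞) * ‖x₀ i‖ₑ ^ 2 ≠ ⊤)
    (hS : Tendsto (fun a => ∑' i, (c i : ℝ≥0∞) * ‖x a i‖ₑ ^ 2) l
      (𝓝 (∑' i, (c i : ℝ≥0∞) * ‖x₀ i‖ₑ ^ 2))) :
    Tendsto (fun a => ∑' i, (c i : ℝ≥0∞) * ‖x a i - x₀ i‖ₑ ^ 2) l (𝓝 0) := by
  rw [ENNReal.tendsto_nhds_zero]
  intro ε' hε'
  rcases eq_or_ne ε' ⊤ with rfl | hε't
  · simp
  obtain ⟨ε, hε, hε9⟩ : ∃ ε : ℝ≥0∞, 0 < ε ∧ 9 * ε ≤ ε' := by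
    refine ⟨ε' / 9, ENNReal.div_pos hε'.ne' (by norm_num), ?_⟩
    rw [ENNReal.mul_div_cancel (by norm_num) (by norm_num)]
  have hεt : ε ≠ ⊤ := by
    rintro rfl
    simp at hε9
    exact hε't hε9
  set S₀ := ∑' i, (c i : ℝ≥0∞) * ‖x₀ i‖ₑ ^ 2 with hS₀
  have htail := ENNReal.tendsto_tsum_compl_atTop_zero h0
  rw [ENNReal.tendsto_nhds_zero] at htail
  obtain ⟨s, hs⟩ := (htail ε hε).exists
  have hsplit : ∀ f : ι → ℝ≥0∞, ∑' i, f i = ∑ i ∈ s, f i + ∑' i : {i // i ∉ s}, f i := by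
    intro f
    rw [← Finset.tsum_subtype]
    exact (ENNReal.summable.tsum_add_tsum_compl (s := (s : Set ι)) ENNReal.summable).symm
  have hd : Tendsto (fun a => ∑ i ∈ s, (c i : ℝ≥0∞) * ‖x a i - x₀ i‖ₑ ^ 2) l (𝓝 0) := by
    have := tendsto_weighted_sum (c := c) (l := l) (x := fun a i => x a i - x₀ i)
      (x₀ := fun _ => 0) (fun i => by simpa using (hx i).sub_const (x₀ i)) s
    simpa using this
  have hfin : ∑ i ∈ s, (c i : ℝ≥0∞) * ‖x₀ i‖ₑ ^ 2 ≠ ⊤ :=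
    ne_top_of_le_ne_top h0 (ENNReal.sum_le_tsum s)
  have h1 : ∀ᶠ a in l, ∑' i, (c i : ℝ≥0∞) * ‖x a i‖ₑ ^ 2 ≤ S₀ + ε := by
    exact (hS.eventually_lt_const (ENNReal.lt_add_right h0 hε.ne')).mono fun _ h => h.le
  have h2 : ∀ᶠ a in l, ∑ i ∈ s, (c i : ℝ≥0∞) * ‖x₀ i‖ₑ ^ 2 ≤
      ∑ i ∈ s, (c i : ℝ≥0∞) * ‖x a i‖ₑ ^ 2 + ε := by
    have ht := (tendsto_weighted_sum (c := c) hx s).add (tendsto_const_nhds (x := ε))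
    exact (ht.eventually_const_lt (ENNReal.lt_add_right hfin hε.ne')).mono fun _ h => h.le
  have h3 : ∀ᶠ a in l, ∑ i ∈ s, (c i : ℝ≥0∞) * ‖x a i - x₀ i‖ₑ ^ 2 ≤ ε :=
    (ENNReal.tendsto_nhds_zero.mp hd) ε hε
  filter_upwards [h1, h2, h3] with a h1 h2 h3
  have hta : ∑' i : {i // i ∉ s}, (c i : ℝ≥0∞) * ‖x a i‖ₑ ^ 2 ≤ 3 * ε := by
    have hA : ∑ i ∈ s, (c i : ℝ≥0∞) * ‖x a i‖ₑ ^ 2 ≠ ⊤ := by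
      refine ne_top_of_le_ne_top (ENNReal.add_ne_top.mpr ⟨h0, hεt⟩) (le_trans ?_ h1)
      exact ENNReal.sum_le_tsum s
    rw [hsplit] at h1
    have h4 : S₀ ≤ ∑ i ∈ s, (c i : ℝ≥0∞) * ‖x a i‖ₑ ^ 2 + ε + ε := by
      rw [hS₀, hsplit]
      exact add_le_add h2 hs
    have h5 := h1.trans (add_le_add_left h4 ε)
    rw [add_assoc, add_assoc, ENNReal.add_le_add_iff_left hA] at h5
    refine h5.trans (le_of_eq ?_)
    ring
  rw [hsplit]
  calc _ ≤ ε + ∑' i : {i // i ∉ s}, (2 * ((c i : ℝ≥0∞) * ‖x a i‖ₑ ^ 2) +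
        2 * ((c i : ℝ≥0∞) * ‖x₀ i‖ₑ ^ 2)) := by
        refine add_le_add h3 (ENNReal.tsum_le_tsum fun i => ?_)
        calc _ ≤ (c i : ℝ≥0∞) * (2 * (‖x a i‖ₑ ^ 2 + ‖x₀ i‖ₑ ^ 2)) := by
              gcongr; exact enorm_sub_sq_le _ _
          _ = _ := by ring
    _ ≤ ε + (2 * (3 * ε) + 2 * ε) := by
        rw [ENNReal.tsum_add, ENNReal.tsum_mul_left, ENNReal.tsum_mul_left]
        gcongr
    _ = 9 * ε := by ring
    _ ≤ ε' := hε9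

end weighted

/-! ### Fourier coefficients and projections onto sets of modes -/

theorem coeff_eq_inner (f : L2) (n : ℤ) : coeff f n = inner ℂ (fourierBasis n : L2) f := by
  rw [← repr_eq_coeff, HilbertBasis.repr_apply_apply]

/-- The Fourier coefficient as a continuous linear form. -/
def coeffL (n : ℤ) : L2 →L[ℂ] ℂ := innerSL ℂ (fourierBasis n : L2)

@[simp]
theorem coeffL_apply (n : ℤ) (f : L2) : coeffL n f = coeff f n := (coeff_eq_inner f n).symm

theorem coeff_sub (f g : L2) (n : ℤ) : coeff (f - g) n = coeff f n - coeff g n := by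
  simp [← coeffL_apply]

theorem coeff_sum {ι : Type*} (s : Finset ι) (f : ι → L2) (n : ℤ) :
    coeff (∑ i ∈ s, f i) n = ∑ i ∈ s, coeff (f i) n := by
  simp [← coeffL_apply]

theorem coeff_fourierLp (m n : ℤ) :
    coeff (fourierLp 2 m : L2) n = if n = m then 1 else 0 := by
  rw [coeff_eq_inner, ← coe_fourierBasis]
  have := (orthonormal_iff_ite.mp (fourierBasis (T := 2 * Real.pi)).orthonormal) n m
  exact this

/-- Parseval's identity. -/
theorem hasSum_coeff_inner (f g : L2) :
    HasSum (fun n => star (coeff f n) * coeff g n) (inner ℂ f g) := by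
  have := fourierBasis.hasSum_inner_mul_inner f g
  have e : (fun n => star (coeff f n) * coeff g n) = fun n =>
      inner ℂ f (fourierBasis n : L2) * inner ℂ (fourierBasis n : L2) g := by
    funext n
    rw [coeff_eq_inner, coeff_eq_inner, ← starRingEnd_apply, inner_conj_symm]
  rw [e]
  exact this

/-- The weighted energy `∑ w(n) |f̂(n)|²`, with values in `[0, ∞]`. -/
def wsum (w : ℤ → ℝ≥0) (f : L2) : ℝ≥0∞ := ∑' n, (w n : ℝ≥0∞) * ‖coeff f n‖ₑ ^ 2

/-- Parseval's identity for the norm. -/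
theorem wsum_one (f : L2) : wsum 1 f = ‖f‖ₑ ^ 2 := by
  have h := hasSum_coeff_inner f f
  have h2 := (Complex.hasSum_re h)
  have h3 : ∀ n, (star (coeff f n) * coeff f n).re = ((‖coeff f n‖₊ ^ 2 : ℝ≥0) : ℝ) := by
    intro n
    rw [Complex.star_def, Complex.conj_mul']
    simp [← Complex.ofReal_pow]
  simp only [h3] at h2
  have h4 : (inner ℂ f f).re = ((‖f‖₊ ^ 2 : ℝ≥0) : ℝ) := by
    rw [inner_self_eq_norm_sq_to_K]
    simp [← Complex.ofReal_pow]
  rw [h4, NNReal.hasSum_coe] at h2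
  have h5 := (ENNReal.hasSum_coe.mpr h2).tsum_eq
  simp only [wsum, Pi.one_apply, ENNReal.coe_one, one_mul, enorm_eq_nnnorm]
  exact_mod_cast h5

theorem wsum_mono {w w' : ℤ → ℝ≥0} {f : L2} (h : ∀ n, coeff f n ≠ 0 → w n ≤ w' n) :
    wsum w f ≤ wsum w' f := by
  refine ENNReal.tsum_le_tsum fun n => ?_
  by_cases hn : coeff f n = 0
  · simp [hn]
  · gcongr; exact h n hn

theorem wsum_const_mul (c : ℝ≥0) (w : ℤ → ℝ≥0) (f : L2) :
    wsum (fun n => c * w n) f = c * wsum w f := by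
  simp only [wsum, ENNReal.coe_mul, mul_assoc, ENNReal.tsum_mul_left]

theorem wsum_mono_coeff {w : ℤ → ℝ≥0} {f g : L2} (h : ∀ n, ‖coeff f n‖ ≤ ‖coeff g n‖) :
    wsum w f ≤ wsum w g := by
  refine ENNReal.tsum_le_tsum fun n => ?_
  gcongr
  exact enorm_le_iff_norm_le.mpr (h n)

/-- The orthogonal projection of `L²` onto the functions with Fourier modes in `A`. -/
def modeProj (A : Set ℤ) : L2 →L[ℂ] L2 :=
  open Classical in
  have hmem : ∀ f : L2, Memℓp (fun n : ℤ => if n ∈ A then coeff f n else 0) 2 := fun f => by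
    have h : Memℓp (fun n : ℤ => coeff f n) 2 := by
      simpa only [← repr_eq_coeff] using lp.memℓp (fourierBasis.repr f)
    have h2 : 0 < (2 : ℝ≥0∞).toReal := by norm_num
    refine (memℓp_gen_iff h2).mpr (((memℓp_gen_iff h2).mp h).of_nonneg_of_le
      (fun n => by positivity) fun n => ?_)
    split_ifs
    · exact le_rfl
    · simp
  let g : L2 → L2 := fun f => fourierBasis.repr.symm ⟨_, hmem f⟩
  have hg : ∀ f n, coeff (g f) n = if n ∈ A then coeff f n else 0 := fun f n => by
    rw [← repr_eq_coeff, LinearIsometryEquiv.apply_symm_apply]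
  LinearMap.mkContinuous
    { toFun := g
      map_add' := fun f f' => coeff_ext fun n => by
        simp only [hg, coeff_add]; split_ifs <;> simp
      map_smul' := fun c f => coeff_ext fun n => by
        simp only [hg, coeff_smul, RingHom.id_apply]; split_ifs <;> simp } 1 fun f => by
    have : wsum 1 (g f) ≤ wsum 1 f := wsum_mono_coeff fun n => by
      rw [hg]; split_ifs <;> simp
    rw [wsum_one, wsum_one, ENNReal.pow_le_pow_left_iff two_ne_zero, enorm_le_iff_norm_le] at this
    simpa using this

open Classical in
theorem coeff_modeProj (A : Set ℤ) (f : L2) (n : ℤ) :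
    coeff (modeProj A f) n = if n ∈ A then coeff f n else 0 := by
  rw [← repr_eq_coeff]
  simp only [modeProj]
  exact congrFun (congrArg Subtype.val (fourierBasis.repr.apply_symm_apply _)) n

theorem coeff_modeProj_of_mem {A : Set ℤ} {n : ℤ} (hn : n ∈ A) (f : L2) :
    coeff (modeProj A f) n = coeff f n := by
  classical
  rw [coeff_modeProj, if_pos hn]

theorem coeff_modeProj_of_notMem {A : Set ℤ} {n : ℤ} (hn : n ∉ A) (f : L2) :
    coeff (modeProj A f) n = 0 := by
  classical
  rw [coeff_modeProj, if_neg hn]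

theorem norm_coeff_modeProj_le (A : Set ℤ) (f : L2) (n : ℤ) :
    ‖coeff (modeProj A f) n‖ ≤ ‖coeff f n‖ := by
  classical
  rw [coeff_modeProj]
  split_ifs <;> simp

theorem wsum_modeProj_le (A : Set ℤ) (w : ℤ → ℝ≥0) (f : L2) :
    wsum w (modeProj A f) ≤ wsum w f :=
  wsum_mono_coeff (norm_coeff_modeProj_le A f)

theorem szego_eq_modeProj (f : L2) : szego f = modeProj (Set.Ici 0) f := by
  classical
  refine coeff_ext fun n => ?_
  rw [coeff_szego, coeff_modeProj]
  simp only [Set.mem_Ici]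

theorem modeProj_eq_self {A : Set ℤ} {f : L2} (h : ∀ n ∉ A, coeff f n = 0) :
    modeProj A f = f := by
  classical
  refine coeff_ext fun n => ?_
  rw [coeff_modeProj]
  split_ifs with hn
  · rfl
  · exact (h n hn).symm

theorem modeProj_add_compl (A : Set ℤ) (f : L2) : modeProj A f + modeProj Aᶜ f = f := by
  classical
  refine coeff_ext fun n => ?_
  rw [coeff_add, coeff_modeProj, coeff_modeProj]
  by_cases hn : n ∈ A <;> simp [hn]

theorem inner_modeProj_left (A : Set ℤ) (f g : L2) :
    inner ℂ (modeProj A f) g = inner ℂ f (modeProj A g) := by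
  classical
  rw [← (hasSum_coeff_inner _ _).tsum_eq, ← (hasSum_coeff_inner _ _).tsum_eq]
  refine tsum_congr fun n => ?_
  rw [coeff_modeProj, coeff_modeProj]
  split_ifs <;> simp

theorem modeProj_finset (s : Finset ℤ) (f : L2) :
    modeProj s f = ∑ n ∈ s, coeff f n • (fourierLp 2 n : L2) := by
  classical
  refine coeff_ext fun n => ?_
  rw [coeff_modeProj, coeff_sum]
  simp [coeff_smul, coeff_fourierLp]

theorem tendsto_modeProj {α : Type*} {l : Filter α} {A : α → Set ℤ} {f : L2}
    (hA : ∀ n, coeff f n ≠ 0 → ∀ᶠ a in l, n ∈ A a) :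
    Tendsto (fun a => modeProj (A a) f) l (𝓝 f) := by
  classical
  have h0 : ∀ n, Tendsto (fun a => coeff (modeProj (A a) f) n) l (𝓝 (coeff f n)) := by
    intro n
    by_cases hn : coeff f n = 0
    · have : ∀ a, coeff (modeProj (A a) f) n = coeff f n := fun a => by
        rw [coeff_modeProj, hn]; simp
      simp only [this]
      exact tendsto_const_nhds
    · refine tendsto_const_nhds.congr' ?_
      filter_upwards [hA n hn] with a ha
      rw [coeff_modeProj_of_mem ha]
  have hfin : wsum 1 f ≠ ⊤ := by
    rw [wsum_one]; exact ENNReal.pow_ne_top enorm_ne_top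
  have hS : Tendsto (fun a => wsum 1 (modeProj (A a) f)) l (𝓝 (wsum 1 f)) := by
    rw [ENNReal.tendsto_nhds hfin]
    intro ε hε
    filter_upwards [weighted_eventually_le_add (c := 1) h0 hfin hε] with a ha
    exact ⟨tsub_le_iff_right.mpr ha, (wsum_modeProj_le _ _ _).trans le_self_add⟩
  have h := weighted_tendsto_of_tendsto (c := 1) h0 hfin hS
  refine tendsto_of_enorm_sub_sq (h.congr fun a => ?_)
  rw [← wsum_one]
  simp only [wsum, coeff_sub]

/-! ### Products and convolutions -/

/-- Pointwise complex conjugation on `L^p` of the torus, as a real-linear continuous map. -/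
def conjLp (p : ℝ≥0∞) [Fact (1 ≤ p)] :
    Lp ℂ p (AddCircle.haarAddCircle : Measure Torus) →L[ℝ]
      Lp ℂ p (AddCircle.haarAddCircle : Measure Torus) :=
  (Complex.conjCLE : ℂ →L[ℝ] ℂ).compLpL p AddCircle.haarAddCircle

theorem coeFn_conjLp {p : ℝ≥0∞} [Fact (1 ≤ p)]
    (f : Lp ℂ p (AddCircle.haarAddCircle : Measure Torus)) :
    conjLp p f =ᵐ[AddCircle.haarAddCircle] fun x => star (f x) := by
  filter_upwards [(Complex.conjCLE : ℂ →L[ℝ] ℂ).coeFn_compLpL f] with x hx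
  rw [conjLp, hx]
  simp

theorem coeff_conjLp (f : L2) (n : ℤ) : coeff (conjLp 2 f) n = star (coeff f (-n)) := by
  rw [coeff, coeff, fourierCoeff, fourierCoeff, Complex.star_def, ← integral_conj]
  refine integral_congr_ae ?_
  filter_upwards [coeFn_conjLp f] with x hx
  rw [hx]
  simp

/-- The Fourier coefficients of a product are the convolution of the Fourier coefficients, by
Parseval's identity for `\bar f` and `e^{-inx} g`. -/
theorem hasSum_fourierCoeff_mul (f g : L2) (n : ℤ) :
    HasSum (fun k => coeff f k * coeff g (n - k)) (fourierCoeff (fun x => f x * g x) n) := by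
  have hm : MemLp (fun x => fourier (-n) x * g x) 2 (AddCircle.haarAddCircle : Measure Torus) := by
    refine (Lp.memLp g).of_le
      ((map_continuous (fourier (-n))).aestronglyMeasurable.mul (Lp.aestronglyMeasurable g)) ?_
    refine ae_of_all _ fun x => ?_
    rw [norm_mul, fourier_apply, Circle.norm_coe, one_mul]
  set G : L2 := hm.toLp with hG
  have hGc : ∀ k, coeff G k = coeff g (k + n) := by
    intro k
    rw [coeff, coeff, fourierCoeff, fourierCoeff]
    refine integral_congr_ae ?_
    filter_upwards [hm.coeFn_toLp] with x hx
    rw [hG, hx, smul_eq_mul, smul_eq_mul, neg_add, fourier_add, mul_assoc]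
  have h := hasSum_coeff_inner (conjLp 2 f) G
  have e : inner ℂ (conjLp 2 f) G = fourierCoeff (fun x => f x * g x) n := by
    rw [L2.inner_def, fourierCoeff]
    refine integral_congr_ae ?_
    filter_upwards [hm.coeFn_toLp, coeFn_conjLp f] with x hx hx'
    rw [hG, hx, hx', RCLike.inner_apply, smul_eq_mul]
    simp only [← starRingEnd_apply, starRingEnd_self_apply]
    ring
  rw [e, ← (Equiv.neg ℤ).hasSum_iff] at h
  refine h.congr_fun fun k => ?_
  simp only [Function.comp_apply, Equiv.neg_apply, coeff_conjLp, hGc, star_star, neg_neg]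
  rw [add_comm, sub_eq_add_neg]

/-- The convolution of two sequences indexed by `ℤ`, with values in `[0, ∞]`. -/
def conv (a b : ℤ → ℝ≥0∞) (n : ℤ) : ℝ≥0∞ := ∑' k, a k * b (n - k)

/-- The sequence of absolute values of the Fourier coefficients. -/
def absCoeff (f : L2) (n : ℤ) : ℝ≥0∞ := ‖coeff f n‖ₑ

theorem conv_mono {a a' b b' : ℤ → ℝ≥0∞} (ha : ∀ n, a n ≤ a' n) (hb : ∀ n, b n ≤ b' n) (n : ℤ) :
    conv a b n ≤ conv a' b' n :=
  ENNReal.tsum_le_tsum fun k => mul_le_mul' (ha k) (hb (n - k))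

theorem absCoeff_le_conv {f g h : L2} (e : h =ᵐ[AddCircle.haarAddCircle] fun x => f x * g x)
    (n : ℤ) : absCoeff h n ≤ conv (absCoeff f) (absCoeff g) n := by
  rw [absCoeff, coeff, fourierCoeff_congr_ae e, ← (hasSum_fourierCoeff_mul f g n).tsum_eq]
  refine enorm_tsum_le_tsum_enorm.trans (le_of_eq ?_)
  simp only [enorm_mul]
  rfl

theorem tsum_sub_left (f : ℤ → ℝ≥0∞) (n : ℤ) : ∑' k, f (n - k) = ∑' k, f k :=
  (Equiv.subLeft n).tsum_eq f

theorem tsum_sub_right (f : ℤ → ℝ≥0∞) (n : ℤ) : ∑' k, f (k - n) = ∑' k, f k :=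
  (Equiv.subRight n).tsum_eq f

theorem conv_comm (a b : ℤ → ℝ≥0∞) (n : ℤ) : conv a b n = conv b a n := by
  rw [conv, ← tsum_sub_left _ n]
  simp only [sub_sub_cancel, conv, mul_comm]

theorem tsum_conv (a b : ℤ → ℝ≥0∞) : ∑' n, conv a b n = (∑' n, a n) * ∑' n, b n := by
  simp only [conv]
  rw [ENNReal.tsum_comm]
  simp only [ENNReal.tsum_mul_left, tsum_sub_right, ENNReal.tsum_mul_right]

/-! ### The embedding of `H^{1/2}` into `L⁶` -/

/-- The weight `1 + |n|`, which defines the `H^{1/2}` energy preserved by the flow. -/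
def wq (n : ℤ) : ℝ≥0 := 1 + n.natAbs

theorem one_le_wq (n : ℤ) : 1 ≤ wq n := by simp [wq]

theorem wq_ne_zero (n : ℤ) : wq n ≠ 0 := (zero_lt_one.trans_le (one_le_wq n)).ne'

/-- The summable sequence `(1 + |n|)^{-3/2}`. -/
def decay (n : ℤ) : ℝ≥0 := (wq n)⁻¹ * ((wq n)⁻¹) ^ (1 / 2 : ℝ)

theorem decay_natCast (n : ℕ) : (decay n : ℝ) = ((n + 1 : ℕ) : ℝ) ^ (-(3 / 2) : ℝ) := by
  have hp : (0 : ℝ) < n + 1 := by positivity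
  have e : ((wq n : ℝ≥0) : ℝ) = n + 1 := by simp [wq, add_comm]
  rw [decay, NNReal.coe_mul, NNReal.coe_rpow, NNReal.coe_inv, e, Real.inv_rpow hp.le,
    ← Real.rpow_neg hp.le, ← Real.rpow_neg_one, ← Real.rpow_add hp, Nat.cast_add_one]
  norm_num

theorem decay_neg (n : ℤ) : decay (-n) = decay n := by
  rw [decay, decay, wq, wq, Int.natAbs_neg]

theorem summable_decay : Summable decay := by
  have h0 : Summable fun n : ℕ => (n : ℝ) ^ (-(3 / 2) : ℝ) :=
    Real.summable_nat_rpow.mpr (by norm_num)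
  have h1 : Summable fun n : ℕ => (decay n : ℝ) :=
    ((summable_nat_add_iff 1).mpr h0).congr fun n => (decay_natCast n).symm
  rw [← NNReal.summable_coe]
  refine Summable.of_nat_of_neg h1 ?_
  simpa only [decay_neg] using h1

theorem tsum_decay_ne_top : ∑' n, (decay n : ℝ≥0∞) ≠ ⊤ :=
  ENNReal.tsum_coe_ne_top_iff_summable.mpr summable_decay

theorem mul_mul_le_of_le {a b c : ℝ≥0} (h1 : c ≤ a) (h2 : c ≤ b) :
    a * b * c ≤ (a * a ^ (1 / 2 : ℝ)) * (b * b ^ (1 / 2 : ℝ)) := by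
  have : c ≤ a ^ (1 / 2 : ℝ) * b ^ (1 / 2 : ℝ) := by
    calc c = c ^ (1 / 2 : ℝ) * c ^ (1 / 2 : ℝ) := by
          rw [← NNReal.sqrt_eq_rpow, NNReal.mul_self_sqrt]
      _ ≤ _ := by gcongr
  calc a * b * c ≤ a * b * (a ^ (1 / 2 : ℝ) * b ^ (1 / 2 : ℝ)) := by gcongr
    _ = _ := by ring

theorem inv_mul_le_decay (k l m : ℤ) :
    (wq k)⁻¹ * (wq l)⁻¹ * (wq m)⁻¹ ≤ decay k * decay l + decay l * decay m + decay k * decay m := by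
  have key : ((wq m)⁻¹ ≤ (wq k)⁻¹ ∧ (wq m)⁻¹ ≤ (wq l)⁻¹) ∨
      ((wq k)⁻¹ ≤ (wq l)⁻¹ ∧ (wq k)⁻¹ ≤ (wq m)⁻¹) ∨
      ((wq l)⁻¹ ≤ (wq k)⁻¹ ∧ (wq l)⁻¹ ≤ (wq m)⁻¹) := by
    grind
  rcases key with h | h | h
  · exact (mul_mul_le_of_le h.1 h.2).trans (by rw [add_assoc]; exact le_self_add)
  · rw [mul_rotate]
    refine (mul_mul_le_of_le h.1 h.2).trans ?_
    rw [add_right_comm]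
    exact le_add_self
  · rw [mul_right_comm]
    exact (mul_mul_le_of_le h.1 h.2).trans le_add_self

/-- The constant bounding `∑_{k,l} (1+|k|)⁻¹ (1+|l|)⁻¹ (1+|n-k-l|)⁻¹` uniformly in `n`. -/
def decayConst : ℝ≥0∞ := 3 * (∑' n, (decay n : ℝ≥0∞)) ^ 2

theorem decayConst_ne_top : decayConst ≠ ⊤ :=
  ENNReal.mul_ne_top (by norm_num) (ENNReal.pow_ne_top tsum_decay_ne_top)

theorem tsum_inv_mul_le (n : ℤ) :
    ∑' q : ℤ × ℤ, ((((wq q.1)⁻¹ * (wq q.2)⁻¹ * (wq (n - q.1 - q.2))⁻¹ : ℝ≥0)) : ℝ≥0∞) ≤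
      decayConst := by
  set G := ∑' n, (decay n : ℝ≥0∞) with hG
  have h1 : ∑' q : ℤ × ℤ, (decay q.1 : ℝ≥0∞) * decay q.2 = G ^ 2 := by
    rw [ENNReal.tsum_prod']
    simp only [ENNReal.tsum_mul_left, ENNReal.tsum_mul_right, sq, ← hG]
  have h2 : ∑' q : ℤ × ℤ, (decay q.2 : ℝ≥0∞) * decay (n - q.1 - q.2) = G ^ 2 := by
    rw [ENNReal.tsum_prod', ENNReal.tsum_comm]
    simp only [ENNReal.tsum_mul_left]
    have : ∀ b : ℤ, ∑' a : ℤ, (decay (n - a - b) : ℝ≥0∞) = G := fun b => by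
      have := tsum_sub_left (fun a => (decay a : ℝ≥0∞)) (n - b)
      rw [hG, ← this]
      refine tsum_congr fun a => ?_
      rw [sub_right_comm]
    simp only [this, ENNReal.tsum_mul_right, sq, ← hG]
  have h3 : ∑' q : ℤ × ℤ, (decay q.1 : ℝ≥0∞) * decay (n - q.1 - q.2) = G ^ 2 := by
    rw [ENNReal.tsum_prod']
    have : ∀ a : ℤ, ∑' b : ℤ, (decay (n - a - b) : ℝ≥0∞) = G := fun a =>
      tsum_sub_left (fun a => (decay a : ℝ≥0∞)) (n - a)
    simp only [ENNReal.tsum_mul_left, this, ENNReal.tsum_mul_right, sq, ← hG]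
  calc _ ≤ ∑' q : ℤ × ℤ, ((decay q.1 : ℝ≥0∞) * decay q.2 + (decay q.2 : ℝ≥0∞) *
        decay (n - q.1 - q.2) + (decay q.1 : ℝ≥0∞) * decay (n - q.1 - q.2)) := by
        refine ENNReal.tsum_le_tsum fun q => ?_
        exact_mod_cast inv_mul_le_decay _ _ _
    _ = decayConst := by
        rw [ENNReal.tsum_add, ENNReal.tsum_add, h1, h2, h3, decayConst]
        ring

/-- A triple convolution is in `ℓ²` when each factor has finite `H^{1/2}` energy. -/
theorem tsum_conv_conv_sq_le (a : ℤ → ℝ≥0∞) :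
    ∑' n, conv a (conv a a) n ^ 2 ≤ decayConst * (∑' n, (wq n : ℝ≥0∞) * a n ^ 2) ^ 3 := by
  set B : ℤ → ℝ≥0∞ := fun n => (wq n : ℝ≥0∞) * a n ^ 2 with hB
  set r : ℤ → ℝ≥0∞ := fun n => (((wq n)⁻¹ ^ (1 / 2 : ℝ) : ℝ≥0) : ℝ≥0∞) with hr
  set s : ℤ → ℝ≥0∞ := fun n => ((wq n ^ (1 / 2 : ℝ) : ℝ≥0) : ℝ≥0∞) with hs
  have hrs : ∀ n, r n * s n = 1 := fun n => by
    simp only [hr, hs, ← ENNReal.coe_mul, ← NNReal.mul_rpow, inv_mul_cancel₀ (wq_ne_zero n),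
      NNReal.one_rpow, ENNReal.coe_one]
  have hr2 : ∀ n, r n ^ 2 = ((wq n)⁻¹ : ℝ≥0) := fun n => by
    simp only [hr]
    rw [← ENNReal.coe_pow, ← NNReal.sqrt_eq_rpow, NNReal.sq_sqrt]
  have hs2 : ∀ n, s n ^ 2 = wq n := fun n => by
    simp only [hs]
    rw [← ENNReal.coe_pow, ← NNReal.sqrt_eq_rpow, NNReal.sq_sqrt]
  have hpt : ∀ n, conv a (conv a a) n ^ 2 ≤
      decayConst * ∑' q : ℤ × ℤ, B q.1 * B q.2 * B (n - q.1 - q.2) := by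
    intro n
    have e : conv a (conv a a) n = ∑' q : ℤ × ℤ, (r q.1 * r q.2 * r (n - q.1 - q.2)) *
        ((s q.1 * a q.1) * (s q.2 * a q.2) * (s (n - q.1 - q.2) * a (n - q.1 - q.2))) := by
      rw [ENNReal.tsum_prod', conv]
      refine tsum_congr fun k => ?_
      rw [conv, ← ENNReal.tsum_mul_left]
      refine tsum_congr fun l => ?_
      calc a k * (a l * a (n - k - l)) = (r k * s k) * (r l * s l) *
            (r (n - k - l) * s (n - k - l)) * (a k * (a l * a (n - k - l))) := by
            rw [hrs, hrs, hrs]; ring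
        _ = _ := by ring
    rw [e]
    refine (ENNReal_tsum_mul_sq_le _ _).trans (mul_le_mul' ?_ (le_of_eq ?_))
    · refine le_trans (le_of_eq (tsum_congr fun q => ?_)) (tsum_inv_mul_le n)
      rw [mul_pow, mul_pow, hr2, hr2, hr2]
      push_cast
      rfl
    · refine tsum_congr fun q => ?_
      simp only [mul_pow, hs2, hB]
  have hsum : ∑' n, ∑' q : ℤ × ℤ, B q.1 * B q.2 * B (n - q.1 - q.2) = (∑' n, B n) ^ 3 := by
    rw [ENNReal.tsum_comm]
    have : ∀ q : ℤ × ℤ, ∑' n, B (n - q.1 - q.2) = ∑' n, B n := fun q => by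
      simp only [sub_sub]
      exact tsum_sub_right B _
    simp only [ENNReal.tsum_mul_left, this, ENNReal.tsum_mul_right]
    rw [ENNReal.tsum_prod']
    simp only [ENNReal.tsum_mul_left, ENNReal.tsum_mul_right]
    ring
  calc _ ≤ ∑' n, decayConst * ∑' q : ℤ × ℤ, B q.1 * B q.2 * B (n - q.1 - q.2) :=
        ENNReal.tsum_le_tsum hpt
    _ = _ := by rw [ENNReal.tsum_mul_left, hsum]

/-- For bounded `f` the norm `‖f‖₆⁶ = ‖f³‖₂²` is computed from the Fourier coefficients of `f³`. -/
theorem eLpNorm_six_pow_le_of_memLp_top {f : L2}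
    (hf : MemLp f ⊤ AddCircle.haarAddCircle) :
    eLpNorm f 6 AddCircle.haarAddCircle ^ 6 ≤ decayConst * wsum wq f ^ 3 := by
  have h2 : MemLp (fun x => f x * f x) 2 AddCircle.haarAddCircle := (Lp.memLp f).mul' hf
  set g : L2 := h2.toLp _ with hg
  have h3 : MemLp (fun x => f x * g x) 2 AddCircle.haarAddCircle := (Lp.memLp g).mul' hf
  set h : L2 := h3.toLp _ with hh
  have e1 : eLpNorm f 6 AddCircle.haarAddCircle ^ 6 = ‖h‖ₑ ^ 2 := by
    have e2 : ‖h‖ₑ = eLpNorm f 6 AddCircle.haarAddCircle ^ (3 : ℝ) := by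
      rw [hh, Lp.enorm_toLp]
      have := eLpNorm_norm_rpow (p := 2) (q := 3) (μ := AddCircle.haarAddCircle) f (by norm_num)
      have e6 : (2 : ℝ≥0∞) * ENNReal.ofReal 3 = 6 := by
        rw [ENNReal.ofReal_ofNat]; norm_num
      rw [e6] at this
      rw [← this]
      refine eLpNorm_congr_norm_ae ?_
      filter_upwards [h2.coeFn_toLp] with x hx
      rw [hg, hx]
      simp only [norm_mul, Real.rpow_ofNat, norm_pow, norm_norm]
      ring
    rw [e2]
    norm_cast
    rw [← pow_mul]
  rw [e1, ← wsum_one]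
  refine le_trans (ENNReal.tsum_le_tsum fun n => ?_) (tsum_conv_conv_sq_le (absCoeff f))
  simp only [Pi.one_apply, ENNReal.coe_one, one_mul]
  gcongr
  refine (absCoeff_le_conv h3.coeFn_toLp n).trans (conv_mono (fun _ => le_rfl) ?_ n)
  exact absCoeff_le_conv h2.coeFn_toLp

theorem memLp_top_modeProj_finset (s : Finset ℤ) (f : L2) :
    MemLp (modeProj s f : L2) ⊤ AddCircle.haarAddCircle := by
  have h : (modeProj s f : L2) =ᵐ[AddCircle.haarAddCircle]
      fun x => ∑ n ∈ s, coeff f n * fourier n x := by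
    rw [modeProj_finset]
    refine (Lp.coeFn_finsetSum s _).trans ?_
    have : ∀ᵐ x ∂(AddCircle.haarAddCircle : Measure Torus), ∀ n : ℤ,
        (coeff f n • (fourierLp 2 n : L2) : L2) x = coeff f n * fourier n x := by
      rw [ae_all_iff]
      intro n
      filter_upwards [Lp.coeFn_smul (coeff f n) (fourierLp 2 n : L2), coeFn_fourierLp 2 n]
        with x hx hx'
      rw [hx, Pi.smul_apply, hx', smul_eq_mul]
    filter_upwards [this] with x hx
    rw [Finset.sum_apply]
    exact Finset.sum_congr rfl fun n _ => hx n
  rw [memLp_congr_ae h]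
  refine memLp_finsetSum s fun n _ => ?_
  refine MemLp.const_mul ?_ _
  refine memLp_top_of_bound (map_continuous (fourier n)).aestronglyMeasurable 1 ?_
  refine ae_of_all _ fun x => ?_
  rw [fourier_apply, Circle.norm_coe]

/-- The Sobolev embedding `H^{1/2} ⊆ L⁶` on the torus. -/
theorem eLpNorm_six_pow_le (f : L2) :
    eLpNorm f 6 AddCircle.haarAddCircle ^ 6 ≤ decayConst * wsum wq f ^ 3 := by
  have ht : Tendsto (fun K : ℕ => modeProj (Finset.Ioo (-K : ℤ) K : Finset ℤ) f) atTop (𝓝 f) := by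
    refine tendsto_modeProj fun n _ => ?_
    filter_upwards [eventually_gt_atTop n.natAbs] with K hK
    rw [Finset.mem_coe, Finset.mem_Ioo]
    omega
  obtain ⟨φ, -, hφ⟩ := (tendstoInMeasure_of_tendsto_Lp ht).exists_seq_tendsto_ae
  have h := Lp.eLpNorm_lim_le_liminf_eLpNorm (p := 6)
    (fun n => Lp.aestronglyMeasurable _) f hφ
  have hb : ∀ K : ℕ, eLpNorm (modeProj (Finset.Ioo (-K : ℤ) K : Finset ℤ) f) 6
      AddCircle.haarAddCircle ≤ (decayConst * wsum wq f ^ 3) ^ (1 / 6 : ℝ) := by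
    intro K
    have := (eLpNorm_six_pow_le_of_memLp_top (memLp_top_modeProj_finset (Finset.Ioo (-K : ℤ) K)
      f)).trans (mul_le_mul' le_rfl (pow_le_pow_left' (wsum_modeProj_le _ wq f) 3))
    rw [one_div, ENNReal.le_rpow_inv_iff (by norm_num)]
    exact_mod_cast this
  have h2 : eLpNorm f 6 AddCircle.haarAddCircle ≤ (decayConst * wsum wq f ^ 3) ^ (1 / 6 : ℝ) :=
    h.trans (liminf_le_of_frequently_le' (Frequently.of_forall fun n => hb _))
  rw [one_div, ENNReal.le_rpow_inv_iff (by norm_num)] at h2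
  exact_mod_cast h2

section

/-! ### Weighted energies of matrix functions -/

/-- The weight `(1 + n²)^s` of the Sobolev norm. -/
def wsob (s : ℝ) (n : ℤ) : ℝ≥0 := (1 + (n.natAbs : ℝ≥0) ^ 2) ^ s

theorem coe_wsob (s : ℝ) (n : ℤ) : (wsob s n : ℝ) = (1 + (n : ℝ) ^ 2) ^ s := by
  rw [wsob, NNReal.coe_rpow]
  push_cast
  rw [Nat.cast_natAbs, Int.cast_abs, sq_abs]

theorem one_le_wsob {s : ℝ} (hs : 0 ≤ s) (n : ℤ) : 1 ≤ wsob s n := by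
  rw [wsob]
  exact NNReal.one_le_rpow (by simp) hs

theorem wsob_half (n : ℤ) : wsob (1 / 2) n = NNReal.sqrt (1 + (n.natAbs : ℝ≥0) ^ 2) := by
  rw [wsob, NNReal.sqrt_eq_rpow]

theorem wsob_half_le_wq (n : ℤ) : wsob (1 / 2) n ≤ wq n := by
  rw [wsob_half, wq, NNReal.sqrt_le_iff_le_sq, add_sq]
  simp only [one_pow, mul_one]
  gcongr
  exact le_self_add

theorem wq_le_wsob_half (n : ℤ) : wq n ≤ 2 * wsob (1 / 2) n := by
  rw [wsob_half, wq, two_mul]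
  refine add_le_add ?_ ?_ <;> rw [NNReal.le_sqrt_iff_sq_le] <;> simp

theorem wsum_ne_top_iff (s : ℝ) (f : L2) : wsum (wsob s) f ≠ ⊤ ↔ f ∈ sobolev s := by
  have h2 : 0 < (2 : ℝ≥0∞).toReal := by norm_num
  have e : ∀ n, (wsob s n : ℝ≥0∞) * ‖coeff f n‖ₑ ^ 2 =
      (((‖wcoeff s f n‖₊ ^ 2 : ℝ≥0)) : ℝ≥0∞) := by
    intro n
    rw [enorm_eq_nnnorm, ← ENNReal.coe_pow, ← ENNReal.coe_mul, ENNReal.coe_inj]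
    rw [← NNReal.coe_inj]
    push_cast
    have hp : (0 : ℝ) < 1 + (n : ℝ) ^ 2 := by positivity
    rw [coe_wsob, wcoeff, norm_mul, Complex.norm_real,
      Real.norm_of_nonneg (Real.rpow_nonneg hp.le _), mul_pow,
      ← Real.rpow_natCast ((1 + (n : ℝ) ^ 2) ^ (s / 2)), ← Real.rpow_mul hp.le]
    norm_num
  simp only [wsum, e]
  rw [ENNReal.tsum_coe_ne_top_iff_summable, ← NNReal.summable_coe]
  change _ ↔ Memℓp (wcoeff s f) 2
  rw [memℓp_gen_iff h2]
  simp

theorem Hs.enorm_sq_eq {s : ℝ} (f : Hs s) : ‖f‖ₑ ^ 2 = wsum (wsob s) f.toL2 := by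
  have hne : wsum (wsob s) f.toL2 ≠ ⊤ := (wsum_ne_top_iff s _).mpr f.2
  have e : ∀ n, (wsob s n : ℝ≥0∞) * ‖coeff f.toL2 n‖ₑ ^ 2 =
      ((wsob s n * ‖coeff f.toL2 n‖₊ ^ 2 : ℝ≥0) : ℝ≥0∞) := fun n => by
    push_cast; rfl
  have h := Hs.norm_sq_eq f
  simp only [wsum, e] at hne ⊢
  rw [ENNReal.tsum_coe_ne_top_iff_summable] at hne
  rw [← ENNReal.coe_tsum hne, enorm_eq_nnnorm, ← ENNReal.coe_pow, ENNReal.coe_inj, ← NNReal.coe_inj]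
  push_cast
  simpa only [coe_wsob] using h

theorem PiLp.enorm_sq_eq {ι : Type*} [Fintype ι] {β : ι → Type*}
    [∀ i, SeminormedAddCommGroup (β i)] (x : PiLp 2 β) : ‖x‖ₑ ^ 2 = ∑ i, ‖x i‖ₑ ^ 2 := by
  have h : ‖x‖₊ ^ 2 = ∑ i, ‖x i‖₊ ^ 2 := by
    rw [← NNReal.coe_inj]
    push_cast
    exact PiLp.norm_sq_eq_of_L2 β x
  simp only [enorm_eq_nnnorm]
  exact_mod_cast h

variable {M N : ℕ}

/-- The weighted energy `∑_{k,j} ∑_n w(n) |Û_{kj}(n)|²` of a matrix function. -/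
def energy (w : ℤ → ℝ≥0) (U : L2Mat M N) : ℝ≥0∞ := ∑ p, wsum w (U p)

theorem energy_eq_tsum (w : ℤ → ℝ≥0) (U : L2Mat M N) :
    energy w U = ∑' q : (Fin M × Fin N) × ℤ, (w q.2 : ℝ≥0∞) * ‖coeff (U q.1) q.2‖ₑ ^ 2 := by
  rw [ENNReal.tsum_prod', tsum_fintype]
  rfl

theorem energy_one (U : L2Mat M N) : energy 1 U = ‖U‖ₑ ^ 2 := by
  simp only [energy, wsum_one, PiLp.enorm_sq_eq]

theorem wsum_le_energy (w : ℤ → ℝ≥0) (U : L2Mat M N) (p : Fin M × Fin N) :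
    wsum w (U p) ≤ energy w U :=
  Finset.single_le_sum (f := fun p => wsum w (U p)) (fun _ _ => zero_le) (Finset.mem_univ p)

theorem energy_mono {w w' : ℤ → ℝ≥0} (h : ∀ n, w n ≤ w' n) (U : L2Mat M N) :
    energy w U ≤ energy w' U :=
  Finset.sum_le_sum fun _ _ => wsum_mono fun n _ => h n

theorem energy_const_mul (c : ℝ≥0) (w : ℤ → ℝ≥0) (U : L2Mat M N) :
    energy (fun n => c * w n) U = c * energy w U := by
  simp only [energy, wsum_const_mul, Finset.mul_sum]

theorem energy_sub_le (w : ℤ → ℝ≥0) (U V : L2Mat M N) :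
    energy w (U - V) ≤ 2 * (energy w U + energy w V) := by
  simp only [energy_eq_tsum]
  rw [← ENNReal.tsum_add, ← ENNReal.tsum_mul_left]
  refine ENNReal.tsum_le_tsum fun q => ?_
  rw [PiLp.sub_apply, coeff_sub, ← mul_add, mul_left_comm]
  gcongr
  exact enorm_sub_sq_le _ _

/-- Fatou's lemma for energies. -/
theorem energy_le_of_tendsto {α : Type*} {l : Filter α} [l.NeBot] {w : ℤ → ℝ≥0}
    {U : α → L2Mat M N} {V : L2Mat M N}
    (h : ∀ p n, Tendsto (fun a => coeff (U a p) n) l (𝓝 (coeff (V p) n))) {B : ℝ≥0∞}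
    (hB : ∀ᶠ a in l, energy w (U a) ≤ B) : energy w V ≤ B := by
  simp only [energy_eq_tsum] at hB ⊢
  exact weighted_tsum_le_of_tendsto (ι := (Fin M × Fin N) × ℤ) (c := fun q => w q.2)
    (fun q => h q.1 q.2) hB

theorem tendsto_energy_sub {α : Type*} {l : Filter α} {w : ℤ → ℝ≥0}
    {U : α → L2Mat M N} {V : L2Mat M N}
    (h : ∀ p n, Tendsto (fun a => coeff (U a p) n) l (𝓝 (coeff (V p) n)))
    (hV : energy w V ≠ ⊤) (hU : Tendsto (fun a => energy w (U a)) l (𝓝 (energy w V))) :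
    Tendsto (fun a => energy w (U a - V)) l (𝓝 0) := by
  simp only [energy_eq_tsum] at hV hU ⊢
  have := weighted_tendsto_of_tendsto (ι := (Fin M × Fin N) × ℤ) (c := fun q => w q.2)
    (fun q => h q.1 q.2) hV hU
  simpa only [PiLp.sub_apply, coeff_sub] using this

theorem tendsto_coeff {α : Type*} {l : Filter α} {U : α → L2Mat M N} {V : L2Mat M N}
    (h : Tendsto U l (𝓝 V)) (p : Fin M × Fin N) (n : ℤ) :
    Tendsto (fun a => coeff (U a p) n) l (𝓝 (coeff (V p) n)) := by
  have hc : Continuous fun U : L2Mat M N => coeffL n (U p) := by fun_prop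
  have h' := (hc.tendsto V).comp h
  simp only [coeffL_apply] at h'
  exact h'

/-- The projection of matrix functions onto the modes in `A`, entry by entry. -/
def projMat (A : Set ℤ) : L2Mat M N →L[ℂ] L2Mat M N :=
  ((PiLp.continuousLinearEquiv 2 ℂ fun _ : Fin M × Fin N => L2).symm :
      (Fin M × Fin N → L2) →L[ℂ] L2Mat M N) ∘L
    ContinuousLinearMap.pi fun p => modeProj A ∘L PiLp.proj 2 _ p

@[simp]
theorem projMat_apply (A : Set ℤ) (U : L2Mat M N) (p : Fin M × Fin N) :
    projMat A U p = modeProj A (U p) := rfl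

theorem energy_projMat_le (A : Set ℤ) (w : ℤ → ℝ≥0) (U : L2Mat M N) :
    energy w (projMat A U) ≤ energy w U :=
  Finset.sum_le_sum fun _ _ => wsum_modeProj_le A w _

theorem norm_le_iff_energy {M' N' : ℕ} {U : L2Mat M N} {V : L2Mat M' N'} :
    ‖U‖ ≤ ‖V‖ ↔ energy 1 U ≤ energy 1 V := by
  rw [energy_one, energy_one, ENNReal.pow_le_pow_left_iff two_ne_zero, enorm_le_iff_norm_le]

theorem norm_projMat_le (A : Set ℤ) (U : L2Mat M N) : ‖projMat A U‖ ≤ ‖U‖ :=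
  norm_le_iff_energy.mpr (energy_projMat_le A 1 U)

theorem szegoMat_eq_projMat (U : L2Mat M N) : szegoMat U = projMat (Set.Ici 0) U := by
  ext1 p
  exact szego_eq_modeProj _

theorem inner_projMat_left (A : Set ℤ) (U V : L2Mat M N) :
    inner ℂ (projMat A U) V = inner ℂ U (projMat A V) := by
  simp only [PiLp.inner_apply, projMat_apply, inner_modeProj_left]

theorem projMat_add_compl (A : Set ℤ) (U : L2Mat M N) : projMat A U + projMat Aᶜ U = U := by
  ext1 p
  exact modeProj_add_compl A _

theorem projMat_eq_self {A : Set ℤ} {U : L2Mat M N} (h : ∀ p, ∀ n ∉ A, coeff (U p) n = 0) :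
    projMat A U = U := by
  ext1 p
  exact modeProj_eq_self (h p)

theorem tendsto_projMat {α : Type*} {l : Filter α} {A : α → Set ℤ} {U : L2Mat M N}
    (hA : ∀ p n, coeff (U p) n ≠ 0 → ∀ᶠ a in l, n ∈ A a) :
    Tendsto (fun a => projMat (A a) U) l (𝓝 U) := by
  have h : Tendsto (fun a => fun p => modeProj (A a) (U p)) l (𝓝 fun p => U p) :=
    tendsto_pi_nhds.mpr fun p => tendsto_modeProj (hA p)
  exact ((PiLp.continuousLinearEquiv 2 ℂ fun _ : Fin M × Fin N => L2).symm.continuous.tendsto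
    _).comp h

/-! ### The Sobolev spaces of matrix functions -/

theorem HsPlusMat.enorm_sq_eq {s : ℝ} (U : HsPlusMat M N s) :
    ‖U‖ₑ ^ 2 = energy (wsob s) (toL2Mat U) := by
  rw [PiLp.enorm_sq_eq, energy]
  refine Finset.sum_congr rfl fun p _ => ?_
  exact Hs.enorm_sq_eq (U p : Hs s)

theorem toL2Mat_apply {s : ℝ} (U : HsPlusMat M N s) (p : Fin M × Fin N) :
    toL2Mat U p = Hs.toL2 (U p : Hs s) := rfl

theorem toL2Mat_add {s : ℝ} (U V : HsPlusMat M N s) :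
    toL2Mat (U + V) = toL2Mat U + toL2Mat V := by
  ext1 p; simp [toL2Mat_apply]

theorem toL2Mat_sub {s : ℝ} (U V : HsPlusMat M N s) :
    toL2Mat (U - V) = toL2Mat U - toL2Mat V := by
  ext1 p; simp [toL2Mat_apply]

theorem toL2Mat_smul {s : ℝ} (c : ℂ) (U : HsPlusMat M N s) :
    toL2Mat (c • U) = c • toL2Mat U := by
  ext1 p; simp [toL2Mat_apply]

theorem toL2Mat_injective {s : ℝ} : Function.Injective (toL2Mat (M := M) (N := N) (s := s)) := by
  intro U V h
  ext1 p
  refine Subtype.ext (Subtype.ext ?_)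
  exact congrFun (congrArg WithLp.ofLp h) p

theorem norm_le_of_energy_le {s s' : ℝ} {M' N' : ℕ} {U : HsPlusMat M N s} {V : HsPlusMat M' N' s'}
    (h : energy (wsob s) (toL2Mat U) ≤ energy (wsob s') (toL2Mat V)) : ‖U‖ ≤ ‖V‖ := by
  rw [← HsPlusMat.enorm_sq_eq, ← HsPlusMat.enorm_sq_eq, ENNReal.pow_le_pow_left_iff two_ne_zero,
    enorm_le_iff_norm_le] at h
  exact h

theorem norm_toL2Mat_le {s : ℝ} (hs : 0 ≤ s) (U : HsPlusMat M N s) : ‖toL2Mat U‖ ≤ ‖U‖ := by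
  rw [← enorm_le_iff_norm_le, ← ENNReal.pow_le_pow_left_iff two_ne_zero, ← energy_one,
    HsPlusMat.enorm_sq_eq]
  exact energy_mono (fun n => one_le_wsob hs n) _

/-- The inclusion `H^s_+ ⊆ L²` as a continuous linear map. -/
def toL2MatL {s : ℝ} (hs : 0 ≤ s) : HsPlusMat M N s →L[ℂ] L2Mat M N :=
  LinearMap.mkContinuous
    { toFun := toL2Mat
      map_add' := toL2Mat_add
      map_smul' := toL2Mat_smul } 1 fun U => by simpa using norm_toL2Mat_le hs U

theorem coeff_toL2Mat_of_neg {s : ℝ} (U : HsPlusMat M N s) (p : Fin M × Fin N) {n : ℤ}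
    (hn : n < 0) : coeff (toL2Mat U p) n = 0 := (U p).2 n hn

theorem exists_toL2Mat_eq {s : ℝ} {U : L2Mat M N} (h0 : ∀ p, ∀ n < 0, coeff (U p) n = 0)
    (h : energy (wsob s) U ≠ ⊤) : ∃ V : HsPlusMat M N s, toL2Mat V = U := by
  refine ⟨WithLp.toLp 2 fun p => ⟨⟨U p, ?_⟩, h0 p⟩, rfl⟩
  rw [← wsum_ne_top_iff]
  exact ne_top_of_le_ne_top h (wsum_le_energy _ _ _)

theorem energy_wq_le {U : HsPlusMat M N (1 / 2)} :
    energy wq (toL2Mat U) ≤ 2 * ‖U‖ₑ ^ 2 := by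
  rw [HsPlusMat.enorm_sq_eq]
  refine (energy_mono wq_le_wsob_half _).trans (le_of_eq ?_)
  exact energy_const_mul 2 _ _

theorem energy_wq_ne_top (U : HsPlusMat M N (1 / 2)) : energy wq (toL2Mat U) ≠ ⊤ :=
  ne_top_of_le_ne_top (ENNReal.mul_ne_top (by norm_num) (ENNReal.pow_ne_top enorm_ne_top))
    energy_wq_le

/-- Convergence in `H^{1/2}` follows from convergence of the Fourier coefficients and of the
energies. -/
theorem tendsto_of_tendsto_energy {α : Type*} {l : Filter α} {U : α → HsPlusMat M N (1 / 2)}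
    {V : HsPlusMat M N (1 / 2)}
    (h : ∀ p n, Tendsto (fun a => coeff (toL2Mat (U a) p) n) l (𝓝 (coeff (toL2Mat V p) n)))
    (hU : Tendsto (fun a => energy wq (toL2Mat (U a))) l (𝓝 (energy wq (toL2Mat V)))) :
    Tendsto U l (𝓝 V) := by
  refine tendsto_of_enorm_sub_sq (tendsto_of_tendsto_of_tendsto_of_le_of_le tendsto_const_nhds
    (tendsto_energy_sub h (energy_wq_ne_top V) hU) (fun _ => zero_le) fun a => ?_)
  rw [HsPlusMat.enorm_sq_eq, toL2Mat_sub]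
  exact energy_mono wsob_half_le_wq _

/-- The energy is continuous on `H^{1/2}_+`; its square root is not literally the norm, but it is
equivalent to it. -/
theorem continuous_energy_wq :
    Continuous fun U : HsPlusMat M N (1 / 2) => energy wq (toL2Mat U) := by
  refine continuous_iff_continuousAt.mpr fun V => ?_
  -- `2 ‖U‖²` minus the energy is itself a weighted energy, so the energy is both lower and upper
  -- semicontinuous
  set w' : ℤ → ℝ≥0 := fun n => 2 * wsob (1 / 2) n - wq n with hw'
  have hadd : ∀ U : HsPlusMat M N (1 / 2),
      energy wq (toL2Mat U) + energy w' (toL2Mat U) = 2 * ‖U‖ₑ ^ 2 := fun U => by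
    rw [HsPlusMat.enorm_sq_eq]
    refine Eq.trans ?_ (energy_const_mul 2 _ _)
    simp only [energy_eq_tsum]
    rw [← ENNReal.tsum_add]
    refine tsum_congr fun q => ?_
    rw [← add_mul, ← ENNReal.coe_add, hw', add_tsub_cancel_of_le (wq_le_wsob_half _)]
  have hfin : ∀ U : HsPlusMat M N (1 / 2), energy w' (toL2Mat U) ≠ ⊤ := fun U => by
    refine ne_top_of_le_ne_top (b := 2 * ‖U‖ₑ ^ 2)
      (ENNReal.mul_ne_top (by norm_num) (ENNReal.pow_ne_top enorm_ne_top)) ?_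
    rw [← hadd U]
    exact le_add_self
  have hc : ∀ p n, Tendsto (fun U : HsPlusMat M N (1 / 2) => coeff (toL2Mat U p) n) (𝓝 V)
      (𝓝 (coeff (toL2Mat V p) n)) := fun p n =>
    tendsto_coeff ((toL2MatL (by norm_num : (0 : ℝ) ≤ 1 / 2)).continuous.tendsto V) p n
  have hlow : ∀ (w : ℤ → ℝ≥0), energy w (toL2Mat V) ≠ ⊤ → ∀ ε : ℝ≥0∞, 0 < ε →
      ∀ᶠ U : HsPlusMat M N (1 / 2) in 𝓝 V, energy w (toL2Mat V) ≤ energy w (toL2Mat U) + ε := by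
    intro w hw ε hε
    simp only [energy_eq_tsum] at hw ⊢
    exact weighted_eventually_le_add (ι := (Fin M × Fin N) × ℤ) (c := fun q => w q.2)
      (fun q => hc q.1 q.2) hw hε
  refine (ENNReal.tendsto_nhds (energy_wq_ne_top V)).mpr fun ε hε => ?_
  have hε2 : 0 < ε / 2 := ENNReal.half_pos hε.ne'
  have hn : Tendsto (fun U : HsPlusMat M N (1 / 2) => 2 * ‖U‖ₑ ^ 2) (𝓝 V) (𝓝 (2 * ‖V‖ₑ ^ 2)) :=
    ENNReal.Tendsto.const_mul (ENNReal.Tendsto.pow tendsto_id.enorm) (Or.inr (by norm_num))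
  have hn2 := (ENNReal.tendsto_nhds (ENNReal.mul_ne_top (by norm_num)
    (ENNReal.pow_ne_top enorm_ne_top))).mp hn (ε / 2) hε2
  filter_upwards [hlow wq (energy_wq_ne_top V) ε hε, hlow w' (hfin V) (ε / 2) hε2, hn2]
    with U h1 h2 h3
  refine ⟨tsub_le_iff_right.mpr h1, ?_⟩
  have h4 := h3.2
  rw [← hadd, ← hadd] at h4
  have h5 : energy wq (toL2Mat U) + energy w' (toL2Mat U) ≤
      (energy wq (toL2Mat V) + ε) + energy w' (toL2Mat U) := by
    refine h4.trans ?_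
    calc _ ≤ energy wq (toL2Mat V) + (energy w' (toL2Mat U) + ε / 2) + ε / 2 := by gcongr
      _ = energy wq (toL2Mat V) + (ε / 2 + ε / 2) + energy w' (toL2Mat U) := by ring
      _ = _ := by rw [ENNReal.add_halves]
  exact (ENNReal.add_le_add_iff_right (hfin U)).mp h5

end

/-! ### The cubic nonlinearity on `H^{1/2}` -/

instance fact_one_le_six : Fact ((1 : ℝ≥0∞) ≤ 6) := ⟨by norm_num⟩

instance fact_one_le_three : Fact ((1 : ℝ≥0∞) ≤ 3) := ⟨by norm_num⟩

instance holderTriple_six_six_three : ENNReal.HolderTriple 6 6 3 where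
  inv_add_inv_eq_inv := by
    rw [← ENNReal.toReal_eq_toReal_iff' (by finiteness) (by finiteness), ENNReal.toReal_add
      (by finiteness) (by finiteness)]
    norm_num

instance holderTriple_three_six_two : ENNReal.HolderTriple 3 6 2 where
  inv_add_inv_eq_inv := by
    rw [← ENNReal.toReal_eq_toReal_iff' (by finiteness) (by finiteness), ENNReal.toReal_add
      (by finiteness) (by finiteness)]
    norm_num

/-- The constant of the embedding `H^{1/2} ⊆ L⁶`. -/
def sixConst : ℝ≥0 := decayConst.toNNReal ^ (1 / 3 : ℝ)

theorem eLpNorm_six_sq_le (f : L2) :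
    eLpNorm f 6 AddCircle.haarAddCircle ^ 2 ≤ sixConst * wsum wq f := by
  have h := ENNReal.rpow_le_rpow (eLpNorm_six_pow_le f) (show (0 : ℝ) ≤ 1 / 3 by norm_num)
  rw [ENNReal.mul_rpow_of_nonneg _ _ (by norm_num), ← ENNReal.rpow_natCast, ← ENNReal.rpow_mul,
    ← ENNReal.rpow_natCast _ 3, ← ENNReal.rpow_mul] at h
  rw [sixConst, ENNReal.coe_rpow_of_nonneg _ (by norm_num), ENNReal.coe_toNNReal decayConst_ne_top,
    ← ENNReal.rpow_natCast]
  norm_num at h ⊢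
  exact h

theorem memLp_six {f : L2} (h : wsum wq f ≠ ⊤) : MemLp f 6 AddCircle.haarAddCircle := by
  refine ⟨Lp.aestronglyMeasurable f, ?_⟩
  have := (eLpNorm_six_sq_le f).trans_lt
    (ENNReal.mul_lt_top ENNReal.coe_lt_top (lt_top_iff_ne_top.mpr h))
  by_contra hcon
  rw [not_lt, top_le_iff] at hcon
  simp [hcon] at this

theorem wsum_wq_le (f : Hs (1 / 2)) : wsum wq f.toL2 ≤ 2 * ‖f‖ₑ ^ 2 := by
  rw [Hs.enorm_sq_eq]
  refine (wsum_mono fun n _ => wq_le_wsob_half n).trans (le_of_eq ?_)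
  exact wsum_const_mul 2 _ _

theorem wsum_wq_ne_top (f : Hs (1 / 2)) : wsum wq f.toL2 ≠ ⊤ :=
  ne_top_of_le_ne_top (ENNReal.mul_ne_top (by norm_num) (ENNReal.pow_ne_top enorm_ne_top))
    (wsum_wq_le f)

/-- The embedding `H^{1/2} ⊆ L⁶` as a continuous linear map. -/
def toL6 : Hs (1 / 2) →L[ℂ] Lp ℂ 6 (AddCircle.haarAddCircle : Measure Torus) :=
  LinearMap.mkContinuous
    { toFun := fun f => (memLp_six (wsum_wq_ne_top f)).toLp _
      map_add' := fun f g => by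
        rw [← MemLp.toLp_add]
        refine MemLp.toLp_congr _ _ ?_
        rw [map_add]
        exact Lp.coeFn_add _ _
      map_smul' := fun c f => by
        rw [RingHom.id_apply, ← MemLp.toLp_const_smul]
        refine MemLp.toLp_congr _ _ ?_
        rw [map_smul]
        exact Lp.coeFn_smul _ _ } (Real.sqrt (2 * sixConst)) fun f => by
    have h : ‖(memLp_six (wsum_wq_ne_top f)).toLp _‖ₑ ^ 2 ≤
        ((2 * sixConst * ‖f‖₊ ^ 2 : ℝ≥0) : ℝ≥0∞) := by
      rw [Lp.enorm_toLp]
      refine (eLpNorm_six_sq_le _).trans ((mul_le_mul' le_rfl (wsum_wq_le f)).trans (le_of_eq ?_))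
      push_cast
      rw [← enorm_eq_nnnorm]
      ring
    have h' : ‖(memLp_six (wsum_wq_ne_top f)).toLp _‖ ^ 2 ≤ 2 * sixConst * ‖f‖ ^ 2 := by
      rw [enorm_eq_nnnorm] at h
      exact_mod_cast h
    change ‖(memLp_six (wsum_wq_ne_top f)).toLp _‖ ≤ _
    rw [← Real.sqrt_sq (norm_nonneg f), ← Real.sqrt_mul (by positivity)]
    exact Real.le_sqrt_of_sq_le h'

theorem coeFn_toL6 (f : Hs (1 / 2)) : toL6 f =ᵐ[AddCircle.haarAddCircle] f.toL2 :=
  MemLp.coeFn_toLp (memLp_six (wsum_wq_ne_top f))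

theorem enorm_toL6_sq_le (f : Hs (1 / 2)) : ‖toL6 f‖ₑ ^ 2 ≤ sixConst * wsum wq f.toL2 := by
  rw [Lp.enorm_def, eLpNorm_congr_ae (coeFn_toL6 f)]
  exact eLpNorm_six_sq_le _

/-- The real trilinear expression `f ḡ h`, from `H^{1/2}` to `L²`. -/
def tri (f g h : Hs (1 / 2)) : L2 :=
  (ContinuousLinearMap.mul ℂ ℂ).holderL AddCircle.haarAddCircle 3 6 2
    ((ContinuousLinearMap.mul ℂ ℂ).holderL AddCircle.haarAddCircle 6 6 3
      (toL6 f) (conjLp 6 (toL6 g))) (toL6 h)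

theorem coeFn_tri (f g h : Hs (1 / 2)) :
    tri f g h =ᵐ[AddCircle.haarAddCircle] fun x => f.toL2 x * star (g.toL2 x) * h.toL2 x := by
  rw [tri, ContinuousLinearMap.holderL_apply_apply, ContinuousLinearMap.holderL_apply_apply]
  filter_upwards [(ContinuousLinearMap.mul ℂ ℂ).coeFn_holder (r := 2)
    ((ContinuousLinearMap.mul ℂ ℂ).holder 3 (toL6 f) (conjLp 6 (toL6 g))) (toL6 h),
    (ContinuousLinearMap.mul ℂ ℂ).coeFn_holder (r := 3) (toL6 f) (conjLp 6 (toL6 g)),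
    coeFn_conjLp (toL6 g), coeFn_toL6 f, coeFn_toL6 g, coeFn_toL6 h] with x h1 h2 h3 h4 h5 h6
  rw [h1, ContinuousLinearMap.mul_apply', h2, ContinuousLinearMap.mul_apply', h3, h4, h5, h6]

theorem norm_conjLp_le {p : ℝ≥0∞} [Fact (1 ≤ p)]
    (f : Lp ℂ p (AddCircle.haarAddCircle : Measure Torus)) : ‖conjLp p f‖ ≤ ‖f‖ := by
  refine Lp.norm_le_norm_of_ae_le ?_
  filter_upwards [coeFn_conjLp f] with x hx
  rw [hx, norm_star]

theorem norm_tri_le (f g h : Hs (1 / 2)) : ‖tri f g h‖ ≤ ‖toL6 f‖ * ‖toL6 g‖ * ‖toL6 h‖ := by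
  rw [tri, ContinuousLinearMap.holderL_apply_apply, ContinuousLinearMap.holderL_apply_apply]
  refine (ContinuousLinearMap.norm_holder_apply_apply_le _ _ _).trans ?_
  have h1 := (ContinuousLinearMap.mul ℂ ℂ).norm_holder_apply_apply_le (r := 3)
    (toL6 f) (conjLp 6 (toL6 g))
  have hm : ‖ContinuousLinearMap.mul ℂ ℂ‖ ≤ 1 := ContinuousLinearMap.opNorm_mul_le ℂ ℂ
  have h2 : ‖(ContinuousLinearMap.mul ℂ ℂ).holder 3 (toL6 f) (conjLp 6 (toL6 g))‖ ≤
      ‖toL6 f‖ * ‖toL6 g‖ := by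
    refine h1.trans ?_
    calc _ ≤ 1 * ‖toL6 f‖ * ‖toL6 g‖ := by gcongr; exact norm_conjLp_le _
      _ = _ := by ring
  calc _ ≤ 1 * (‖toL6 f‖ * ‖toL6 g‖) * ‖toL6 h‖ := by gcongr
    _ = _ := by ring

theorem contDiff_tri {E : Type*} [NormedAddCommGroup E] [NormedSpace ℝ E] {n : WithTop ℕ∞}
    {f g h : E → Hs (1 / 2)} (hf : ContDiff ℝ n f) (hg : ContDiff ℝ n g) (hh : ContDiff ℝ n h) :
    ContDiff ℝ n fun x => tri (f x) (g x) (h x) := by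
  have h6 : ∀ {f : E → Hs (1 / 2)}, ContDiff ℝ n f → ContDiff ℝ n fun x => toL6 (f x) :=
    fun hf => (toL6.restrictScalars ℝ).contDiff.comp hf
  have hc : ContDiff ℝ n fun x => conjLp 6 (toL6 (g x)) := (conjLp 6).contDiff.comp (h6 hg)
  have h1 := (((((ContinuousLinearMap.mul ℂ ℂ).holderL AddCircle.haarAddCircle 6 6
    3).bilinearRestrictScalars ℝ).contDiff.comp (h6 hf)).clm_apply hc)
  exact ((((ContinuousLinearMap.mul ℂ ℂ).holderL AddCircle.haarAddCircle 3 6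
    2).bilinearRestrictScalars ℝ).contDiff.comp h1).clm_apply (h6 hh)

variable {M N : ℕ}

/-- The nonlinearity `U U^* U` on `H^{1/2}_+`, as an element of `L²`. -/
def cubicL2 (U : HsPlusMat M N (1 / 2)) : L2Mat M N :=
  WithLp.toLp 2 fun p => ∑ b, ∑ a, tri (U (p.1, a)) (U (b, a)) (U (b, p.2))

theorem cubicL2_apply (U : HsPlusMat M N (1 / 2)) (p : Fin M × Fin N) :
    cubicL2 U p = ∑ b, ∑ a, tri (U (p.1, a)) (U (b, a)) (U (b, p.2)) := rfl

theorem cubic_apply (U : L2Mat M N) (x : Torus) (k : Fin M) (j : Fin N) :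
    cubic U x k j = ∑ b, ∑ a, U (k, a) x * star (U (b, a) x) * U (b, j) x := by
  simp [cubic, evalMat, Matrix.mul_apply, Finset.sum_mul]

theorem coeFn_cubicL2 (U : HsPlusMat M N (1 / 2)) (p : Fin M × Fin N) :
    cubicL2 U p =ᵐ[AddCircle.haarAddCircle] fun x => cubic (toL2Mat U) x p.1 p.2 := by
  rw [cubicL2_apply]
  have h : ∀ᵐ x ∂(AddCircle.haarAddCircle : Measure Torus), ∀ (b : Fin M) (a : Fin N),
      tri (U (p.1, a)) (U (b, a)) (U (b, p.2)) x =
        toL2Mat U (p.1, a) x * star (toL2Mat U (b, a) x) * toL2Mat U (b, p.2) x := by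
    rw [ae_all_iff]
    intro b
    rw [ae_all_iff]
    exact fun a => coeFn_tri _ _ _
  have h2 : ∀ᵐ x ∂(AddCircle.haarAddCircle : Measure Torus), ∀ b : Fin M,
      (∑ a, tri (U (p.1, a)) (U (b, a)) (U (b, p.2)) : L2) x =
        ∑ a, tri (U (p.1, a)) (U (b, a)) (U (b, p.2)) x := by
    rw [ae_all_iff]
    intro b
    filter_upwards [Lp.coeFn_finsetSum Finset.univ
      fun a => tri (U (p.1, a)) (U (b, a)) (U (b, p.2))]
      with x hx
    rw [hx, Finset.sum_apply]
  filter_upwards [h, h2, Lp.coeFn_finsetSum Finset.univ fun b =>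
    ∑ a, tri (U (p.1, a)) (U (b, a)) (U (b, p.2))] with x h h2 h3
  rw [h3, Finset.sum_apply, cubic_apply]
  exact Finset.sum_congr rfl fun b _ => by rw [h2]; exact Finset.sum_congr rfl fun a _ => h b a

theorem memL2Mat_cubic (U : HsPlusMat M N (1 / 2)) : MemL2Mat (cubic (toL2Mat U)) := fun p =>
  (memLp_congr_ae (coeFn_cubicL2 U p)).mp (Lp.memLp (cubicL2 U p))

theorem toL2Mat_cubic (U : HsPlusMat M N (1 / 2)) (h : MemL2Mat (cubic (toL2Mat U))) :
    h.toL2Mat = cubicL2 U := by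
  ext1 p
  refine Lp.ext ?_
  exact (h p).coeFn_toLp.trans (coeFn_cubicL2 U p).symm

/-- A shortcut for instance search. -/
abbrev realNormedSpace_hsPlusMat (M N : ℕ) (s : ℝ) : NormedSpace ℝ (HsPlusMat M N s) :=
  inferInstance

attribute [local instance] realNormedSpace_hsPlusMat

theorem contDiff_entry {s : ℝ} {n : WithTop ℕ∞} (p : Fin M × Fin N) :
    ContDiff ℝ n fun U : HsPlusMat M N s => ((U p : HsPlus s) : Hs s) := by
  have h : ContDiff ℝ n fun U : HsPlusMat M N s => (U p : HsPlus s) := by fun_prop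
  exact ((HsPlus s).subtypeL.restrictScalars ℝ).contDiff.comp h

theorem contDiff_cubicL2 {n : WithTop ℕ∞} :
    ContDiff ℝ n (cubicL2 : HsPlusMat M N (1 / 2) → L2Mat M N) := by
  refine (contDiff_piLp (ι := Fin M × Fin N) (𝕜 := ℝ) (E := fun _ => L2)
    (H := HsPlusMat M N (1 / 2)) 2).mpr fun p => ?_
  change ContDiff ℝ n fun U : HsPlusMat M N (1 / 2) =>
    ∑ b, ∑ a, tri (U (p.1, a)) (U (b, a)) (U (b, p.2))
  refine ContDiff.sum fun b _ => ContDiff.sum fun a _ => ?_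
  exact contDiff_tri (contDiff_entry _) (contDiff_entry _) (contDiff_entry _)

theorem norm_le_sum_norm {ι : Type*} [Fintype ι] {β : ι → Type*}
    [∀ i, SeminormedAddCommGroup (β i)] (x : PiLp 2 β) : ‖x‖ ≤ ∑ i, ‖x i‖ := by
  refine abs_le_of_sq_le_sq' ?_ (Finset.sum_nonneg fun _ _ => norm_nonneg _) |>.2
  rw [PiLp.norm_sq_eq_of_L2]
  exact Finset.sum_sq_le_sq_sum_of_nonneg fun _ _ => norm_nonneg _

/-- The nonlinearity is bounded in `L²` on sets of bounded energy. -/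
theorem exists_norm_cubicL2_le (M N : ℕ) (R : ℝ≥0) : ∃ C : ℝ, 0 ≤ C ∧
    ∀ U : HsPlusMat M N (1 / 2), energy wq (toL2Mat U) ≤ R → ‖cubicL2 U‖ ≤ C := by
  set ρ := Real.sqrt (sixConst * R) with hρ
  refine ⟨∑ _p : Fin M × Fin N, ∑ _b : Fin M, ∑ _a : Fin N, ρ * ρ * ρ, by positivity,
    fun U hU => ?_⟩
  have h6 : ∀ p, ‖toL6 (U p)‖ ≤ ρ := fun p => by
    have h := (enorm_toL6_sq_le (U p : Hs (1 / 2))).trans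
      (mul_le_mul' le_rfl ((wsum_le_energy wq (toL2Mat U) p).trans hU))
    rw [enorm_eq_nnnorm] at h
    have h' : ‖toL6 (U p)‖ ^ 2 ≤ sixConst * R := by exact_mod_cast h
    exact Real.le_sqrt_of_sq_le h'
  refine (norm_le_sum_norm _).trans (Finset.sum_le_sum fun p _ => ?_)
  rw [cubicL2_apply]
  refine (norm_sum_le _ _).trans (Finset.sum_le_sum fun b _ => ?_)
  refine (norm_sum_le _ _).trans (Finset.sum_le_sum fun a _ => ?_)
  refine (norm_tri_le _ _ _).trans ?_
  gcongr <;> exact h6 _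

/-! ### The logarithmic estimate -/

/-- Cauchy–Schwarz for sums of Fourier coefficients. -/
theorem tsum_absCoeff_sq_le {v : ℤ → ℝ≥0} (hv : ∀ n, v n ≠ 0) (A : Set ℤ) (f : L2) :
    (∑' n : A, absCoeff f n) ^ 2 ≤ (∑' n : A, ((v n : ℝ≥0∞))⁻¹) * wsum v f := by
  set r : ℤ → ℝ≥0∞ := fun n => ((NNReal.sqrt (v n) : ℝ≥0) : ℝ≥0∞) with hr
  have hr0 : ∀ n, r n ≠ 0 := fun n => by simp [hr, hv n]
  have hr2 : ∀ n, r n ^ 2 = v n := fun n => by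
    rw [hr, ← ENNReal.coe_pow, NNReal.sq_sqrt]
  have e : ∀ n : A, absCoeff f n = (r n)⁻¹ * (r n * absCoeff f n) := fun n => by
    rw [← mul_assoc, ENNReal.inv_mul_cancel (hr0 n) ENNReal.coe_ne_top, one_mul]
  rw [tsum_congr e]
  refine (ENNReal_tsum_mul_sq_le _ _).trans ?_
  simp only [mul_pow, ← ENNReal.inv_pow, hr2]
  refine mul_le_mul' le_rfl ?_
  exact ENNReal.tsum_comp_le_tsum_of_injective Subtype.val_injective
    fun n => (v n : ℝ≥0∞) * absCoeff f n ^ 2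

/-- The bound `1 + log K` for the harmonic sum over the modes `0 ≤ n < K`. -/
def lg (K : ℕ) : ℝ≥0 := Real.toNNReal (1 + Real.log K)

theorem coe_lg {K : ℕ} : (lg K : ℝ) = 1 + Real.log K :=
  Real.coe_toNNReal _ (by have := Real.log_natCast_nonneg K; linarith)

theorem tsum_inv_wq_le (K : ℕ) :
    ∑' n : Set.Ico (0 : ℤ) K, ((wq n : ℝ≥0∞))⁻¹ ≤ lg K := by
  have e : (Set.Ico (0 : ℤ) K) = ((Finset.range K).map Nat.castEmbedding : Finset ℤ) := by
    ext n
    simp only [Set.mem_Ico, Finset.coe_map, Set.mem_image, Finset.coe_range, Set.mem_Iio,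
      Nat.castEmbedding_apply]
    constructor
    · rintro ⟨h1, h2⟩
      exact ⟨n.toNat, by omega, by omega⟩
    · rintro ⟨m, h1, rfl⟩
      omega
  rw [e, Finset.tsum_subtype' _ (fun n : ℤ => ((wq n : ℝ≥0∞))⁻¹), Finset.sum_map]
  have h : ∑ n ∈ Finset.range K, (wq n)⁻¹ ≤ lg K := by
    rw [← NNReal.coe_le_coe, coe_lg]
    refine le_trans (le_of_eq ?_) (harmonic_le_one_add_log K)
    rw [harmonic]
    push_cast
    refine Finset.sum_congr rfl fun n _ => ?_
    simp [wq, add_comm]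
  refine le_trans (le_of_eq ?_) (ENNReal.coe_le_coe.mpr h)
  push_cast
  refine Finset.sum_congr rfl fun n _ => ?_
  rw [ENNReal.coe_inv (wq_ne_zero _)]
  rfl

theorem ae_enorm_modeProj_finset_le (s : Finset ℤ) (f : L2) :
    ∀ᵐ x ∂(AddCircle.haarAddCircle : Measure Torus),
      ‖(modeProj s f : L2) x‖ₑ ≤ ∑' n : (s : Set ℤ), absCoeff f n := by
  have : ∀ᵐ x ∂(AddCircle.haarAddCircle : Measure Torus), ∀ n : ℤ,
      (coeff f n • (fourierLp 2 n : L2) : L2) x = coeff f n * fourier n x := by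
    rw [ae_all_iff]
    intro n
    filter_upwards [Lp.coeFn_smul (coeff f n) (fourierLp 2 n : L2), coeFn_fourierLp 2 n]
      with x hx hx'
    rw [hx, Pi.smul_apply, hx', smul_eq_mul]
  rw [modeProj_finset]
  filter_upwards [this, Lp.coeFn_finsetSum s fun n => coeff f n • (fourierLp 2 n : L2)] with x h1 h2
  rw [h2, Finset.sum_apply, Finset.tsum_subtype' s (absCoeff f)]
  refine (enorm_sum_le _ _).trans (Finset.sum_le_sum fun n _ => ?_)
  have h3 : ‖fourier n x‖ₑ = 1 := by
    rw [← ofReal_norm, fourier_apply, Circle.norm_coe, ENNReal.ofReal_one]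
  rw [h1, enorm_mul, h3, mul_one, absCoeff]

/-- The supremum of a function with modes in `[0, K)` is bounded by its `H^{1/2}` energy up to a
logarithm of `K`. -/
theorem ae_enorm_modeProj_Ico_sq_le (K : ℕ) (f : L2) :
    ∀ᵐ x ∂(AddCircle.haarAddCircle : Measure Torus),
      ‖(modeProj (Set.Ico 0 (K : ℤ)) f : L2) x‖ₑ ^ 2 ≤ lg K * wsum wq f := by
  have h := ae_enorm_modeProj_finset_le (Finset.Ico 0 (K : ℤ)) f
  rw [Finset.coe_Ico] at h
  filter_upwards [h] with x hx
  refine (pow_le_pow_left' hx 2).trans ((tsum_absCoeff_sq_le wq_ne_zero _ f).trans ?_)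
  gcongr
  exact tsum_inv_wq_le K

/-- The modes `≥ K` of a function with nonnegative modes are small in `L²`. -/
theorem enorm_modeProj_compl_sq_le {K : ℕ} {A : Set ℤ} (hA : Set.Ico 0 (K : ℤ) ⊆ A) {f : L2}
    (hf : ∀ n < 0, coeff f n = 0) : K * ‖modeProj Aᶜ f‖ₑ ^ 2 ≤ wsum wq f := by
  rw [← wsum_one]
  refine le_trans ?_ (wsum_modeProj_le Aᶜ wq f)
  have := (wsum_const_mul K 1 (modeProj Aᶜ f)).symm
  rw [ENNReal.coe_natCast] at this
  rw [this]
  refine wsum_mono fun n hn => ?_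
  have hnA : n ∉ A := fun h => hn (coeff_modeProj_of_notMem (by simpa using h) f)
  have hn0 : 0 ≤ n := by
    by_contra hlt
    apply hn
    have := norm_coeff_modeProj_le Aᶜ f n
    rwa [hf n (not_le.mp hlt), norm_zero, norm_le_zero_iff] at this
  have hK : K ≤ n.natAbs := by
    by_contra hlt
    exact hnA (hA ⟨hn0, by omega⟩)
  simp only [Pi.one_apply, mul_one, wq]
  exact (Nat.cast_le.mpr hK).trans le_add_self

theorem eLpNorm_mul_mul_le (f w : L2) :
    eLpNorm (fun x => w x * w x * f x) 2 AddCircle.haarAddCircle ≤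
      eLpNorm w 6 AddCircle.haarAddCircle ^ 2 * eLpNorm f 6 AddCircle.haarAddCircle := by
  have hf := Lp.aestronglyMeasurable f
  have hw := Lp.aestronglyMeasurable w
  have h1 := eLpNorm_smul_le_mul_eLpNorm (p := 3) (q := 6) (r := 2) hf (hw.mul hw)
  have h2 := eLpNorm_smul_le_mul_eLpNorm (p := 6) (q := 6) (r := 3) hw hw
  refine h1.trans ?_
  rw [sq]
  gcongr
  exact h2

/-- Hölder's inequality and the embedding into `L⁶`; this is applied to high-frequency `f`, for which
the factor `‖f‖_{L²}` is small. -/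
theorem lintegral_sq_mul_sq_le (f w : L2) :
    ∫⁻ x, ‖f x‖ₑ ^ 2 * ‖w x‖ₑ ^ 2 ∂AddCircle.haarAddCircle ≤
      ‖f‖ₑ * eLpNorm f 6 AddCircle.haarAddCircle * (sixConst * wsum wq w) := by
  have hf := Lp.aestronglyMeasurable f
  have hw := Lp.aestronglyMeasurable w
  have h1 := eLpNorm_smul_le_mul_eLpNorm (p := 2) (q := 2) (r := 1) ((hw.mul hw).mul hf) hf
  rw [eLpNorm_one_eq_lintegral_enorm] at h1
  calc _ = ∫⁻ x, ‖(⇑f • (⇑w * ⇑w * ⇑f)) x‖ₑ ∂AddCircle.haarAddCircle := by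
        refine lintegral_congr fun x => ?_
        simp only [Pi.smul_apply', Pi.mul_apply, smul_eq_mul, enorm_mul]
        ring
    _ ≤ _ := h1
    _ ≤ ‖f‖ₑ * (eLpNorm w 6 AddCircle.haarAddCircle ^ 2 *
          eLpNorm f 6 AddCircle.haarAddCircle) := by
        rw [Lp.enorm_def]
        gcongr
        exact eLpNorm_mul_mul_le f w
    _ ≤ ‖f‖ₑ * ((sixConst * wsum wq w) * eLpNorm f 6 AddCircle.haarAddCircle) := by
        gcongr
        exact eLpNorm_six_sq_le w
    _ = _ := by ring

/-- The key estimate: `∫ |f|²|w|²` is controlled by `log K` times `‖w‖²_{L²}`, up to an error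
`O(K^{-1/2})` depending only on the `H^{1/2}` energies. -/
theorem lintegral_sq_mul_sq_le_log {K : ℕ} (hK : K ≠ 0) {f : L2} (hf : ∀ n < 0, coeff f n = 0)
    (w : L2) :
    ∫⁻ x, ‖f x‖ₑ ^ 2 * ‖w x‖ₑ ^ 2 ∂AddCircle.haarAddCircle ≤
      2 * (lg K * wsum wq f * ‖w‖ₑ ^ 2 +
        NNReal.sqrt (sixConst / K) * wsum wq f * (sixConst * wsum wq w)) := by
  set A : Set ℤ := Set.Ico 0 (K : ℤ) with hA
  set g : L2 := modeProj A f with hg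
  set h : L2 := modeProj Aᶜ f with hh
  have hadd : f =ᵐ[AddCircle.haarAddCircle] fun x => g x + h x := by
    have := Lp.coeFn_add g h
    rw [hg, hh, modeProj_add_compl] at this
    exact this
  have hlow : ∫⁻ x, ‖g x‖ₑ ^ 2 * ‖w x‖ₑ ^ 2 ∂AddCircle.haarAddCircle ≤
      lg K * wsum wq f * ‖w‖ₑ ^ 2 := by
    have e : ‖w‖ₑ ^ 2 = ∫⁻ x, ‖w x‖ₑ ^ 2 ∂AddCircle.haarAddCircle := by
      rw [Lp.enorm_def, eLpNorm_eq_lintegral_rpow_enorm_toReal (by norm_num) (by norm_num),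
        ← ENNReal.rpow_natCast, ← ENNReal.rpow_mul]
      norm_num
    rw [e, ← lintegral_const_mul'' _ ((Lp.aestronglyMeasurable w).enorm.pow_const 2)]
    refine lintegral_mono_ae ?_
    filter_upwards [ae_enorm_modeProj_Ico_sq_le K f] with x hx
    gcongr
  have hhigh : ∫⁻ x, ‖h x‖ₑ ^ 2 * ‖w x‖ₑ ^ 2 ∂AddCircle.haarAddCircle ≤
      NNReal.sqrt (sixConst / K) * wsum wq f * (sixConst * wsum wq w) := by
    refine (lintegral_sq_mul_sq_le h w).trans (mul_le_mul' ?_ le_rfl)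
    rw [← ENNReal.pow_le_pow_left_iff two_ne_zero, mul_pow, mul_pow, ← ENNReal.coe_pow,
      NNReal.sq_sqrt]
    have h1 : ‖h‖ₑ ^ 2 ≤ (K : ℝ≥0∞)⁻¹ * wsum wq f := by
      have := enorm_modeProj_compl_sq_le (K := K) (A := A) subset_rfl hf
      rw [mul_comm (K : ℝ≥0∞)⁻¹, ← div_eq_mul_inv]
      rw [ENNReal.le_div_iff_mul_le (Or.inl (by simpa using hK)) (Or.inl (by simp)), mul_comm]
      exact this
    have h2 : eLpNorm h 6 AddCircle.haarAddCircle ^ 2 ≤ sixConst * wsum wq f :=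
      (eLpNorm_six_sq_le h).trans (mul_le_mul' le_rfl (wsum_modeProj_le _ _ _))
    refine (mul_le_mul' h1 h2).trans (le_of_eq ?_)
    rw [ENNReal.coe_div (by exact_mod_cast hK), ENNReal.coe_natCast, div_eq_mul_inv]
    ring
  calc _ ≤ ∫⁻ x, 2 * (‖g x‖ₑ ^ 2 * ‖w x‖ₑ ^ 2 + ‖h x‖ₑ ^ 2 * ‖w x‖ₑ ^ 2)
        ∂AddCircle.haarAddCircle := by
        refine lintegral_mono_ae ?_
        filter_upwards [hadd] with x hx
        rw [hx, ← add_mul, ← mul_assoc]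
        gcongr
        exact enorm_add_sq_le _ _
    _ = 2 * (∫⁻ x, ‖g x‖ₑ ^ 2 * ‖w x‖ₑ ^ 2 ∂AddCircle.haarAddCircle +
          ∫⁻ x, ‖h x‖ₑ ^ 2 * ‖w x‖ₑ ^ 2 ∂AddCircle.haarAddCircle) := by
        rw [lintegral_const_mul' _ _ (by norm_num), lintegral_add_left']
        exact ((Lp.aestronglyMeasurable g).enorm.pow_const 2).mul
          ((Lp.aestronglyMeasurable w).enorm.pow_const 2)
    _ ≤ _ := by gcongr

/-! ### The energy estimate for differences -/

section pointwise

attribute [local instance] Matrix.frobeniusNormedAddCommGroup Matrix.frobeniusNormedSpace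

theorem frobenius_norm_sq (A : Matrix (Fin M) (Fin N) ℂ) :
    ‖A‖ ^ 2 = ∑ p : Fin M × Fin N, ‖A p.1 p.2‖ ^ 2 := by
  rw [Matrix.frobenius_norm_def, ← Real.rpow_natCast, ← Real.rpow_mul (by positivity),
    Fintype.sum_prod_type]
  norm_num

/-- The cubic map `A ↦ A A^* A` is locally Lipschitz in the Frobenius norm, in the form needed to
pair the difference with `A - B`. -/
theorem norm_sum_star_mul_cubic_sub_le (A B : Matrix (Fin M) (Fin N) ℂ) :
    ‖∑ p : Fin M × Fin N, star ((A - B) p.1 p.2) * (A * Aᴴ * A - B * Bᴴ * B) p.1 p.2‖ ≤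
      3 / 2 * ((∑ p : Fin M × Fin N, ‖A p.1 p.2‖ ^ 2) + ∑ p : Fin M × Fin N, ‖B p.1 p.2‖ ^ 2) *
        ∑ p : Fin M × Fin N, ‖(A - B) p.1 p.2‖ ^ 2 := by
  rw [← frobenius_norm_sq, ← frobenius_norm_sq, ← frobenius_norm_sq]
  set D := A - B with hD
  set E := A * Aᴴ * A - B * Bᴴ * B with hE
  have h1 : ‖∑ p : Fin M × Fin N, star (D p.1 p.2) * E p.1 p.2‖ ≤ ‖D‖ * ‖E‖ := by
    refine (norm_sum_le _ _).trans (abs_le_of_sq_le_sq' ?_ (by positivity)).2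
    rw [mul_pow, frobenius_norm_sq, frobenius_norm_sq]
    simp only [norm_mul, norm_star]
    exact Finset.sum_mul_sq_le_sq_mul_sq _ _ _
  have h2 : ‖E‖ ≤ 3 / 2 * (‖A‖ ^ 2 + ‖B‖ ^ 2) * ‖D‖ := by
    have e : E = D * Aᴴ * A + B * Dᴴ * A + B * Bᴴ * D := by
      rw [hE, hD, Matrix.conjTranspose_sub]
      simp only [Matrix.sub_mul, Matrix.mul_sub]
      abel
    have m3 : ∀ X Y Z : Matrix (Fin M) (Fin N) ℂ, ‖X * Yᴴ * Z‖ ≤ ‖X‖ * ‖Y‖ * ‖Z‖ := by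
      intro X Y Z
      refine (Matrix.frobenius_norm_mul _ _).trans ?_
      gcongr
      refine (Matrix.frobenius_norm_mul _ _).trans ?_
      rw [Matrix.frobenius_norm_conjTranspose]
    rw [e]
    refine (norm_add₃_le).trans ?_
    refine (add_le_add (add_le_add (m3 _ _ _) (m3 _ _ _)) (m3 _ _ _)).trans ?_
    nlinarith [mul_nonneg (norm_nonneg D) (sq_nonneg (‖A‖ - ‖B‖))]
  calc _ ≤ ‖D‖ * ‖E‖ := h1
    _ ≤ ‖D‖ * (3 / 2 * (‖A‖ ^ 2 + ‖B‖ ^ 2) * ‖D‖) := by gcongr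
    _ = _ := by ring

end pointwise

/-- The pairing of `W = U - V` with the difference of the nonlinearities, bounded by integrals of
`|U|²|W|²` and `|V|²|W|²`. -/
theorem enorm_inner_cubic_sub_le (U V : HsPlusMat M N (1 / 2)) :
    ‖inner ℂ (toL2Mat U - toL2Mat V) (cubicL2 U - cubicL2 V)‖ₑ ≤
      (3 / 2 : ℝ≥0) * ∑ p, ∑ q, (
        ∫⁻ x, ‖toL2Mat U p x‖ₑ ^ 2 * ‖(toL2Mat U - toL2Mat V) q x‖ₑ ^ 2 ∂AddCircle.haarAddCircle +
        ∫⁻ x, ‖toL2Mat V p x‖ₑ ^ 2 * ‖(toL2Mat U - toL2Mat V) q x‖ₑ ^ 2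
          ∂AddCircle.haarAddCircle) := by
  set W := toL2Mat U - toL2Mat V with hW
  have hWx : ∀ᵐ x ∂(AddCircle.haarAddCircle : Measure Torus), ∀ p,
      W p x = toL2Mat U p x - toL2Mat V p x := by
    rw [ae_all_iff]
    exact fun p => Lp.coeFn_sub _ _
  have hDx : ∀ᵐ x ∂(AddCircle.haarAddCircle : Measure Torus), ∀ p,
      (cubicL2 U - cubicL2 V) p x =
        cubic (toL2Mat U) x p.1 p.2 - cubic (toL2Mat V) x p.1 p.2 := by
    rw [ae_all_iff]
    intro p
    rw [PiLp.sub_apply]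
    filter_upwards [Lp.coeFn_sub (cubicL2 U p) (cubicL2 V p), coeFn_cubicL2 U p,
      coeFn_cubicL2 V p] with x h1 h2 h3
    rw [h1, Pi.sub_apply, h2, h3]
  have hmeas : ∀ f : L2, AEMeasurable (fun x => ‖f x‖ₑ ^ 2) AddCircle.haarAddCircle :=
    fun f => (Lp.aestronglyMeasurable f).enorm.pow_const 2
  have hmeas2 : ∀ f g : L2, AEMeasurable (fun x => ‖f x‖ₑ ^ 2 * ‖g x‖ₑ ^ 2)
      AddCircle.haarAddCircle := fun f g => (hmeas f).mul (hmeas g)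
  have hmeas3 : ∀ Z : L2Mat M N, AEMeasurable (fun x => (∑ p, ‖Z p x‖ₑ ^ 2) * ∑ q, ‖W q x‖ₑ ^ 2)
      AddCircle.haarAddCircle := fun Z => (Finset.aemeasurable_fun_sum _ fun q _ => hmeas _).mul
        (Finset.aemeasurable_fun_sum _ fun q _ => hmeas _)
  have hsum : ∀ Z : L2Mat M N, ∑ p, ∑ q, ∫⁻ x, ‖Z p x‖ₑ ^ 2 * ‖W q x‖ₑ ^ 2
      ∂AddCircle.haarAddCircle =
      ∫⁻ x, (∑ p, ‖Z p x‖ₑ ^ 2) * ∑ q, ‖W q x‖ₑ ^ 2 ∂AddCircle.haarAddCircle := by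
    intro Z
    simp only [Finset.sum_mul_sum]
    rw [lintegral_finsetSum' _ fun p _ =>
      Finset.aemeasurable_fun_sum _ fun q _ => hmeas2 _ _]
    refine Finset.sum_congr rfl fun p _ => ?_
    rw [lintegral_finsetSum' _ fun q _ => hmeas2 _ _]
  simp only [Finset.sum_add_distrib, hsum]
  rw [PiLp.inner_apply]
  simp only [L2.inner_def]
  rw [← integral_finsetSum _ fun p _ => L2.integrable_inner _ _,
    ← lintegral_add_left' (hmeas3 _),
    ← lintegral_const_mul' _ _ ENNReal.coe_ne_top]
  refine (enorm_integral_le_lintegral_enorm _).trans (lintegral_mono_ae ?_)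
  filter_upwards [hWx, hDx] with x hWx hDx
  have key := norm_sum_star_mul_cubic_sub_le (evalMat (toL2Mat U) x) (evalMat (toL2Mat V) x)
  have e1 : ∀ p, inner ℂ (W p x) ((cubicL2 U - cubicL2 V) p x) =
      star ((evalMat (toL2Mat U) x - evalMat (toL2Mat V) x) p.1 p.2) *
        (evalMat (toL2Mat U) x * (evalMat (toL2Mat U) x)ᴴ * evalMat (toL2Mat U) x -
          evalMat (toL2Mat V) x * (evalMat (toL2Mat V) x)ᴴ * evalMat (toL2Mat V) x) p.1 p.2 := by
    intro p
    rw [hWx, hDx, RCLike.inner_apply, mul_comm]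
    rfl
  have e2 : ∀ p, (evalMat (toL2Mat U) x - evalMat (toL2Mat V) x) p.1 p.2 = W p x := fun p => by
    rw [hWx]; rfl
  simp only [e1]
  simp only [e2] at key ⊢
  have key' : ‖∑ p, star (W p x) *
      (evalMat (toL2Mat U) x * (evalMat (toL2Mat U) x)ᴴ * evalMat (toL2Mat U) x -
        evalMat (toL2Mat V) x * (evalMat (toL2Mat V) x)ᴴ * evalMat (toL2Mat V) x) p.1 p.2‖₊ ≤
      3 / 2 * ((∑ p, ‖toL2Mat U p x‖₊ ^ 2) + ∑ p, ‖toL2Mat V p x‖₊ ^ 2) * ∑ p, ‖W p x‖₊ ^ 2 := by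
    rw [← NNReal.coe_le_coe]
    push_cast
    exact key
  simp only [enorm_eq_nnnorm]
  rw [← add_mul, ← mul_assoc]
  exact_mod_cast key'

/-- The logarithmic estimate for the pairing of `U - V` with the difference of the nonlinearities. -/
theorem exists_norm_inner_cubic_sub_le (M N : ℕ) (R : ℝ≥0) : ∃ C : ℝ, 0 ≤ C ∧
    ∀ K : ℕ, K ≠ 0 → ∀ U V : HsPlusMat M N (1 / 2),
      energy wq (toL2Mat U) ≤ R → energy wq (toL2Mat V) ≤ R →
      ‖inner ℂ (toL2Mat U - toL2Mat V) (cubicL2 U - cubicL2 V)‖ ≤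
        C * ((1 + Real.log K) * ‖toL2Mat U - toL2Mat V‖ ^ 2 + (Real.sqrt K)⁻¹) := by
  set C₁ : ℝ≥0 := 6 * R with hC₁
  set C₂ : ℝ≥0 := 24 * R * (R * sixConst) * NNReal.sqrt sixConst with hC₂
  refine ⟨C₁ + C₂, by positivity, fun K hK U V hU hV => ?_⟩
  set W := toL2Mat U - toL2Mat V with hW
  have hWR : energy wq W ≤ (4 * R : ℝ≥0) := by
    refine (energy_sub_le wq _ _).trans ((mul_le_mul' le_rfl (add_le_add hU hV)).trans
      (le_of_eq ?_))
    push_cast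
    ring
  have hstep : ∀ Z : HsPlusMat M N (1 / 2), energy wq (toL2Mat Z) ≤ R →
      ∑ p, ∑ q, ∫⁻ x, ‖toL2Mat Z p x‖ₑ ^ 2 * ‖W q x‖ₑ ^ 2 ∂AddCircle.haarAddCircle ≤
        ((2 * (lg K * R * ‖W‖₊ ^ 2 +
          NNReal.sqrt (sixConst / K) * R * (sixConst * (4 * R))) : ℝ≥0) : ℝ≥0∞) := by
    intro Z hZ
    have h1 : ∑ p, ∑ q, ∫⁻ x, ‖toL2Mat Z p x‖ₑ ^ 2 * ‖W q x‖ₑ ^ 2 ∂AddCircle.haarAddCircle ≤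
        ∑ p, ∑ q, 2 * (lg K * wsum wq (toL2Mat Z p) * ‖W q‖ₑ ^ 2 +
          NNReal.sqrt (sixConst / K) * wsum wq (toL2Mat Z p) * (sixConst * wsum wq (W q))) :=
      Finset.sum_le_sum fun p _ => Finset.sum_le_sum fun q _ =>
        lintegral_sq_mul_sq_le_log hK (fun n hn => coeff_toL2Mat_of_neg Z p hn) _
    have h2 : ∑ p, ∑ q, 2 * (lg K * wsum wq (toL2Mat Z p) * ‖W q‖ₑ ^ 2 +
          NNReal.sqrt (sixConst / K) * wsum wq (toL2Mat Z p) * (sixConst * wsum wq (W q))) =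
        2 * (lg K * energy wq (toL2Mat Z) * ‖W‖ₑ ^ 2 +
          NNReal.sqrt (sixConst / K) * energy wq (toL2Mat Z) * (sixConst * energy wq W)) := by
      rw [PiLp.enorm_sq_eq W, energy, energy]
      simp only [← Finset.mul_sum, Finset.sum_add_distrib, ← Finset.sum_mul]
    rw [h2] at h1
    refine h1.trans ?_
    push_cast
    rw [← enorm_eq_nnnorm]
    push_cast at hWR
    gcongr
  have hmain := enorm_inner_cubic_sub_le U V
  simp only [Finset.sum_add_distrib] at hmain
  have hmain2 := hmain.trans (mul_le_mul' le_rfl (add_le_add (hstep U hU) (hstep V hV)))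
  rw [enorm_eq_nnnorm] at hmain2
  have hmain3 : ‖inner ℂ W (cubicL2 U - cubicL2 V)‖₊ ≤ 3 / 2 *
      ((2 * (lg K * R * ‖W‖₊ ^ 2 + NNReal.sqrt (sixConst / K) * R * (sixConst * (4 * R)))) +
      (2 * (lg K * R * ‖W‖₊ ^ 2 + NNReal.sqrt (sixConst / K) * R * (sixConst * (4 * R))))) := by
    exact_mod_cast hmain2
  have e : (3 / 2 : ℝ≥0) *
      ((2 * (lg K * R * ‖W‖₊ ^ 2 + NNReal.sqrt (sixConst / K) * R * (sixConst * (4 * R)))) +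
      (2 * (lg K * R * ‖W‖₊ ^ 2 + NNReal.sqrt (sixConst / K) * R * (sixConst * (4 * R))))) =
      C₁ * (lg K * ‖W‖₊ ^ 2) + C₂ * (NNReal.sqrt K)⁻¹ := by
    rw [NNReal.sqrt_div, hC₁, hC₂, div_eq_mul_inv (NNReal.sqrt _)]
    rw [← NNReal.coe_inj]
    push_cast
    ring
  rw [e] at hmain3
  have h5 : C₁ * (lg K * ‖W‖₊ ^ 2) + C₂ * (NNReal.sqrt K)⁻¹ ≤
      (C₁ + C₂) * (lg K * ‖W‖₊ ^ 2 + (NNReal.sqrt K)⁻¹) := by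
    rw [mul_add]
    gcongr
    · exact le_self_add
    · exact le_add_self
  have h6 := NNReal.coe_le_coe.mpr (hmain3.trans h5)
  push_cast at h6
  rw [coe_lg] at h6
  exact h6

/-! ### Flows and their stability in `L²` -/

/-- A trajectory of the equation `i ∂_t U = P_A (U U^* U)` truncated to the modes in `A`, on the
time set `I`. The full equation is the case where `A` is the set of nonnegative modes; the Galerkin
approximations are those where `A = {0, …, K - 1}`. -/
structure IsFlow (A : Set ℤ) (I : Set ℝ) (U : ℝ → HsPlusMat M N (1 / 2)) : Prop where
  modes : ∀ t ∈ I, ∀ p, ∀ n ∉ A, coeff (toL2Mat (U t) p) n = 0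
  deriv : ∀ t ∈ I, HasDerivAt (fun τ => toL2Mat (U τ))
    (-Complex.I • projMat A (cubicL2 (U t))) t

theorem IsFlow.mono {A : Set ℤ} {I J : Set ℝ} {U : ℝ → HsPlusMat M N (1 / 2)}
    (h : IsFlow A I U) (hJ : J ⊆ I) : IsFlow A J U :=
  ⟨fun t ht => h.modes t (hJ ht), fun t ht => h.deriv t (hJ ht)⟩

theorem isFlow_of_isSolution {U : ℝ → HsPlusMat M N (1 / 2)} (h : IsSolution U) :
    IsFlow (Set.Ici 0) Set.univ U where
  modes t _ p n hn := coeff_toL2Mat_of_neg (U t) p (not_le.mp hn)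
  deriv t _ := by
    obtain ⟨hm, D, hD, he⟩ := h t
    rw [toL2Mat_cubic, szegoMat_eq_projMat] at he
    rwa [← he, smul_smul, neg_mul, Complex.I_mul_I, neg_neg, one_smul]

theorem isSolution_of_isFlow {U : ℝ → HsPlusMat M N (1 / 2)}
    (h : IsFlow (Set.Ici 0) Set.univ U) : IsSolution U := by
  intro t
  refine ⟨memL2Mat_cubic (U t), _, h.deriv t trivial, ?_⟩
  rw [toL2Mat_cubic, szegoMat_eq_projMat, smul_smul, mul_neg, Complex.I_mul_I, neg_neg, one_smul]

/-- Grönwall's inequality between two times in either order. -/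
theorem le_exp_of_abs_deriv_le {y y' : ℝ → ℝ} {a b t₀ t₁ : ℝ} (ha : 1 ≤ a) (hb : 0 ≤ b)
    (hy : ∀ t ∈ Set.uIcc t₀ t₁, 0 ≤ y t) (hd : ∀ t ∈ Set.uIcc t₀ t₁, HasDerivAt y (y' t) t)
    (hle : ∀ t ∈ Set.uIcc t₀ t₁, |y' t| ≤ a * y t + b) :
    y t₁ ≤ (y t₀ + b) * Real.exp (a * |t₁ - t₀|) := by
  have hmem : ∀ s ∈ Set.Icc (0 : ℝ) 1, t₀ + s * (t₁ - t₀) ∈ Set.uIcc t₀ t₁ := by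
    intro s hs
    rw [← segment_eq_uIcc]
    refine ⟨1 - s, s, by linarith [hs.2], hs.1, by ring, ?_⟩
    simp only [smul_eq_mul]
    ring
  have hz : ∀ s ∈ Set.Icc (0 : ℝ) 1, HasDerivAt (fun s => y (t₀ + s * (t₁ - t₀)))
      (y' (t₀ + s * (t₁ - t₀)) * (t₁ - t₀)) s := by
    intro s hs
    have h1 : HasDerivAt (fun s : ℝ => t₀ + s * (t₁ - t₀)) (t₁ - t₀) s := by
      simpa using ((hasDerivAt_id s).mul_const (t₁ - t₀)).const_add t₀
    exact (hd _ (hmem s hs)).comp s h1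
  have hg := norm_le_gronwallBound_of_norm_deriv_right_le
    (f := fun s => y (t₀ + s * (t₁ - t₀))) (f' := fun s => y' (t₀ + s * (t₁ - t₀)) * (t₁ - t₀))
    (δ := y t₀) (K := a * |t₁ - t₀|) (ε := b * |t₁ - t₀|) (a := 0) (b := 1)
    (fun s hs => (hz s hs).continuousAt.continuousWithinAt)
    (fun s hs => (hz s ⟨hs.1, hs.2.le⟩).hasDerivWithinAt)
    (by
      simp only [zero_mul, add_zero]
      rw [Real.norm_of_nonneg (hy _ Set.left_mem_uIcc)])
    (fun s hs => by
      have hs' : s ∈ Set.Icc (0 : ℝ) 1 := ⟨hs.1, hs.2.le⟩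
      rw [norm_mul, Real.norm_eq_abs, Real.norm_eq_abs, Real.norm_of_nonneg (hy _ (hmem s hs'))]
      calc _ ≤ (a * y (t₀ + s * (t₁ - t₀)) + b) * |t₁ - t₀| := by
            gcongr; exact hle _ (hmem s hs')
        _ = _ := by ring)
    1 (by simp)
  simp only [one_mul, add_sub_cancel, sub_zero] at hg
  rw [Real.norm_of_nonneg (hy _ Set.right_mem_uIcc)] at hg
  refine hg.trans ?_
  have hy0 := hy _ Set.left_mem_uIcc
  rcases eq_or_ne (t₁ - t₀) 0 with h0 | h0
  · rw [h0]
    simp [gronwallBound_K0, hb]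
  have hpos : 0 < |t₁ - t₀| := abs_pos.mpr h0
  rw [gronwallBound_of_K_ne_0 (by positivity)]
  simp only [mul_one]
  have hexp : 1 ≤ Real.exp (a * |t₁ - t₀|) := Real.one_le_exp (by positivity)
  have hq : b * |t₁ - t₀| / (a * |t₁ - t₀|) ≤ b := by
    rw [mul_div_mul_right _ _ hpos.ne']
    exact div_le_self hb ha
  nlinarith [mul_le_mul_of_nonneg_right hq (sub_nonneg.mpr hexp)]

/-- The modes outside `A ⊇ [0, K)` of a function of bounded energy are `O(K^{-1/2})` in `L²`. -/
theorem norm_projMat_compl_sq_le {K : ℕ} (hK : K ≠ 0) {A : Set ℤ}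
    (hA : Set.Ico 0 (K : ℤ) ⊆ A) {W : L2Mat M N} (hW : ∀ p, ∀ n < 0, coeff (W p) n = 0)
    {R : ℝ≥0} (hR : energy wq W ≤ R) : ‖projMat Aᶜ W‖ ≤ Real.sqrt R * (Real.sqrt K)⁻¹ := by
  have h : (K : ℝ≥0∞) * ‖projMat Aᶜ W‖ₑ ^ 2 ≤ R := by
    refine le_trans ?_ hR
    rw [PiLp.enorm_sq_eq, Finset.mul_sum]
    exact Finset.sum_le_sum fun p _ => enorm_modeProj_compl_sq_le hA (hW p)
  rw [enorm_eq_nnnorm] at h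
  have h' : (K : ℝ) * ‖projMat Aᶜ W‖ ^ 2 ≤ R := by exact_mod_cast h
  have hK' : (0 : ℝ) < K := by positivity
  rw [← Real.sqrt_inv, ← Real.sqrt_mul (NNReal.coe_nonneg R)]
  refine Real.le_sqrt_of_sq_le ?_
  rw [← div_eq_mul_inv, le_div_iff₀ hK', mul_comm]
  exact h'

/-- The derivative of the squared `L²` distance between two trajectories is controlled by a
logarithmic factor. -/
theorem exists_abs_inner_le (M N : ℕ) (R : ℝ≥0) : ∃ C : ℝ, 1 ≤ C ∧
    ∀ K : ℕ, K ≠ 0 → ∀ A B : Set ℤ, Set.Ico 0 (K : ℤ) ⊆ A → Set.Ico 0 (K : ℤ) ⊆ B →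
    ∀ U V : HsPlusMat M N (1 / 2),
      energy wq (toL2Mat U) ≤ R → energy wq (toL2Mat V) ≤ R →
      2 * ‖inner ℂ (toL2Mat U - toL2Mat V)
        (projMat A (cubicL2 U) - projMat B (cubicL2 V))‖ ≤
        C * (1 + Real.log K) * ‖toL2Mat U - toL2Mat V‖ ^ 2 + C * (Real.sqrt K)⁻¹ := by
  obtain ⟨C₁, hC₁, h1⟩ := exists_norm_inner_cubic_sub_le M N R
  obtain ⟨C₂, hC₂, h2⟩ := exists_norm_cubicL2_le M N R
  set S : ℝ := Real.sqrt ((4 * R : ℝ≥0) : ℝ) with hS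
  have hS0 : 0 ≤ S := Real.sqrt_nonneg _
  refine ⟨1 + 2 * C₁ + 4 * (S * C₂), by nlinarith [mul_nonneg hS0 hC₂],
    fun K hK A B hA hB U V hU hV => ?_⟩
  set W := toL2Mat U - toL2Mat V with hW
  have hWR : energy wq W ≤ (4 * R : ℝ≥0) := by
    refine (energy_sub_le wq _ _).trans ((mul_le_mul' le_rfl (add_le_add hU hV)).trans
      (le_of_eq ?_))
    push_cast
    ring
  have hWneg : ∀ p, ∀ n < 0, coeff (W p) n = 0 := fun p n hn => by
    rw [hW, PiLp.sub_apply, coeff_sub, coeff_toL2Mat_of_neg U p hn, coeff_toL2Mat_of_neg V p hn,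
      sub_zero]
  have hdecomp : ∀ (A : Set ℤ) (F : L2Mat M N),
      inner ℂ W (projMat A F) = inner ℂ W F - inner ℂ (projMat Aᶜ W) F := by
    intro A F
    rw [← inner_projMat_left, eq_sub_iff_add_eq, ← inner_add_left, projMat_add_compl]
  have hsmall : ∀ (A : Set ℤ), Set.Ico 0 (K : ℤ) ⊆ A → ∀ Z : HsPlusMat M N (1 / 2),
      energy wq (toL2Mat Z) ≤ R →
      ‖inner ℂ (projMat Aᶜ W) (cubicL2 Z)‖ ≤ S * C₂ * (Real.sqrt K)⁻¹ := by
    intro A hA Z hZ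
    refine (norm_inner_le_norm _ _).trans ?_
    calc _ ≤ (S * (Real.sqrt K)⁻¹) * C₂ := by
          gcongr
          · exact norm_projMat_compl_sq_le hK hA hWneg hWR
          · exact h2 Z hZ
      _ = _ := by ring
  have e : inner ℂ W (projMat A (cubicL2 U) - projMat B (cubicL2 V)) =
      inner ℂ W (cubicL2 U - cubicL2 V) - inner ℂ (projMat Aᶜ W) (cubicL2 U) +
        inner ℂ (projMat Bᶜ W) (cubicL2 V) := by
    rw [inner_sub_right, inner_sub_right, hdecomp, hdecomp]
    ring
  rw [e]
  have hlog : 0 ≤ Real.log K := Real.log_natCast_nonneg K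
  have hi : 0 ≤ (Real.sqrt K)⁻¹ := by positivity
  have hn : ‖inner ℂ W (cubicL2 U - cubicL2 V) - inner ℂ (projMat Aᶜ W) (cubicL2 U) +
      inner ℂ (projMat Bᶜ W) (cubicL2 V)‖ ≤
      C₁ * ((1 + Real.log K) * ‖W‖ ^ 2 + (Real.sqrt K)⁻¹) + S * C₂ * (Real.sqrt K)⁻¹ +
        S * C₂ * (Real.sqrt K)⁻¹ :=
    (norm_add_le _ _).trans (add_le_add ((norm_sub_le _ _).trans
      (add_le_add (h1 K hK U V hU hV) (hsmall A hA U hU))) (hsmall B hB V hV))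
  have hp1 : 0 ≤ (1 + Real.log K) * ‖W‖ ^ 2 := by positivity
  have hp2 : 0 ≤ (1 + Real.log K) * ‖W‖ ^ 2 * (S * C₂) := by positivity
  nlinarith

theorem IsFlow.hasDerivAt_norm_sub_sq {A B : Set ℤ} {I : Set ℝ}
    {U V : ℝ → HsPlusMat M N (1 / 2)} (hU : IsFlow A I U) (hV : IsFlow B I V) {t : ℝ}
    (ht : t ∈ I) :
    HasDerivAt (fun τ => ‖toL2Mat (U τ) - toL2Mat (V τ)‖ ^ 2)
      (2 * (inner ℂ (toL2Mat (U t) - toL2Mat (V t))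
        (projMat A (cubicL2 (U t)) - projMat B (cubicL2 (V t)))).im) t := by
  have hd := (hU.deriv t ht).sub (hV.deriv t ht)
  have hi := HasDerivAt.inner ℂ hd hd
  have hr := Complex.reCLM.hasFDerivAt.comp_hasDerivAt t hi
  have e : ∀ τ, ‖toL2Mat (U τ) - toL2Mat (V τ)‖ ^ 2 =
      Complex.reCLM (inner ℂ (toL2Mat (U τ) - toL2Mat (V τ)) (toL2Mat (U τ) - toL2Mat (V τ))) := by
    intro τ
    rw [inner_self_eq_norm_sq_to_K]
    simp [← Complex.ofReal_pow]
  simp only [e]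
  refine hr.congr_deriv ?_
  have key : ∀ W D : L2Mat M N, Complex.reCLM (inner ℂ W (-Complex.I • D) +
      inner ℂ (-Complex.I • D) W) = 2 * (inner ℂ W D).im := by
    intro W D
    have hc : (inner ℂ D W).im = -(inner ℂ W D).im := by
      rw [← inner_conj_symm]
      exact Complex.conj_im _
    rw [inner_smul_right, inner_smul_left]
    simp [hc]
    ring
  rw [← key, smul_sub]
  rfl

/-- Stability over a time step whose length depends only on the energy bound. -/
theorem exists_stability_step (M N : ℕ) (R : ℝ≥0) : ∃ τ : ℝ, 0 < τ ∧
    ∀ ε : ℝ, 0 < ε → ∃ δ : ℝ, 0 < δ ∧ ∃ K : ℕ, ∀ (A B : Set ℤ) (I : Set ℝ)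
    (U V : ℝ → HsPlusMat M N (1 / 2)), Set.Ico 0 (K : ℤ) ⊆ A → Set.Ico 0 (K : ℤ) ⊆ B →
    I.OrdConnected → IsFlow A I U → IsFlow B I V →
    (∀ t ∈ I, energy wq (toL2Mat (U t)) ≤ R) → (∀ t ∈ I, energy wq (toL2Mat (V t)) ≤ R) →
    ∀ t₀ ∈ I, ∀ t₁ ∈ I, |t₁ - t₀| ≤ τ → ‖toL2Mat (U t₀) - toL2Mat (V t₀)‖ ≤ δ →
      ‖toL2Mat (U t₁) - toL2Mat (V t₁)‖ ≤ ε := by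
  obtain ⟨C, hC, h⟩ := exists_abs_inner_le M N R
  refine ⟨1 / (4 * C), by positivity, fun ε hε => ?_⟩
  -- frequencies are cut at `K`, with `K ^ (1 / 4 - 1 / 2)` small
  obtain ⟨K, hK0, hK⟩ : ∃ K : ℕ, K ≠ 0 ∧ 2 * C * (K : ℝ) ^ (-(1 / 4) : ℝ) ≤ ε ^ 2 / 2 := by
    have ht : Tendsto (fun K : ℕ => 2 * C * (K : ℝ) ^ (-(1 / 4) : ℝ)) atTop (𝓝 0) := by
      have := ((tendsto_rpow_neg_atTop (show (0 : ℝ) < 1 / 4 by norm_num)).comp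
        tendsto_natCast_atTop_atTop).const_mul (2 * C)
      simpa using this
    have hpos : (0 : ℝ) < ε ^ 2 / 2 := by positivity
    obtain ⟨K, hK1, hK2⟩ := ((ht.eventually_le_const hpos).and (eventually_ne_atTop 0)).exists
    exact ⟨K, hK2, hK1⟩
  have hKpos : (0 : ℝ) < K := by positivity
  set q : ℝ := (K : ℝ) ^ (1 / 4 : ℝ) with hq
  have hqpos : 0 < q := Real.rpow_pos_of_pos hKpos _
  refine ⟨Real.sqrt (ε ^ 2 / (4 * q)), Real.sqrt_pos.mpr (by positivity), K,
    fun A B I U V hA hB hI hU hV hUR hVR t₀ ht₀ t₁ ht₁ hτ h0 => ?_⟩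
  have hsub : Set.uIcc t₀ t₁ ⊆ I := hI.uIcc_subset ht₀ ht₁
  have hlog : 0 ≤ Real.log K := Real.log_natCast_nonneg K
  have hgr := le_exp_of_abs_deriv_le (y := fun τ => ‖toL2Mat (U τ) - toL2Mat (V τ)‖ ^ 2)
    (t₀ := t₀) (t₁ := t₁) (a := C * (1 + Real.log K)) (b := C * (Real.sqrt K)⁻¹)
    (by nlinarith) (by positivity) (fun _ _ => by positivity)
    (fun t ht => hU.hasDerivAt_norm_sub_sq hV (hsub ht)) (fun t ht => by
      rw [abs_mul, abs_two]
      refine le_trans ?_ (h K hK0 A B hA hB (U t) (V t) (hUR t (hsub ht)) (hVR t (hsub ht)))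
      gcongr
      exact Complex.abs_im_le_norm _)
  have hexp : Real.exp (C * (1 + Real.log K) * |t₁ - t₀|) ≤ 2 * q := by
    calc Real.exp (C * (1 + Real.log K) * |t₁ - t₀|)
        ≤ Real.exp (C * (1 + Real.log K) * (1 / (4 * C))) := by gcongr
      _ = Real.exp (1 / 4) * q := by
          rw [hq, Real.rpow_def_of_pos hKpos, ← Real.exp_add]
          congr 1
          field_simp
      _ ≤ 2 * q := by
          gcongr
          have h1 : Real.exp (1 / 4) ≤ Real.exp (1 / 2) := by gcongr; norm_num
          have h2 : Real.exp (1 / 2) ^ 2 = Real.exp 1 := by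
            rw [← Real.exp_nat_mul]; norm_num
          have h3 := Real.exp_one_lt_d9
          nlinarith [Real.exp_pos (1 / 2)]
  have h0sq : ‖toL2Mat (U t₀) - toL2Mat (V t₀)‖ ^ 2 ≤ ε ^ 2 / (4 * q) := by
    have := pow_le_pow_left₀ (norm_nonneg _) h0 2
    rwa [Real.sq_sqrt (by positivity)] at this
  have hKq : (Real.sqrt K)⁻¹ * q = (K : ℝ) ^ (-(1 / 4) : ℝ) := by
    rw [hq, Real.sqrt_eq_rpow, ← Real.rpow_neg hKpos.le, ← Real.rpow_add hKpos]
    norm_num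
  have hfin : ‖toL2Mat (U t₁) - toL2Mat (V t₁)‖ ^ 2 ≤ ε ^ 2 := by
    calc _ ≤ _ := hgr
      _ ≤ (ε ^ 2 / (4 * q) + C * (Real.sqrt K)⁻¹) * (2 * q) := by gcongr
      _ = ε ^ 2 / 2 + 2 * C * ((Real.sqrt K)⁻¹ * q) := by field_simp; ring
      _ ≤ ε ^ 2 / 2 + ε ^ 2 / 2 := by rw [hKq]; gcongr
      _ = ε ^ 2 := by ring
  exact (abs_le_of_sq_le_sq' hfin hε.le).2

/-- Stability in `L²` of trajectories of bounded energy, over bounded times and uniformly in the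
truncation. -/
theorem exists_stability (M N : ℕ) (R : ℝ≥0) (T : ℝ) :
    ∀ ε : ℝ, 0 < ε → ∃ δ : ℝ, 0 < δ ∧ ∃ K : ℕ, ∀ (A B : Set ℤ) (I : Set ℝ)
    (U V : ℝ → HsPlusMat M N (1 / 2)), Set.Ico 0 (K : ℤ) ⊆ A → Set.Ico 0 (K : ℤ) ⊆ B →
    I.OrdConnected → IsFlow A I U → IsFlow B I V →
    (∀ t ∈ I, energy wq (toL2Mat (U t)) ≤ R) → (∀ t ∈ I, energy wq (toL2Mat (V t)) ≤ R) →
    ∀ t₀ ∈ I, ∀ t₁ ∈ I, |t₁ - t₀| ≤ T → ‖toL2Mat (U t₀) - toL2Mat (V t₀)‖ ≤ δ →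
      ‖toL2Mat (U t₁) - toL2Mat (V t₁)‖ ≤ ε := by
  obtain ⟨τ, hτ, hstep⟩ := exists_stability_step M N R
  obtain ⟨n, hn⟩ := exists_nat_gt (T / τ)
  rw [div_lt_iff₀ hτ] at hn
  suffices H : ∀ n : ℕ, ∀ ε : ℝ, 0 < ε → ∃ δ : ℝ, 0 < δ ∧ ∃ K : ℕ, ∀ (A B : Set ℤ) (I : Set ℝ)
      (U V : ℝ → HsPlusMat M N (1 / 2)), Set.Ico 0 (K : ℤ) ⊆ A → Set.Ico 0 (K : ℤ) ⊆ B →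
      I.OrdConnected → IsFlow A I U → IsFlow B I V →
      (∀ t ∈ I, energy wq (toL2Mat (U t)) ≤ R) → (∀ t ∈ I, energy wq (toL2Mat (V t)) ≤ R) →
      ∀ t₀ ∈ I, ∀ t₁ ∈ I, |t₁ - t₀| ≤ n * τ → ‖toL2Mat (U t₀) - toL2Mat (V t₀)‖ ≤ δ →
        ‖toL2Mat (U t₁) - toL2Mat (V t₁)‖ ≤ ε by
    intro ε hε
    obtain ⟨δ, hδ, K, h⟩ := H n ε hε
    exact ⟨δ, hδ, K, fun A B I U V hA hB hI hU hV hUR hVR t₀ ht₀ t₁ ht₁ hT h0 =>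
      h A B I U V hA hB hI hU hV hUR hVR t₀ ht₀ t₁ ht₁ (hT.trans hn.le) h0⟩
  intro n
  induction n with
  | zero =>
    refine fun ε hε => ⟨ε, hε, 0, fun A B I U V _ _ _ _ _ _ _ t₀ _ t₁ _ hT h0 => ?_⟩
    have : t₁ = t₀ := by
      rw [Nat.cast_zero, zero_mul] at hT
      exact sub_eq_zero.mp (abs_nonpos_iff.mp hT)
    rwa [this]
  | succ n ih =>
    intro ε hε
    obtain ⟨δ₁, hδ₁, K₁, h₁⟩ := hstep ε hε
    obtain ⟨δ₂, hδ₂, K₂, h₂⟩ := ih δ₁ hδ₁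
    refine ⟨δ₂, hδ₂, max K₁ K₂, fun A B I U V hA hB hI hU hV hUR hVR t₀ ht₀ t₁ ht₁ hT h0 => ?_⟩
    have hK1 : Set.Ico 0 (K₁ : ℤ) ⊆ Set.Ico 0 ((max K₁ K₂ : ℕ) : ℤ) :=
      Set.Ico_subset_Ico_right (by exact_mod_cast le_max_left _ _)
    have hK2 : Set.Ico 0 (K₂ : ℤ) ⊆ Set.Ico 0 ((max K₁ K₂ : ℕ) : ℤ) :=
      Set.Ico_subset_Ico_right (by exact_mod_cast le_max_right _ _)
    set θ : ℝ := n / (n + 1) with hθ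
    have hn1 : (0 : ℝ) < n + 1 := by positivity
    have hθ0 : 0 ≤ θ := by positivity
    have hθ1 : 1 - θ = 1 / (n + 1) := by rw [hθ]; field_simp; ring
    set s := t₀ + θ * (t₁ - t₀) with hs
    have hsI : s ∈ I := by
      refine hI.uIcc_subset ht₀ ht₁ ?_
      rw [← segment_eq_uIcc]
      refine ⟨1 - θ, θ, by rw [hθ1]; positivity, hθ0, by ring, ?_⟩
      simp only [smul_eq_mul, hs]
      ring
    push_cast at hT
    have hs0 : |s - t₀| ≤ n * τ := by
      rw [hs, add_sub_cancel_left, abs_mul, abs_of_nonneg hθ0]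
      calc θ * |t₁ - t₀| ≤ θ * ((n + 1) * τ) := by gcongr
        _ = n * τ := by rw [hθ]; field_simp
    have hs1 : |t₁ - s| ≤ τ := by
      have : t₁ - s = (1 - θ) * (t₁ - t₀) := by rw [hs]; ring
      rw [this, abs_mul, hθ1, abs_of_nonneg (by positivity)]
      calc 1 / ((n : ℝ) + 1) * |t₁ - t₀| ≤ 1 / ((n : ℝ) + 1) * ((n + 1) * τ) := by gcongr
        _ = τ := by field_simp
    exact h₁ A B I U V (hK1.trans hA) (hK1.trans hB) hI hU hV hUR hVR s hsI t₁ ht₁ hs1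
      (h₂ A B I U V (hK2.trans hA) (hK2.trans hB) hI hU hV hUR hVR t₀ ht₀ s hsI hs0 h0)

/-! ### Galerkin approximations -/

theorem mem_Ico_iff_exists_fin {K : ℕ} {m : ℤ} :
    m ∈ Set.Ico 0 (K : ℤ) ↔ ∃ n : Fin K, ((n : ℕ) : ℤ) = m := by
  constructor
  · rintro ⟨h1, h2⟩
    exact ⟨⟨m.toNat, by omega⟩, by simpa using h1⟩
  · rintro ⟨n, rfl⟩
    exact ⟨by omega, by exact_mod_cast n.2⟩

theorem energy_projMat_Ico_le (K : ℕ) (s : ℝ) (U : L2Mat M N) :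
    energy (wsob s) (projMat (Set.Ico 0 (K : ℤ)) U) ≤
      (∑ n : Fin K, wsob s (n : ℕ) : ℝ≥0) * ‖U‖ₑ ^ 2 := by
  set c : ℝ≥0 := ∑ n : Fin K, wsob s (n : ℕ) with hc
  rw [← energy_one, ← energy_const_mul]
  refine le_trans ?_ (energy_projMat_le (Set.Ico 0 (K : ℤ)) _ U)
  refine Finset.sum_le_sum fun p _ => wsum_mono fun m hm => ?_
  have hmem : m ∈ Set.Ico 0 (K : ℤ) := by
    by_contra h
    exact hm (coeff_modeProj_of_notMem h _)
  obtain ⟨n, rfl⟩ := mem_Ico_iff_exists_fin.mp hmem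
  simp only [Pi.one_apply, mul_one]
  exact Finset.single_le_sum (f := fun n : Fin K => wsob s (n : ℕ)) (fun _ _ => zero_le)
    (Finset.mem_univ n)

theorem exists_trunc (K : ℕ) (s : ℝ) (U : L2Mat M N) :
    ∃ V : HsPlusMat M N s, toL2Mat V = projMat (Set.Ico 0 (K : ℤ)) U := by
  refine exists_toL2Mat_eq (fun p n hn => ?_) ?_
  · refine coeff_modeProj_of_notMem (fun h => ?_) _
    exact absurd h.1 (not_le.mpr hn)
  · refine ne_top_of_le_ne_top ?_ (energy_projMat_Ico_le K s U)
    exact ENNReal.mul_ne_top ENNReal.coe_ne_top (ENNReal.pow_ne_top enorm_ne_top)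

/-- The projection of an `L²` function onto the modes `0 ≤ n < K`, as a continuous map into `H^s_+`:
trigonometric polynomials belong to every Sobolev space. -/
def trunc (K : ℕ) (s : ℝ) : L2Mat M N →L[ℂ] HsPlusMat M N s :=
  LinearMap.mkContinuous
    { toFun := fun U => (exists_trunc K s U).choose
      map_add' := fun U V => toL2Mat_injective <| by
        rw [toL2Mat_add, (exists_trunc K s _).choose_spec, (exists_trunc K s _).choose_spec,
          (exists_trunc K s _).choose_spec, map_add]
      map_smul' := fun c U => toL2Mat_injective <| by
        rw [RingHom.id_apply, toL2Mat_smul, (exists_trunc K s _).choose_spec,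
          (exists_trunc K s _).choose_spec, map_smul] }
    (Real.sqrt (∑ n : Fin K, wsob s (n : ℕ) : ℝ≥0)) fun U => by
    have h := energy_projMat_Ico_le K s U
    rw [← (exists_trunc K s U).choose_spec, ← HsPlusMat.enorm_sq_eq, enorm_eq_nnnorm,
      enorm_eq_nnnorm] at h
    have h' : ‖(exists_trunc K s U).choose‖ ^ 2 ≤
      (∑ n : Fin K, wsob s (n : ℕ) : ℝ≥0) * ‖U‖ ^ 2 := by exact_mod_cast h
    change ‖(exists_trunc K s U).choose‖ ≤ _
    rw [← Real.sqrt_sq (norm_nonneg U), ← Real.sqrt_mul (NNReal.coe_nonneg _)]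
    exact Real.le_sqrt_of_sq_le h'

theorem toL2Mat_trunc (K : ℕ) (s : ℝ) (U : L2Mat M N) :
    toL2Mat (trunc K s U) = projMat (Set.Ico 0 (K : ℤ)) U :=
  (exists_trunc K s U).choose_spec

/-- The trigonometric polynomial with prescribed coefficients at the modes `0 ≤ n < K`. -/
def synth (M N K : ℕ) : (Fin M × Fin N → Fin K → ℂ) →L[ℂ] L2Mat M N :=
  LinearMap.toContinuousLinearMap
    { toFun := fun a => WithLp.toLp 2 fun p =>
        ∑ n : Fin K, a p n • (fourierLp 2 ((n : ℕ) : ℤ) : L2)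
      map_add' := fun a b => by
        ext1 p
        simp [add_smul, Finset.sum_add_distrib]
      map_smul' := fun c a => by
        ext1 p
        simp [mul_smul, Finset.smul_sum] }

theorem synth_apply {K : ℕ} (a : Fin M × Fin N → Fin K → ℂ) (p : Fin M × Fin N) :
    synth M N K a p = ∑ n : Fin K, a p n • (fourierLp 2 ((n : ℕ) : ℤ) : L2) := rfl

theorem coeff_synth {K : ℕ} (a : Fin M × Fin N → Fin K → ℂ) (p : Fin M × Fin N) (n : Fin K) :
    coeff (synth M N K a p) (n : ℕ) = a p n := by
  rw [synth_apply, coeff_sum]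
  simp only [coeff_smul, coeff_fourierLp, Nat.cast_inj, Fin.val_inj, mul_ite, mul_one, mul_zero,
    Finset.sum_ite_eq, Finset.mem_univ, if_true]

theorem coeff_synth_of_notMem {K : ℕ} (a : Fin M × Fin N → Fin K → ℂ) (p : Fin M × Fin N) {m : ℤ}
    (hm : m ∉ Set.Ico 0 (K : ℤ)) : coeff (synth M N K a p) m = 0 := by
  rw [synth_apply, coeff_sum]
  refine Finset.sum_eq_zero fun n _ => ?_
  rw [coeff_smul, coeff_fourierLp, if_neg, mul_zero]
  rintro rfl
  exact hm (mem_Ico_iff_exists_fin.mpr ⟨n, rfl⟩)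

theorem synth_coeff (K : ℕ) (U : L2Mat M N) :
    synth M N K (fun p n => coeff (U p) (n : ℕ)) = projMat (Set.Ico 0 (K : ℤ)) U := by
  ext1 p
  refine coeff_ext fun m => ?_
  rw [projMat_apply]
  by_cases hm : m ∈ Set.Ico 0 (K : ℤ)
  · rw [coeff_modeProj_of_mem hm]
    obtain ⟨n, rfl⟩ := mem_Ico_iff_exists_fin.mp hm
    rw [coeff_synth]
  · rw [coeff_modeProj_of_notMem hm, coeff_synth_of_notMem _ _ hm]

theorem energy_synth {K : ℕ} (w : ℤ → ℝ≥0) (a : Fin M × Fin N → Fin K → ℂ) :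
    energy w (synth M N K a) =
      ((∑ p, ∑ n : Fin K, w (n : ℕ) * ‖a p n‖₊ ^ 2 : ℝ≥0) : ℝ≥0∞) := by
  push_cast
  refine Finset.sum_congr rfl fun p _ => ?_
  have hinj : Function.Injective fun n : Fin K => ((n : ℕ) : ℤ) := fun m n h => by
    simpa [Fin.val_inj] using h
  have hs : (Function.support fun m : ℤ => (w m : ℝ≥0∞) * ‖coeff (synth M N K a p) m‖ₑ ^ 2) ⊆
      Set.range fun n : Fin K => ((n : ℕ) : ℤ) := by
    intro m hm
    by_contra h
    apply hm
    have : m ∉ Set.Ico 0 (K : ℤ) := fun h' => h (mem_Ico_iff_exists_fin.mp h')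
    simp [coeff_synth_of_notMem a p this]
  rw [wsum, ← hinj.tsum_eq hs, tsum_fintype]
  simp only [coeff_synth, enorm_eq_nnnorm]

/-! ### The coefficients of the nonlinearity on trigonometric polynomials -/

theorem ae_sum_fourierLp {K : ℕ} (c : Fin K → ℂ) :
    (∑ n : Fin K, c n • (fourierLp 2 ((n : ℕ) : ℤ) : L2) : L2) =ᵐ[AddCircle.haarAddCircle]
      fun x => ∑ n : Fin K, c n * fourier ((n : ℕ) : ℤ) x := by
  have : ∀ᵐ x ∂(AddCircle.haarAddCircle : Measure Torus), ∀ n : Fin K,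
      (c n • (fourierLp 2 ((n : ℕ) : ℤ) : L2) : L2) x = c n * fourier ((n : ℕ) : ℤ) x := by
    rw [ae_all_iff]
    intro n
    filter_upwards [Lp.coeFn_smul (c n) (fourierLp 2 ((n : ℕ) : ℤ) : L2), coeFn_fourierLp 2 (n : ℕ)]
      with x hx hx'
    rw [hx, Pi.smul_apply, hx', smul_eq_mul]
  filter_upwards [this, Lp.coeFn_finsetSum Finset.univ
    fun n : Fin K => c n • (fourierLp 2 ((n : ℕ) : ℤ) : L2)] with x h1 h2
  rw [h2, Finset.sum_apply]
  exact Finset.sum_congr rfl fun n _ => h1 n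

theorem fourier_mul_star_mul (l m n : ℤ) (x : Torus) :
    fourier l x * star (fourier m x) * fourier n x = fourier (l - m + n) x := by
  rw [fourier_add, sub_eq_add_neg, fourier_add, fourier_neg]
  rfl

theorem fourierCoeff_const_mul_fourier (c : ℂ) (m n : ℤ) :
    fourierCoeff (fun x : Torus => c * fourier m x) n = if n = m then c else 0 := by
  rw [fourierCoeff.const_mul, fourierCoeff_fourier]
  by_cases h : n = m
  · simp [h]
  · simp [h]

theorem coeff_tri_of_sum {K : ℕ} {f g h : Hs (1 / 2)} {a b c : Fin K → ℂ}
    (hf : f.toL2 = ∑ n : Fin K, a n • (fourierLp 2 ((n : ℕ) : ℤ) : L2))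
    (hg : g.toL2 = ∑ n : Fin K, b n • (fourierLp 2 ((n : ℕ) : ℤ) : L2))
    (hh : h.toL2 = ∑ n : Fin K, c n • (fourierLp 2 ((n : ℕ) : ℤ) : L2)) (n : ℤ) :
    coeff (tri f g h) n = ∑ m₁ : Fin K, ∑ m₂ : Fin K, ∑ m₃ : Fin K,
      if n = ((m₁ : ℕ) : ℤ) - ((m₂ : ℕ) : ℤ) + ((m₃ : ℕ) : ℤ) then
        a m₁ * star (b m₂) * c m₃ else 0 := by
  have e : tri f g h =ᵐ[AddCircle.haarAddCircle] fun x => ∑ q : Fin K × Fin K × Fin K,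
      (a q.1 * star (b q.2.1) * c q.2.2) *
        fourier (((q.1 : ℕ) : ℤ) - ((q.2.1 : ℕ) : ℤ) + ((q.2.2 : ℕ) : ℤ)) x := by
    have ha := ae_sum_fourierLp a
    have hb := ae_sum_fourierLp b
    have hc := ae_sum_fourierLp c
    rw [← hf] at ha
    rw [← hg] at hb
    rw [← hh] at hc
    filter_upwards [coeFn_tri f g h, ha, hb, hc] with x h1 h2 h3 h4
    rw [h1, h2, h3, h4, star_sum, Finset.sum_mul_sum, Finset.sum_mul, Fintype.sum_prod_type]
    refine Finset.sum_congr rfl fun m₁ _ => ?_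
    rw [Finset.sum_mul_sum, Fintype.sum_prod_type]
    refine Finset.sum_congr rfl fun m₂ _ => Finset.sum_congr rfl fun m₃ _ => ?_
    rw [← fourier_mul_star_mul, star_mul']
    ring
  have hint : ∀ q ∈ (Finset.univ : Finset (Fin K × Fin K × Fin K)), Integrable (fun x =>
      (a q.1 * star (b q.2.1) * c q.2.2) *
        fourier (((q.1 : ℕ) : ℤ) - ((q.2.1 : ℕ) : ℤ) + ((q.2.2 : ℕ) : ℤ)) x)
      (AddCircle.haarAddCircle : Measure Torus) := fun q _ =>
    ((map_continuous (fourier _)).integrable_of_hasCompactSupport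
      (HasCompactSupport.of_compactSpace _)).const_mul _
  have hsum := congrFun (fourierCoeff.sum Finset.univ _ hint) n
  rw [Finset.sum_apply] at hsum
  simp only [fourierCoeff_const_mul_fourier] at hsum
  rw [coeff, fourierCoeff_congr_ae e]
  have e2 : (fun x : Torus => ∑ q : Fin K × Fin K × Fin K,
      (a q.1 * star (b q.2.1) * c q.2.2) *
        fourier (((q.1 : ℕ) : ℤ) - ((q.2.1 : ℕ) : ℤ) + ((q.2.2 : ℕ) : ℤ)) x) =
      ∑ q : Fin K × Fin K × Fin K, fun x : Torus => (a q.1 * star (b q.2.1) * c q.2.2) *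
        fourier (((q.1 : ℕ) : ℤ) - ((q.2.1 : ℕ) : ℤ) + ((q.2.2 : ℕ) : ℤ)) x := by
    ext x
    rw [Finset.sum_apply]
  rw [e2, hsum]
  simp only [Fintype.sum_prod_type]

/-- The truncated trigonometric polynomial, in `H^{1/2}_+`. -/
def synthHalf (M N K : ℕ) : (Fin M × Fin N → Fin K → ℂ) →L[ℂ] HsPlusMat M N (1 / 2) :=
  trunc K (1 / 2) ∘L synth M N K

theorem toL2Mat_synthHalf {K : ℕ} (a : Fin M × Fin N → Fin K → ℂ) :
    toL2Mat (synthHalf M N K a) = synth M N K a := by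
  rw [synthHalf, ContinuousLinearMap.comp_apply, toL2Mat_trunc]
  exact projMat_eq_self fun p n hn => coeff_synth_of_notMem a p hn

/-- The Fourier coefficients of the nonlinearity on a trigonometric polynomial, as a sum over resonant
frequencies. -/
theorem coeff_cubicL2_synthHalf {K : ℕ} (c : Fin M × Fin N → Fin K → ℂ) (p : Fin M × Fin N)
    (n : ℤ) :
    coeff (cubicL2 (synthHalf M N K c) p) n =
      ∑ b : Fin M, ∑ a : Fin N, ∑ m₁ : Fin K, ∑ m₂ : Fin K, ∑ m₃ : Fin K,
        if n = ((m₁ : ℕ) : ℤ) - ((m₂ : ℕ) : ℤ) + ((m₃ : ℕ) : ℤ) then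
          c (p.1, a) m₁ * star (c (b, a) m₂) * c (b, p.2) m₃ else 0 := by
  have he : ∀ q, Hs.toL2 ((synthHalf M N K c) q : Hs (1 / 2)) =
      ∑ n : Fin K, c q n • (fourierLp 2 ((n : ℕ) : ℤ) : L2) := fun q => by
    rw [← toL2Mat_apply, toL2Mat_synthHalf, synth_apply]
  rw [cubicL2_apply, coeff_sum]
  refine Finset.sum_congr rfl fun b _ => ?_
  rw [coeff_sum]
  exact Finset.sum_congr rfl fun a _ => coeff_tri_of_sum (he _) (he _) (he _) n

/-! ### Conservation of the energy -/

/-- The quartic expression `c_{ka}(m₁) \bar c_{ba}(m₂) c_{bj}(m₃) \bar c_{kj}(n)`, restricted to the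
resonant frequencies `n + m₂ = m₁ + m₃`; the indices are listed as `(k, j, n, b, a, m₁, m₂, m₃)`. -/
def quartic {K : ℕ} (c : Fin M × Fin N → Fin K → ℂ)
    (i : Fin M × Fin N × Fin K × Fin M × Fin N × Fin K × Fin K × Fin K) : ℂ :=
  match i with
  | (k, j, n, b, a, m₁, m₂, m₃) =>
    if (n : ℕ) + m₂ = (m₁ : ℕ) + m₃ then
      c (k, a) m₁ * star (c (b, a) m₂) * c (b, j) m₃ * star (c (k, j) n) else 0

/-- The weighted sum of the quartic form is real; this is the algebraic source of the conservation
of energy. -/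
theorem im_sum_quartic {K : ℕ} (c : Fin M × Fin N → Fin K → ℂ) :
    (∑ i, ((1 + (i.2.2.1 : ℕ) : ℝ) : ℂ) * quartic c i).im = 0 := by
  -- relabelling the indices shows that the weight may be moved to any of the four frequencies, up
  -- to conjugation, and the weights balance on the resonant set
  let σ : Fin M × Fin N × Fin K × Fin M × Fin N × Fin K × Fin K × Fin K →
      Fin M × Fin N × Fin K × Fin M × Fin N × Fin K × Fin K × Fin K :=
    fun ⟨k, j, n, b, a, m₁, m₂, m₃⟩ => (b, a, m₂, k, j, m₃, n, m₁)
  let τ : Fin M × Fin N × Fin K × Fin M × Fin N × Fin K × Fin K × Fin K →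
      Fin M × Fin N × Fin K × Fin M × Fin N × Fin K × Fin K × Fin K :=
    fun ⟨k, j, n, b, a, m₁, m₂, m₃⟩ => (k, a, m₁, b, j, n, m₃, m₂)
  have hσ : Function.Involutive σ := fun _ => rfl
  have hτ : Function.Involutive τ := fun _ => rfl
  have hqσ : ∀ i, quartic c (σ i) = quartic c i := by
    rintro ⟨k, j, n, b, a, m₁, m₂, m₃⟩
    simp only [σ, quartic]
    split_ifs with h1 h2 h2
    · ring
    · omega
    · omega
    · rfl
  have hqτ : ∀ i, quartic c (τ i) = star (quartic c i) := by
    rintro ⟨k, j, n, b, a, m₁, m₂, m₃⟩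
    simp only [τ, quartic]
    split_ifs with h1 h2 h2
    · simp only [star_mul', star_star]
      ring
    · omega
    · omega
    · simp
  set Z := ∑ i, ((1 + (i.2.2.1 : ℕ) : ℝ) : ℂ) * quartic c i with hZ
  have h1 : Z = ∑ i, ((1 + (i.2.2.2.2.2.2.1 : ℕ) : ℝ) : ℂ) * quartic c i := by
    rw [hZ, ← Equiv.sum_comp hσ.toPerm]
    refine Finset.sum_congr rfl fun i _ => ?_
    simp only [Function.Involutive.coe_toPerm, hqσ]
    rfl
  have hstar : ∀ (r : _ → ℝ) (Y : ℂ), Y = ∑ i, ((r i : ℝ) : ℂ) * quartic c i →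
      star Y = ∑ i, ((r (τ i) : ℝ) : ℂ) * quartic c i := by
    rintro r Y rfl
    rw [← Equiv.sum_comp hτ.toPerm, star_sum]
    refine Finset.sum_congr rfl fun i _ => ?_
    simp only [Function.Involutive.coe_toPerm, hqτ, star_mul', star_star]
    rw [Complex.star_def, Complex.conj_ofReal]
  have h2 := hstar _ _ hZ
  have h3 := hstar _ _ h1
  have h4 : Z + Z = star Z + star Z := by
    nth_rewrite 1 [h1]
    nth_rewrite 1 [hZ]
    nth_rewrite 1 [h2]
    rw [h3, ← Finset.sum_add_distrib, ← Finset.sum_add_distrib]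
    refine Finset.sum_congr rfl ?_
    rintro ⟨k, j, n, b, a, m₁, m₂, m₃⟩ -
    simp only [τ, quartic]
    split_ifs with h
    · have h' : ((n : ℕ) : ℂ) + ((m₂ : ℕ) : ℂ) = ((m₁ : ℕ) : ℂ) + ((m₃ : ℕ) : ℂ) := by
        exact_mod_cast h
      push_cast
      rw [← add_mul, ← add_mul]
      congr 1
      linear_combination h'
    · simp
  have h5 : Z = star Z := by
    have : (2 : ℂ) * Z = 2 * star Z := by rw [two_mul, two_mul, h4]
    exact mul_left_cancel₀ two_ne_zero this
  exact Complex.conj_eq_iff_im.mp h5.symm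

/-- The pairing `⟨(1 + |D|) U, U U^* U⟩` is real for trigonometric polynomials. -/
theorem im_sum_star_mul_coeff_cubicL2 {K : ℕ} (c : Fin M × Fin N → Fin K → ℂ) :
    (∑ p, ∑ n : Fin K, ((1 + (n : ℕ) : ℝ) : ℂ) *
      (star (c p n) * coeff (cubicL2 (synthHalf M N K c) p) (n : ℕ))).im = 0 := by
  rw [← im_sum_quartic c]
  congr 1
  simp only [Fintype.sum_prod_type, coeff_cubicL2_synthHalf, Finset.mul_sum]
  refine Finset.sum_congr rfl fun k _ => Finset.sum_congr rfl fun j _ =>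
    Finset.sum_congr rfl fun n _ => Finset.sum_congr rfl fun b _ => Finset.sum_congr rfl fun a _ =>
    Finset.sum_congr rfl fun m₁ _ => Finset.sum_congr rfl fun m₂ _ =>
    Finset.sum_congr rfl fun m₃ _ => ?_
  simp only [quartic]
  split_ifs with h1 h2 h2
  · ring
  · omega
  · omega
  · simp

/-! ### Global existence of the Galerkin approximations -/

/-- The Galerkin vector field, in terms of the Fourier coefficients at the modes `0 ≤ n < K`. -/
def galerkinField {K : ℕ} (a : Fin M × Fin N → Fin K → ℂ) : Fin M × Fin N → Fin K → ℂ :=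
  fun p n => -Complex.I * coeff (cubicL2 (synthHalf M N K a) p) (n : ℕ)

theorem synth_galerkinField {K : ℕ} (a : Fin M × Fin N → Fin K → ℂ) :
    synth M N K (galerkinField a) =
      -Complex.I • projMat (Set.Ico 0 (K : ℤ)) (cubicL2 (synthHalf M N K a)) := by
  rw [← synth_coeff, ← map_smul]
  rfl

theorem contDiff_galerkinField {K : ℕ} :
    ContDiff ℝ 1 (galerkinField : (Fin M × Fin N → Fin K → ℂ) → _) := by
  have hs : ContDiff ℝ 1 fun a : Fin M × Fin N → Fin K → ℂ => cubicL2 (synthHalf M N K a) :=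
    contDiff_cubicL2.comp ((synthHalf M N K).restrictScalars ℝ).contDiff
  refine contDiff_pi.mpr fun p => contDiff_pi.mpr fun n => ?_
  have hp : ContDiff ℝ 1 fun U : L2Mat M N => coeff (U p) (n : ℕ) := by
    simp only [← coeffL_apply]
    exact (((coeffL (n : ℕ)) ∘L (PiLp.proj 2 (fun _ : Fin M × Fin N => L2) p :
      L2Mat M N →L[ℂ] L2)).restrictScalars ℝ).contDiff
  exact contDiff_const.mul (hp.comp hs)

/-- The energy with weight `1 + n` in terms of the Fourier coefficients. -/
def galerkinEnergy {K : ℕ} (a : Fin M × Fin N → Fin K → ℂ) : ℝ :=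
  ∑ p, ∑ n : Fin K, (1 + (n : ℕ) : ℝ) * ‖a p n‖ ^ 2

theorem energy_wq_synth {K : ℕ} (a : Fin M × Fin N → Fin K → ℂ) :
    energy wq (synth M N K a) = ENNReal.ofReal (galerkinEnergy a) := by
  rw [energy_synth, ← ENNReal.ofReal_coe_nnreal, galerkinEnergy]
  push_cast
  simp [wq]

theorem norm_le_sqrt_galerkinEnergy {K : ℕ} (a : Fin M × Fin N → Fin K → ℂ) :
    ‖a‖ ≤ Real.sqrt (galerkinEnergy a) := by
  refine (pi_norm_le_iff_of_nonneg (Real.sqrt_nonneg _)).mpr fun p =>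
    (pi_norm_le_iff_of_nonneg (Real.sqrt_nonneg _)).mpr fun n => Real.le_sqrt_of_sq_le ?_
  have h0 : ∀ p, ∀ n : Fin K, 0 ≤ (1 + (n : ℕ) : ℝ) * ‖a p n‖ ^ 2 := fun _ _ => by positivity
  calc ‖a p n‖ ^ 2 ≤ (1 + (n : ℕ) : ℝ) * ‖a p n‖ ^ 2 :=
        le_mul_of_one_le_left (by positivity) (by simp)
    _ ≤ ∑ n : Fin K, (1 + (n : ℕ) : ℝ) * ‖a p n‖ ^ 2 :=
        Finset.single_le_sum (f := fun n : Fin K => (1 + (n : ℕ) : ℝ) * ‖a p n‖ ^ 2)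
          (fun n _ => h0 p n) (Finset.mem_univ n)
    _ ≤ _ := Finset.single_le_sum (f := fun p => ∑ n : Fin K, (1 + (n : ℕ) : ℝ) * ‖a p n‖ ^ 2)
          (fun p _ => Finset.sum_nonneg fun n _ => h0 p n) (Finset.mem_univ p)

/-- The energy is conserved by the Galerkin field, also after multiplication of the field by a real
scalar `χ`, which allows for a cut-off. -/
theorem hasDerivWithinAt_galerkinEnergy {K : ℕ} {a : ℝ → Fin M × Fin N → Fin K → ℂ} {χ t : ℝ}
    {S : Set ℝ} (h : HasDerivWithinAt a (χ • galerkinField (a t)) S t) :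
    HasDerivWithinAt (fun τ => galerkinEnergy (a τ)) 0 S t := by
  have h1 : ∀ p, ∀ n : Fin K, HasDerivWithinAt (fun τ => (1 + (n : ℕ) : ℝ) * ‖a τ p n‖ ^ 2)
      ((1 + (n : ℕ) : ℝ) * (2 * inner ℝ (a t p n) ((χ • galerkinField (a t)) p n))) S t :=
    fun p n => ((hasDerivWithinAt_pi.mp (hasDerivWithinAt_pi.mp h p) n).norm_sq).const_mul _
  have h2 := HasDerivWithinAt.fun_sum (u := Finset.univ) fun p (_ : p ∈ Finset.univ) =>
    HasDerivWithinAt.fun_sum (u := Finset.univ) fun n (_ : n ∈ Finset.univ) => h1 p n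
  have h3 := im_sum_star_mul_coeff_cubicL2 (M := M) (N := N) (a t)
  have h4 : (∑ p, ∑ n : Fin K, (1 + (n : ℕ) : ℝ) *
      (2 * inner ℝ (a t p n) ((χ • galerkinField (a t)) p n))) =
      2 * χ * (∑ p, ∑ n : Fin K, ((1 + (n : ℕ) : ℝ) : ℂ) *
      (star (a t p n) * coeff (cubicL2 (synthHalf M N K (a t)) p) (n : ℕ))).im := by
    simp only [Complex.im_sum, Finset.mul_sum]
    refine Finset.sum_congr rfl fun p _ => Finset.sum_congr rfl fun n _ => ?_
    rw [Complex.im_ofReal_mul, Complex.inner]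
    simp only [Pi.smul_apply, galerkinField, Complex.real_smul, Complex.star_def,
      Complex.mul_re, Complex.mul_im, Complex.conj_re, Complex.conj_im, Complex.ofReal_re,
      Complex.ofReal_im, Complex.neg_re, Complex.neg_im, Complex.I_re, Complex.I_im]
    ring
  rw [h4, h3, mul_zero] at h2
  exact h2

/-- The Galerkin equation has solutions on arbitrarily long time intervals: its vector field is
modified far away to become globally Lipschitz, and the conserved energy keeps the solution in the
region where the field is not modified. -/
theorem exists_galerkin_coeff {K : ℕ} (a₀ : Fin M × Fin N → Fin K → ℂ) (t₀ : ℝ) {T : ℝ}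
    (hT : 0 < T) : ∃ a : ℝ → Fin M × Fin N → Fin K → ℂ, a t₀ = a₀ ∧
      ∀ t ∈ Set.Ioo (t₀ - T) (t₀ + T), HasDerivAt a (galerkinField (a t)) t ∧
        galerkinEnergy (a t) = galerkinEnergy a₀ := by
  set ρ := Real.sqrt (galerkinEnergy a₀) + 1 with hρ
  have hρ0 : 0 < ρ := by positivity
  let χ : ContDiffBump (0 : Fin M × Fin N → Fin K → ℂ) := ⟨ρ, ρ + 1, hρ0, by linarith⟩
  set G : (Fin M × Fin N → Fin K → ℂ) → Fin M × Fin N → Fin K → ℂ :=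
    fun a => χ a • galerkinField a with hG
  have hGc : ContDiff ℝ 1 G := χ.contDiff.smul contDiff_galerkinField
  have hGs : HasCompactSupport G := χ.hasCompactSupport.smul_right
  obtain ⟨C, hC⟩ := ContDiff.lipschitzWith_of_hasCompactSupport (𝕂 := ℝ) hGs hGc one_ne_zero
  obtain ⟨L, hL⟩ := hGs.exists_bound_of_continuous hGc.continuous
  have hL0 : 0 ≤ L := (norm_nonneg _).trans (hL 0)
  have hmem : t₀ ∈ Set.Icc (t₀ - T) (t₀ + T) := ⟨by linarith, by linarith⟩
  have hPL : IsPicardLindelof (fun _ => G) (⟨t₀, hmem⟩ : Set.Icc (t₀ - T) (t₀ + T)) a₀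
      (L.toNNReal * T.toNNReal) 0 L.toNNReal C := by
    refine IsPicardLindelof.of_time_independent (fun x _ => (hL x).trans (Real.le_coe_toNNReal L))
      hC.lipschitzOnWith ?_
    simp [hT.le]
  obtain ⟨a, ha0, ha⟩ := hPL.exists_eq_forall_mem_Icc_hasDerivWithinAt₀
  change a t₀ = a₀ at ha0
  have hcons : ∀ t ∈ Set.Icc (t₀ - T) (t₀ + T), galerkinEnergy (a t) = galerkinEnergy a₀ := by
    have hd : ∀ t ∈ Set.Icc (t₀ - T) (t₀ + T), HasDerivWithinAt (fun τ => galerkinEnergy (a τ)) 0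
        (Set.Icc (t₀ - T) (t₀ + T)) t := fun t ht => hasDerivWithinAt_galerkinEnergy (ha t ht)
    have hc := constant_of_derivWithin_zero (fun t ht => (hd t ht).differentiableWithinAt)
      (fun t ht => (hd t ⟨ht.1, ht.2.le⟩).derivWithin
        (uniqueDiffOn_Icc (by linarith) t ⟨ht.1, ht.2.le⟩))
    intro t ht
    rw [hc t ht, ← hc t₀ hmem, ha0]
  refine ⟨a, ha0, fun t ht => ?_⟩
  have ht' := Set.Ioo_subset_Icc_self ht
  refine ⟨?_, hcons t ht'⟩
  have h1 := (ha t ht').hasDerivAt (Icc_mem_nhds ht.1 ht.2)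
  have h2 : χ (a t) = 1 := by
    refine χ.one_of_mem_closedBall ?_
    rw [mem_closedBall_zero_iff]
    have := norm_le_sqrt_galerkinEnergy (a t)
    rw [hcons t ht'] at this
    exact this.trans (by change _ ≤ ρ; rw [hρ]; linarith)
  simpa only [hG, h2, one_smul] using h1

/-- The Galerkin approximations as trajectories in `H^{1/2}_+`, with conserved energy. -/
theorem exists_galerkin (K : ℕ) (U₀ : L2Mat M N) (t₀ : ℝ) {T : ℝ} (hT : 0 < T) :
    ∃ U : ℝ → HsPlusMat M N (1 / 2),
      IsFlow (Set.Ico 0 (K : ℤ)) (Set.Ioo (t₀ - T) (t₀ + T)) U ∧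
      toL2Mat (U t₀) = projMat (Set.Ico 0 (K : ℤ)) U₀ ∧
      ∀ t ∈ Set.Ioo (t₀ - T) (t₀ + T),
        energy wq (toL2Mat (U t)) = energy wq (projMat (Set.Ico 0 (K : ℤ)) U₀) := by
  obtain ⟨a, ha0, ha⟩ := exists_galerkin_coeff (fun p (n : Fin K) => coeff (U₀ p) (n : ℕ)) t₀ hT
  refine ⟨fun t => synthHalf M N K (a t), ⟨fun t _ p n hn => ?_, fun t ht => ?_⟩, ?_,
    fun t ht => ?_⟩
  · rw [toL2Mat_synthHalf, coeff_synth_of_notMem _ _ hn]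
  · simp only [toL2Mat_synthHalf]
    rw [← synth_galerkinField]
    exact ((synth M N K).restrictScalars ℝ).hasFDerivAt.comp_hasDerivAt t (ha t ht).1
  · rw [toL2Mat_synthHalf, ha0, synth_coeff]
  · rw [toL2Mat_synthHalf, ← synth_coeff, energy_wq_synth, energy_wq_synth, (ha t ht).2]

/-! ### Global well-posedness in `H^{1/2}` -/

/-- Two families of trajectories of (truncations of) the equation that are asymptotically close in
`L²` at time `t₀` stay so at later and earlier times, as long as their energies are bounded and the
truncations disappear in the limit. -/
theorem tendsto_sub_of_isFlow {α : Type*} {l : Filter α} {A B : α → Set ℤ} {I : α → Set ℝ}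
    {U V : α → ℝ → HsPlusMat M N (1 / 2)} (R : ℝ≥0) (T : ℝ) {t₀ : ℝ} {t₁ : α → ℝ}
    (hA : ∀ K : ℕ, ∀ᶠ a in l, Set.Ico 0 (K : ℤ) ⊆ A a)
    (hB : ∀ K : ℕ, ∀ᶠ a in l, Set.Ico 0 (K : ℤ) ⊆ B a)
    (hI : ∀ᶠ a in l, (I a).OrdConnected ∧ t₀ ∈ I a ∧ t₁ a ∈ I a ∧ |t₁ a - t₀| ≤ T)
    (hU : ∀ᶠ a in l, IsFlow (A a) (I a) (U a)) (hV : ∀ᶠ a in l, IsFlow (B a) (I a) (V a))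
    (hUR : ∀ᶠ a in l, ∀ t ∈ I a, energy wq (toL2Mat (U a t)) ≤ R)
    (hVR : ∀ᶠ a in l, ∀ t ∈ I a, energy wq (toL2Mat (V a t)) ≤ R)
    (h0 : Tendsto (fun a => toL2Mat (U a t₀) - toL2Mat (V a t₀)) l (𝓝 0)) :
    Tendsto (fun a => toL2Mat (U a (t₁ a)) - toL2Mat (V a (t₁ a))) l (𝓝 0) := by
  rw [tendsto_zero_iff_norm_tendsto_zero, Metric.tendsto_nhds] at h0 ⊢
  intro ε hε
  obtain ⟨δ, hδ, K, hK⟩ := exists_stability M N R T (ε / 2) (half_pos hε)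
  filter_upwards [hA K, hB K, hI, hU, hV, hUR, hVR, h0 δ hδ] with a h1 h2 h3 h4 h5 h6 h7 h8
  rw [Real.dist_eq, sub_zero, abs_of_nonneg (norm_nonneg _)] at h8 ⊢
  have := hK (A a) (B a) (I a) (U a) (V a) h1 h2 h3.1 h4 h5 h6 h7 t₀ h3.2.1 (t₁ a) h3.2.2.1
    h3.2.2.2 h8.le
  linarith

/-- If the energies do not exceed the energy of the limit, then they converge to it. -/
theorem tendsto_energy_of_le {α : Type*} {l : Filter α} {w : ℤ → ℝ≥0}
    {U : α → L2Mat M N} {V : L2Mat M N}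
    (h : ∀ p n, Tendsto (fun a => coeff (U a p) n) l (𝓝 (coeff (V p) n)))
    (hV : energy w V ≠ ⊤) (hU : ∀ᶠ a in l, energy w (U a) ≤ energy w V) :
    Tendsto (fun a => energy w (U a)) l (𝓝 (energy w V)) := by
  refine (ENNReal.tendsto_nhds hV).mpr fun ε hε => ?_
  have hlow : ∀ᶠ a in l, energy w V ≤ energy w (U a) + ε := by
    simp only [energy_eq_tsum] at hV ⊢
    exact weighted_eventually_le_add (ι := (Fin M × Fin N) × ℤ) (c := fun q => w q.2)
      (fun q => h q.1 q.2) hV hε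
  filter_upwards [hU, hlow] with a h1 h2
  exact ⟨tsub_le_iff_right.mpr h2, h1.trans le_self_add⟩

theorem eventually_mem_Ico (m : ℤ) (hm : 0 ≤ m) :
    ∀ᶠ n : ℕ in atTop, m ∈ Set.Ico 0 (n : ℤ) := by
  filter_upwards [eventually_gt_atTop m.toNat] with n hn
  exact ⟨hm, by omega⟩

theorem eventually_Ico_subset (K : ℕ) :
    ∀ᶠ n : ℕ in atTop, Set.Ico 0 (K : ℤ) ⊆ Set.Ico 0 (n : ℤ) := by
  filter_upwards [eventually_ge_atTop K] with n hn
  exact Set.Ico_subset_Ico_right (by exact_mod_cast hn)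

/-- The truncations to the modes `0 ≤ k < n` converge to the projection on the nonnegative modes. -/
theorem tendsto_projMat_Ico (U : L2Mat M N) :
    Tendsto (fun n : ℕ => projMat (Set.Ico 0 (n : ℤ)) U) atTop (𝓝 (projMat (Set.Ici 0) U)) := by
  have h : ∀ n : ℕ, projMat (Set.Ico 0 (n : ℤ)) U =
      projMat (Set.Ico 0 (n : ℤ)) (projMat (Set.Ici 0) U) := by
    intro n
    ext1 p
    refine coeff_ext fun m => ?_
    simp only [projMat_apply]
    by_cases hm : m ∈ Set.Ico 0 (n : ℤ)
    · have hm' : m ∈ Set.Ici (0 : ℤ) := hm.1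
      rw [coeff_modeProj_of_mem hm, coeff_modeProj_of_mem hm, coeff_modeProj_of_mem hm']
    · rw [coeff_modeProj_of_notMem hm, coeff_modeProj_of_notMem hm]
  simp only [h]
  refine tendsto_projMat fun p m hm => eventually_mem_Ico m ?_
  by_contra hneg
  refine hm (coeff_modeProj_of_notMem ?_ _)
  simpa using hneg

theorem projMat_Ici_toL2Mat {s : ℝ} (U : HsPlusMat M N s) :
    projMat (Set.Ici 0) (toL2Mat U) = toL2Mat U :=
  projMat_eq_self fun p n hn => coeff_toL2Mat_of_neg U p (by simpa using hn)

/-- A sequence of Galerkin approximations with data `U₀` at time `t₀`, on growing time intervals. -/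
structure IsGalerkinSeq (U₀ : HsPlusMat M N (1 / 2)) (t₀ : ℝ)
    (u : ℕ → ℝ → HsPlusMat M N (1 / 2)) : Prop where
  isFlow : ∀ n : ℕ, IsFlow (Set.Ico 0 (n : ℤ)) (Set.Ioo (t₀ - (n + 1)) (t₀ + (n + 1))) (u n)
  initial : ∀ n : ℕ, toL2Mat (u n t₀) = projMat (Set.Ico 0 (n : ℤ)) (toL2Mat U₀)
  energy_eq : ∀ n : ℕ, ∀ t ∈ Set.Ioo (t₀ - (n + 1)) (t₀ + (n + 1)),
    energy wq (toL2Mat (u n t)) = energy wq (projMat (Set.Ico 0 (n : ℤ)) (toL2Mat U₀))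

theorem exists_isGalerkinSeq (U₀ : HsPlusMat M N (1 / 2)) (t₀ : ℝ) :
    ∃ u, IsGalerkinSeq U₀ t₀ u := by
  choose u hu using fun n : ℕ =>
    exists_galerkin n (toL2Mat U₀) t₀ (T := n + 1) (by positivity)
  exact ⟨u, fun n => (hu n).1, fun n => (hu n).2.1, fun n => (hu n).2.2⟩

theorem eventually_subset_Ioo (t₀ a b : ℝ) :
    ∀ᶠ n : ℕ in atTop, Set.uIcc a b ⊆ Set.Ioo (t₀ - (n + 1)) (t₀ + (n + 1)) := by
  obtain ⟨m, hm⟩ := exists_nat_gt (|a - t₀| ⊔ |b - t₀|)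
  filter_upwards [eventually_ge_atTop m] with n hn
  have hn' : (m : ℝ) ≤ n := by exact_mod_cast hn
  rw [max_lt_iff] at hm
  have h1 := abs_lt.mp hm.1
  have h2 := abs_lt.mp hm.2
  refine Set.ordConnected_Ioo.uIcc_subset ⟨?_, ?_⟩ ⟨?_, ?_⟩ <;> linarith [h1.1, h1.2, h2.1, h2.2]

theorem energy_wq_eq_coe (U : HsPlusMat M N (1 / 2)) :
    (((energy wq (toL2Mat U)).toNNReal : ℝ≥0) : ℝ≥0∞) = energy wq (toL2Mat U) :=
  ENNReal.coe_toNNReal (energy_wq_ne_top U)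

namespace IsGalerkinSeq

variable {U₀ : HsPlusMat M N (1 / 2)} {t₀ : ℝ} {u : ℕ → ℝ → HsPlusMat M N (1 / 2)}

theorem energy_le (h : IsGalerkinSeq U₀ t₀ u) {n : ℕ} {t : ℝ}
    (ht : t ∈ Set.Ioo (t₀ - (n + 1)) (t₀ + (n + 1))) :
    energy wq (toL2Mat (u n t)) ≤ energy wq (toL2Mat U₀) := by
  rw [h.energy_eq n t ht]
  exact energy_projMat_le _ _ _

theorem tendsto_initial (h : IsGalerkinSeq U₀ t₀ u) :
    Tendsto (fun n => toL2Mat (u n t₀)) atTop (𝓝 (toL2Mat U₀)) := by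
  have := tendsto_projMat_Ico (toL2Mat U₀)
  rw [projMat_Ici_toL2Mat] at this
  simpa only [h.initial] using this

theorem cauchySeq (h : IsGalerkinSeq U₀ t₀ u) (t : ℝ) :
    CauchySeq fun n => toL2Mat (u n t) := by
  rw [cauchySeq_iff_tendsto_dist_atTop_0]
  simp only [dist_eq_norm]
  rw [← tendsto_zero_iff_norm_tendsto_zero]
  have h1 : Tendsto (Prod.fst : ℕ × ℕ → ℕ) atTop atTop := by
    rw [← prod_atTop_atTop_eq]; exact tendsto_fst
  have h2 : Tendsto (Prod.snd : ℕ × ℕ → ℕ) atTop atTop := by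
    rw [← prod_atTop_atTop_eq]; exact tendsto_snd
  have hsub := eventually_subset_Ioo t₀ t₀ t
  refine tendsto_sub_of_isFlow (I := fun _ => Set.uIcc t₀ t) (t₀ := t₀) (t₁ := fun _ => t)
    (A := fun q : ℕ × ℕ => Set.Ico 0 (q.1 : ℤ)) (B := fun q : ℕ × ℕ => Set.Ico 0 (q.2 : ℤ))
    (U := fun q => u q.1) (V := fun q => u q.2)
    (energy wq (toL2Mat U₀)).toNNReal |t - t₀| (fun K => h1.eventually (eventually_Ico_subset K))
    (fun K => h2.eventually (eventually_Ico_subset K))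
    (.of_forall fun _ => ⟨Set.ordConnected_uIcc, Set.left_mem_uIcc, Set.right_mem_uIcc, le_rfl⟩)
    ?_ ?_ ?_ ?_ ?_
  · filter_upwards [h1.eventually hsub] with q hq using (h.isFlow q.1).mono hq
  · filter_upwards [h2.eventually hsub] with q hq using (h.isFlow q.2).mono hq
  · filter_upwards [h1.eventually hsub] with q hq s hs
    rw [energy_wq_eq_coe]
    exact h.energy_le (hq hs)
  · filter_upwards [h2.eventually hsub] with q hq s hs
    rw [energy_wq_eq_coe]
    exact h.energy_le (hq hs)
  · have := (h.tendsto_initial.comp h1).sub (h.tendsto_initial.comp h2)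
    rwa [sub_self] at this

/-- The Galerkin approximations converge in `L²` to functions of no larger energy. -/
theorem exists_tendsto (h : IsGalerkinSeq U₀ t₀ u) (t : ℝ) :
    ∃ U : HsPlusMat M N (1 / 2), Tendsto (fun n => toL2Mat (u n t)) atTop (𝓝 (toL2Mat U)) ∧
      energy wq (toL2Mat U) ≤ energy wq (toL2Mat U₀) := by
  obtain ⟨w, hw⟩ := cauchySeq_tendsto_of_complete (h.cauchySeq t)
  have hE : energy wq w ≤ energy wq (toL2Mat U₀) := by
    refine energy_le_of_tendsto (tendsto_coeff hw) ?_
    filter_upwards [eventually_subset_Ioo t₀ t t] with n hn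
    exact h.energy_le (hn Set.left_mem_uIcc)
  have hneg : ∀ p, ∀ n < 0, coeff (w p) n = 0 := by
    intro p n hn
    refine tendsto_nhds_unique (tendsto_coeff hw p n) ?_
    simp only [coeff_toL2Mat_of_neg _ p hn]
    exact tendsto_const_nhds
  obtain ⟨U, rfl⟩ := exists_toL2Mat_eq hneg (s := 1 / 2) <|
    ne_top_of_le_ne_top (energy_wq_ne_top U₀) ((energy_mono wsob_half_le_wq w).trans hE)
  exact ⟨U, hw, hE⟩

/-- No energy is lost in the limit: the same argument backwards in time bounds the energy of the
data by the energy of the limit. -/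
theorem energy_limit_eq (h : IsGalerkinSeq U₀ t₀ u) {t : ℝ} {U : HsPlusMat M N (1 / 2)}
    (hU : Tendsto (fun n => toL2Mat (u n t)) atTop (𝓝 (toL2Mat U)))
    (hE : energy wq (toL2Mat U) ≤ energy wq (toL2Mat U₀)) :
    energy wq (toL2Mat U) = energy wq (toL2Mat U₀) := by
  refine le_antisymm hE ?_
  obtain ⟨v, hv⟩ := exists_isGalerkinSeq U t
  have hsub := eventually_subset_Ioo t₀ t t₀
  have hsub' := eventually_subset_Ioo t t t₀
  have hlim : Tendsto (fun n => toL2Mat (v n t₀) - toL2Mat (u n t₀)) atTop (𝓝 0) := by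
    refine tendsto_sub_of_isFlow (I := fun _ => Set.uIcc t t₀) (t₀ := t) (t₁ := fun _ => t₀)
      (A := fun n : ℕ => Set.Ico 0 (n : ℤ)) (B := fun n : ℕ => Set.Ico 0 (n : ℤ))
      (energy wq (toL2Mat U₀)).toNNReal |t₀ - t| eventually_Ico_subset eventually_Ico_subset
      (.of_forall fun _ => ⟨Set.ordConnected_uIcc, Set.left_mem_uIcc, Set.right_mem_uIcc, le_rfl⟩)
      ?_ ?_ ?_ ?_ ?_
    · filter_upwards [hsub'] with n hn using (hv.isFlow n).mono hn
    · filter_upwards [hsub] with n hn using (h.isFlow n).mono hn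
    · filter_upwards [hsub'] with n hn s hs
      rw [energy_wq_eq_coe]
      exact (hv.energy_le (hn hs)).trans hE
    · filter_upwards [hsub] with n hn s hs
      rw [energy_wq_eq_coe]
      exact h.energy_le (hn hs)
    · have := hv.tendsto_initial.sub hU
      rwa [sub_self] at this
  have hlim' : Tendsto (fun n => toL2Mat (v n t₀)) atTop (𝓝 (toL2Mat U₀)) := by
    have := hlim.add h.tendsto_initial
    simpa using this
  refine energy_le_of_tendsto (tendsto_coeff hlim') ?_
  filter_upwards [hsub'] with n hn
  exact hv.energy_le (hn Set.right_mem_uIcc)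

/-- Convergence in `H^{1/2}`, not only in `L²`, since the energies converge. -/
theorem tendsto_limit (h : IsGalerkinSeq U₀ t₀ u) {t : ℝ} {U : HsPlusMat M N (1 / 2)}
    (hU : Tendsto (fun n => toL2Mat (u n t)) atTop (𝓝 (toL2Mat U)))
    (hE : energy wq (toL2Mat U) ≤ energy wq (toL2Mat U₀)) :
    Tendsto (fun n => u n t) atTop (𝓝 U) := by
  refine tendsto_of_tendsto_energy (tendsto_coeff hU) ?_
  refine tendsto_energy_of_le (tendsto_coeff hU) (energy_wq_ne_top U) ?_
  filter_upwards [eventually_subset_Ioo t₀ t t] with n hn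
  rw [h.energy_limit_eq hU hE]
  exact h.energy_le (hn Set.left_mem_uIcc)

theorem continuousOn (h : IsGalerkinSeq U₀ t₀ u) (n : ℕ) :
    ContinuousOn (u n) (Set.Ioo (t₀ - (n + 1)) (t₀ + (n + 1))) := by
  have hc : ContinuousOn (fun t => trunc n (1 / 2) (toL2Mat (u n t)))
      (Set.Ioo (t₀ - (n + 1)) (t₀ + (n + 1))) := fun t ht =>
    ((trunc n (1 / 2)).continuous.continuousAt.comp
      ((h.isFlow n).deriv t ht).continuousAt).continuousWithinAt
  refine hc.congr fun t ht => toL2Mat_injective ?_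
  rw [toL2Mat_trunc, projMat_eq_self ((h.isFlow n).modes t ht)]

end IsGalerkinSeq

/-- The right-hand side `-i Π_{≥0}(U U^* U)` of the equation. -/
def szegoField (U : HsPlusMat M N (1 / 2)) : L2Mat M N :=
  -Complex.I • projMat (Set.Ici 0) (cubicL2 U)

theorem continuous_cubicL2 : Continuous (cubicL2 : HsPlusMat M N (1 / 2) → L2Mat M N) :=
  (contDiff_cubicL2 (n := 0)).continuous

theorem continuous_szegoField : Continuous (szegoField : HsPlusMat M N (1 / 2) → L2Mat M N) := by
  unfold szegoField
  exact ((projMat (Set.Ici 0)).continuous.comp continuous_cubicL2).const_smul (-Complex.I)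

theorem norm_neg_I_smul (U : L2Mat M N) : ‖-Complex.I • U‖ = ‖U‖ := by
  rw [norm_smul, norm_neg, Complex.norm_I, one_mul]

/-- The integral form of the equation, by passage to the limit in the Galerkin approximations. -/
theorem IsGalerkinSeq.integral_eq {U₀ : HsPlusMat M N (1 / 2)} {t₀ : ℝ}
    {u : ℕ → ℝ → HsPlusMat M N (1 / 2)} (h : IsGalerkinSeq U₀ t₀ u)
    {U : ℝ → HsPlusMat M N (1 / 2)}
    (hU : ∀ t, Tendsto (fun n => u n t) atTop (𝓝 (U t))) (t : ℝ) :
    toL2Mat (U t) - toL2Mat U₀ = ∫ τ in t₀..t, szegoField (U τ) := by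
  obtain ⟨C, hC, hbound⟩ := exists_norm_cubicL2_le M N (energy wq (toL2Mat U₀)).toNNReal
  have hcont : Continuous (toL2Mat : HsPlusMat M N (1 / 2) → L2Mat M N) :=
    (toL2MatL (by norm_num : (0 : ℝ) ≤ 1 / 2)).continuous
  set G : ℕ → ℝ → L2Mat M N := fun n τ =>
    -Complex.I • projMat (Set.Ico 0 (n : ℤ)) (cubicL2 (u n τ)) with hG
  have hsub := eventually_subset_Ioo t₀ t₀ t
  have hGc : ∀ᶠ n in atTop, ContinuousOn (G n) (Set.uIcc t₀ t) := by
    filter_upwards [hsub] with n hn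
    exact ((projMat _).continuous.comp_continuousOn
      (continuous_cubicL2.comp_continuousOn ((h.continuousOn n).mono hn))).const_smul
        (-Complex.I)
  have hint : ∀ᶠ n in atTop, ∫ τ in t₀..t, G n τ = toL2Mat (u n t) - toL2Mat (u n t₀) := by
    filter_upwards [hsub, hGc] with n hn hc
    exact intervalIntegral.integral_eq_sub_of_hasDerivAt
      (fun τ hτ => (h.isFlow n).deriv τ (hn hτ)) hc.intervalIntegrable
  have hlim : Tendsto (fun n => ∫ τ in t₀..t, G n τ) atTop
      (𝓝 (∫ τ in t₀..t, szegoField (U τ))) := by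
    refine intervalIntegral.tendsto_integral_filter_of_dominated_convergence (fun _ => C) ?_ ?_
      (intervalIntegrable_const) (.of_forall fun τ _ => ?_)
    · filter_upwards [hGc] with n hc
      exact (hc.mono Set.uIoc_subset_uIcc).aestronglyMeasurable measurableSet_uIoc
    · filter_upwards [hsub] with n hn
      refine .of_forall fun τ hτ => ?_
      rw [hG, norm_neg_I_smul]
      refine (norm_projMat_le _ _).trans (hbound _ ?_)
      rw [energy_wq_eq_coe]
      exact h.energy_le (hn (Set.uIoc_subset_uIcc hτ))
    · have h1 : Tendsto (fun n => cubicL2 (u n τ) - cubicL2 (U τ)) atTop (𝓝 0) := by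
        have := ((continuous_cubicL2.tendsto _).comp (hU τ)).sub_const (cubicL2 (U τ))
        rwa [sub_self] at this
      have h2 : Tendsto (fun n : ℕ => projMat (Set.Ico 0 (n : ℤ))
          (cubicL2 (u n τ) - cubicL2 (U τ))) atTop (𝓝 0) :=
        squeeze_zero_norm (fun n => norm_projMat_le _ _)
          (tendsto_zero_iff_norm_tendsto_zero.mp h1)
      have h3 := (h2.add (tendsto_projMat_Ico (cubicL2 (U τ)))).const_smul (-Complex.I)
      simp only [map_sub, sub_add_cancel, zero_add] at h3
      exact h3
  have hlim2 : Tendsto (fun n => toL2Mat (u n t) - toL2Mat (u n t₀)) atTop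
      (𝓝 (toL2Mat (U t) - toL2Mat U₀)) :=
    ((hcont.tendsto _).comp (hU t)).sub h.tendsto_initial
  exact tendsto_nhds_unique (hlim2.congr' (hint.mono fun n hn => hn.symm)) hlim

/-- The equation has a global solution with prescribed value at a given time, and its energy is
conserved. -/
theorem exists_flow (U₀ : HsPlusMat M N (1 / 2)) (t₀ : ℝ) :
    ∃ U : ℝ → HsPlusMat M N (1 / 2), IsFlow (Set.Ici 0) Set.univ U ∧ Continuous U ∧ U t₀ = U₀ ∧
      ∀ t, energy wq (toL2Mat (U t)) = energy wq (toL2Mat U₀) := by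
  obtain ⟨u, hu⟩ := exists_isGalerkinSeq U₀ t₀
  choose U hU hE using hu.exists_tendsto
  have hEq : ∀ t, energy wq (toL2Mat (U t)) = energy wq (toL2Mat U₀) := fun t =>
    hu.energy_limit_eq (hU t) (hE t)
  have hlim : ∀ t, Tendsto (fun n => u n t) atTop (𝓝 (U t)) := fun t =>
    hu.tendsto_limit (hU t) (hE t)
  obtain ⟨C, hC, hbound⟩ := exists_norm_cubicL2_le M N (energy wq (toL2Mat U₀)).toNNReal
  have hLip : ∀ a b, ‖toL2Mat (U b) - toL2Mat (U a)‖ ≤ C * |b - a| := by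
    intro a b
    refine le_of_tendsto ((hU b).sub (hU a)).norm ?_
    filter_upwards [eventually_subset_Ioo t₀ a b] with n hn
    have := (convex_uIcc a b).norm_image_sub_le_of_norm_hasDerivWithin_le
      (f := fun τ => toL2Mat (u n τ)) (C := C)
      (fun τ hτ => ((hu.isFlow n).deriv τ (hn hτ)).hasDerivWithinAt)
      (fun τ hτ => by
        rw [norm_neg_I_smul]
        refine (norm_projMat_le _ _).trans (hbound _ ?_)
        rw [energy_wq_eq_coe]
        exact hu.energy_le (hn hτ)) Set.left_mem_uIcc Set.right_mem_uIcc
    rwa [Real.norm_eq_abs] at this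
  have hcL2 : Continuous fun t => toL2Mat (U t) := by
    refine (LipschitzWith.of_dist_le_mul (K := C.toNNReal) fun a b => ?_).continuous
    rw [dist_eq_norm, Real.dist_eq, Real.coe_toNNReal _ hC]
    exact hLip b a
  have hc : Continuous U := by
    refine continuous_iff_continuousAt.mpr fun t => ?_
    refine tendsto_of_tendsto_energy (tendsto_coeff (hcL2.tendsto t)) ?_
    simp only [hEq]
    exact tendsto_const_nhds
  refine ⟨U, ⟨fun t _ p n hn => coeff_toL2Mat_of_neg (U t) p (by simpa using hn), fun t _ => ?_⟩,
    hc, ?_, hEq⟩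
  · have hF : Continuous fun τ => szegoField (U τ) := continuous_szegoField.comp hc
    have hd := (hF.integral_hasStrictDerivAt t₀ t).hasDerivAt.add_const (toL2Mat U₀)
    refine hd.congr_of_eventuallyEq (.of_forall fun τ => ?_)
    exact (sub_eq_iff_eq_add.mp (hu.integral_eq hlim τ))
  · exact toL2Mat_injective (tendsto_nhds_unique (hU t₀) hu.tendsto_initial)

theorem exists_energy_bound {U : ℝ → HsPlusMat M N (1 / 2)} (hU : Continuous U) (a b : ℝ) :
    ∃ R : ℝ≥0, ∀ t ∈ Set.uIcc a b, energy wq (toL2Mat (U t)) ≤ R := by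
  obtain ⟨t, -, ht⟩ := isCompact_uIcc.exists_isMaxOn Set.nonempty_uIcc
    (continuous_energy_wq.comp hU).continuousOn (s := Set.uIcc a b)
  refine ⟨(energy wq (toL2Mat (U t))).toNNReal, fun s hs => ?_⟩
  rw [energy_wq_eq_coe]
  exact ht hs

/-- The solution is unique among the continuous ones. -/
theorem IsFlow.unique {U V : ℝ → HsPlusMat M N (1 / 2)}
    (hU : IsFlow (Set.Ici 0) Set.univ U) (hV : IsFlow (Set.Ici 0) Set.univ V)
    (hUc : Continuous U) (hVc : Continuous V) {t₀ : ℝ} (h : U t₀ = V t₀) : U = V := by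
  funext t
  obtain ⟨R₁, hR₁⟩ := exists_energy_bound hUc t₀ t
  obtain ⟨R₂, hR₂⟩ := exists_energy_bound hVc t₀ t
  have hsub : ∀ K : ℕ, Set.Ico 0 (K : ℤ) ⊆ Set.Ici 0 := fun K => Set.Ico_subset_Ici_self
  have := tendsto_sub_of_isFlow (l := (atTop : Filter ℕ)) (I := fun _ => Set.uIcc t₀ t) (t₀ := t₀)
    (t₁ := fun _ => t) (A := fun _ => Set.Ici 0) (B := fun _ => Set.Ici 0) (U := fun _ => U)
    (V := fun _ => V) (R₁ ⊔ R₂) |t - t₀| (fun K => .of_forall fun _ => hsub K)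
    (fun K => .of_forall fun _ => hsub K)
    (.of_forall fun _ => ⟨Set.ordConnected_uIcc, Set.left_mem_uIcc, Set.right_mem_uIcc, le_rfl⟩)
    (.of_forall fun _ => hU.mono (Set.subset_univ _))
    (.of_forall fun _ => hV.mono (Set.subset_univ _))
    (.of_forall fun _ s hs => (hR₁ s hs).trans (by exact_mod_cast le_max_left R₁ R₂))
    (.of_forall fun _ s hs => (hR₂ s hs).trans (by exact_mod_cast le_max_right R₁ R₂))
    (by simp [h])
  exact toL2Mat_injective (sub_eq_zero.mp (tendsto_nhds_unique tendsto_const_nhds this))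

/-- The value at time `t` of the solution with data `U₀` at time `0`. -/
def flow (U₀ : HsPlusMat M N (1 / 2)) : ℝ → HsPlusMat M N (1 / 2) := (exists_flow U₀ 0).choose

theorem isFlow_flow (U₀ : HsPlusMat M N (1 / 2)) : IsFlow (Set.Ici 0) Set.univ (flow U₀) :=
  (exists_flow U₀ 0).choose_spec.1

theorem continuous_flow_apply (U₀ : HsPlusMat M N (1 / 2)) : Continuous (flow U₀) :=
  (exists_flow U₀ 0).choose_spec.2.1

theorem flow_zero (U₀ : HsPlusMat M N (1 / 2)) : flow U₀ 0 = U₀ :=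
  (exists_flow U₀ 0).choose_spec.2.2.1

theorem energy_flow (U₀ : HsPlusMat M N (1 / 2)) (t : ℝ) :
    energy wq (toL2Mat (flow U₀ t)) = energy wq (toL2Mat U₀) :=
  (exists_flow U₀ 0).choose_spec.2.2.2 t

/-- By uniqueness, every continuous solution is given by the flow. -/
theorem eq_flow {U : ℝ → HsPlusMat M N (1 / 2)} (hU : IsSolution U) (hc : Continuous U) :
    U = flow (U 0) :=
  (isFlow_of_isSolution hU).unique (isFlow_flow _) hc (continuous_flow_apply _) (flow_zero _).symm

/-- The Galerkin approximations converge to the solution. -/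
theorem IsGalerkinSeq.tendsto_flow {U₀ : HsPlusMat M N (1 / 2)}
    {u : ℕ → ℝ → HsPlusMat M N (1 / 2)} (h : IsGalerkinSeq U₀ 0 u) (t : ℝ) :
    Tendsto (fun n => toL2Mat (u n t)) atTop (𝓝 (toL2Mat (flow U₀ t))) := by
  have hsub := eventually_subset_Ioo 0 0 t
  have : Tendsto (fun n => toL2Mat (u n t) - toL2Mat (flow U₀ t)) atTop (𝓝 0) := by
    refine tendsto_sub_of_isFlow (I := fun _ => Set.uIcc 0 t) (t₀ := 0) (t₁ := fun _ => t)
      (A := fun n : ℕ => Set.Ico 0 (n : ℤ)) (B := fun _ => Set.Ici 0) (V := fun _ => flow U₀)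
      (energy wq (toL2Mat U₀)).toNNReal |t - 0| eventually_Ico_subset
      (fun K => .of_forall fun _ => Set.Ico_subset_Ici_self)
      (.of_forall fun _ => ⟨Set.ordConnected_uIcc, Set.left_mem_uIcc, Set.right_mem_uIcc, le_rfl⟩)
      ?_ (.of_forall fun _ => (isFlow_flow U₀).mono (Set.subset_univ _)) ?_
      (.of_forall fun _ s _ => ?_) ?_
    · filter_upwards [hsub] with n hn using (h.isFlow n).mono hn
    · filter_upwards [hsub] with n hn s hs
      rw [energy_wq_eq_coe]
      exact h.energy_le (hn hs)
    · rw [energy_wq_eq_coe]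
      exact (energy_flow U₀ s).le
    · have := h.tendsto_initial.sub_const (toL2Mat U₀)
      rw [sub_self] at this
      simpa only [flow_zero] using this
  simpa using this.add_const (toL2Mat (flow U₀ t))

/-- The solution depends continuously on the data and on time, jointly. -/
theorem tendsto_flow {α : Type*} {l : Filter α} {U : α → HsPlusMat M N (1 / 2)} {τ : α → ℝ}
    {U₀ : HsPlusMat M N (1 / 2)} {t : ℝ} (hU : Tendsto U l (𝓝 U₀)) (hτ : Tendsto τ l (𝓝 t)) :
    Tendsto (fun a => flow (U a) (τ a)) l (𝓝 (flow U₀ t)) := by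
  have hcont : Continuous (toL2Mat : HsPlusMat M N (1 / 2) → L2Mat M N) :=
    (toL2MatL (by norm_num : (0 : ℝ) ≤ 1 / 2)).continuous
  have hen : Tendsto (fun a => energy wq (toL2Mat (U a))) l (𝓝 (energy wq (toL2Mat U₀))) :=
    (continuous_energy_wq.tendsto U₀).comp hU
  set R : ℝ≥0 := (energy wq (toL2Mat U₀)).toNNReal + 1 with hR
  have hRE : energy wq (toL2Mat U₀) < R := by
    rw [hR, ENNReal.coe_add, energy_wq_eq_coe]
    exact ENNReal.lt_add_right (energy_wq_ne_top U₀) (by simp)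
  have hI : ∀ᶠ a in l, (Set.univ : Set ℝ).OrdConnected ∧ 0 ∈ (Set.univ : Set ℝ) ∧
      τ a ∈ (Set.univ : Set ℝ) ∧ |τ a - 0| ≤ |t| + 1 := by
    filter_upwards [hτ.abs.eventually_lt_const (lt_add_one |t|)] with a ha
    exact ⟨Set.ordConnected_univ, trivial, trivial, by simpa using ha.le⟩
  have hUR : ∀ᶠ a in l, ∀ s ∈ (Set.univ : Set ℝ), energy wq (toL2Mat (flow (U a) s)) ≤ R := by
    filter_upwards [hen.eventually_lt_const hRE] with a ha s _
    exact (energy_flow (U a) s).trans_le ha.le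
  have hVR : ∀ᶠ _ in l, ∀ s ∈ (Set.univ : Set ℝ), energy wq (toL2Mat (flow U₀ s)) ≤ R :=
    .of_forall fun _ s _ => (energy_flow U₀ s).trans_le hRE.le
  have h0 : Tendsto (fun a => toL2Mat (flow (U a) 0) - toL2Mat (flow U₀ 0)) l (𝓝 0) := by
    simp only [flow_zero]
    have := ((hcont.tendsto U₀).comp hU).sub_const (toL2Mat U₀)
    rwa [sub_self] at this
  have hd := tendsto_sub_of_isFlow (l := l) (I := fun _ => Set.univ) (t₀ := 0) (t₁ := τ)
    (A := fun _ => Set.Ici 0) (B := fun _ => Set.Ici 0) (U := fun a => flow (U a))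
    (V := fun _ => flow U₀) R (|t| + 1)
    (fun K => .of_forall fun _ => Set.Ico_subset_Ici_self)
    (fun K => .of_forall fun _ => Set.Ico_subset_Ici_self) hI
    (.of_forall fun a => isFlow_flow (U a)) (.of_forall fun _ => isFlow_flow U₀) hUR hVR h0
  have hL2 := hd.add (((hcont.comp (continuous_flow_apply U₀)).tendsto t).comp hτ)
  simp only [Function.comp_apply, sub_add_cancel, zero_add] at hL2
  refine tendsto_of_tendsto_energy (tendsto_coeff hL2) ?_
  simp only [energy_flow]
  exact hen

theorem continuous_flow :
    Continuous fun q : HsPlusMat M N (1 / 2) × ℝ => flow q.1 q.2 :=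
  continuous_iff_continuousAt.mpr fun q =>
    tendsto_flow (continuous_fst.tendsto q) (continuous_snd.tendsto q)

theorem existsUnique_solution (U₀ : HsPlusMat M N (1 / 2)) :
    ∃! U : C(ℝ, HsPlusMat M N (1 / 2)), IsSolution U ∧ U 0 = U₀ := by
  refine ⟨⟨flow U₀, continuous_flow_apply U₀⟩,
    ⟨isSolution_of_isFlow (isFlow_flow U₀), flow_zero U₀⟩, ?_⟩
  rintro V ⟨hV, rfl⟩
  exact ContinuousMap.ext fun t => congrFun (eq_flow hV V.continuous) t

/-- Joint continuity of the flow, curried, is continuity for the topology of uniform convergence on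
`[-T, T]`, which is the compact-open topology. -/
theorem exists_continuous_flowMap (M N : ℕ) (T : ℝ) :
    ∃ Φ : HsPlusMat M N (1 / 2) → C(Set.Icc (-T) T, HsPlusMat M N (1 / 2)),
      Continuous Φ ∧ ∀ U : C(ℝ, HsPlusMat M N (1 / 2)), IsSolution U →
        Φ (U 0) = U.restrict (Set.Icc (-T) T) := by
  let F : C(HsPlusMat M N (1 / 2) × Set.Icc (-T) T, HsPlusMat M N (1 / 2)) :=
    ⟨fun q => flow q.1 q.2, continuous_flow.comp
      (continuous_fst.prodMk (continuous_subtype_val.comp continuous_snd))⟩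
  refine ⟨F.curry, F.curry.continuous, fun U hU => ContinuousMap.ext fun t => ?_⟩
  exact (congrFun (eq_flow hU U.continuous) t).symm

/-! ### The Wiener norm and products in `H^s` for `s > 1/2` -/

/-- The Wiener norm `∑ |f̂(n)|`, possibly infinite. -/
def wien (f : L2) : ℝ≥0∞ := ∑' n, absCoeff f n

theorem ENNReal_add_sq_le (x y : ℝ≥0∞) : (x + y) ^ 2 ≤ 2 * (x ^ 2 + y ^ 2) := by
  rcases eq_or_ne x ⊤ with rfl | hx
  · simp
  rcases eq_or_ne y ⊤ with rfl | hy
  · simp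
  lift x to ℝ≥0 using hx
  lift y to ℝ≥0 using hy
  have h : (x + y) ^ 2 ≤ 2 * (x ^ 2 + y ^ 2) := add_sq_le
  exact_mod_cast h

/-- Young's inequality `ℓ² * ℓ¹ ⊆ ℓ²`. -/
theorem tsum_conv_sq_le (x y : ℤ → ℝ≥0∞) :
    ∑' n, conv x y n ^ 2 ≤ (∑' n, x n ^ 2) * (∑' n, y n) ^ 2 := by
  have hsqrt : ∀ a : ℝ≥0∞, (a ^ (1 / 2 : ℝ)) ^ 2 = a := fun a => by
    rw [← ENNReal.rpow_natCast, ← ENNReal.rpow_mul]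
    norm_num
  have h : ∀ n, conv x y n ^ 2 ≤ conv (fun k => x k ^ 2) y n * ∑' k, y k := by
    intro n
    have e : conv x y n =
        ∑' k, (x k * y (n - k) ^ (1 / 2 : ℝ)) * y (n - k) ^ (1 / 2 : ℝ) := by
      refine tsum_congr fun k => ?_
      rw [mul_assoc, ← sq, hsqrt]
    rw [e]
    refine (ENNReal_tsum_mul_sq_le _ _).trans (le_of_eq ?_)
    simp only [mul_pow, hsqrt, tsum_sub_left y n]
    rfl
  refine (ENNReal.tsum_le_tsum h).trans (le_of_eq ?_)
  rw [ENNReal.tsum_mul_right, tsum_conv, sq, mul_assoc]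

/-- The Wiener algebra property. -/
theorem wien_mul_le {f g h : L2} (e : h =ᵐ[AddCircle.haarAddCircle] fun x => f x * g x) :
    wien h ≤ wien f * wien g :=
  (ENNReal.tsum_le_tsum (absCoeff_le_conv e)).trans (le_of_eq (tsum_conv _ _))

/-- Peetre's inequality in additive form. -/
theorem wsob_add_le {s : ℝ} (hs : 0 ≤ s) (k l : ℤ) :
    wsob s (k + l) ≤ 4 ^ s * (wsob s k + wsob s l) := by
  have h1 : (1 : ℝ≥0) + ((k + l).natAbs : ℝ≥0) ^ 2 ≤
      4 * max (1 + (k.natAbs : ℝ≥0) ^ 2) (1 + (l.natAbs : ℝ≥0) ^ 2) := by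
    have hadd : ((k + l).natAbs : ℝ≥0) ≤ k.natAbs + l.natAbs := by
      exact_mod_cast Int.natAbs_add_le k l
    have hsq : ((k + l).natAbs : ℝ≥0) ^ 2 ≤ 2 * ((k.natAbs : ℝ≥0) ^ 2 + (l.natAbs : ℝ≥0) ^ 2) :=
      (pow_le_pow_left' hadd 2).trans add_sq_le
    calc (1 : ℝ≥0) + ((k + l).natAbs : ℝ≥0) ^ 2
        ≤ 4 + 2 * ((k.natAbs : ℝ≥0) ^ 2 + (l.natAbs : ℝ≥0) ^ 2) :=
          add_le_add (by norm_num) hsq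
      _ = 2 * (1 + (k.natAbs : ℝ≥0) ^ 2) + 2 * (1 + (l.natAbs : ℝ≥0) ^ 2) := by ring
      _ ≤ 2 * max (1 + (k.natAbs : ℝ≥0) ^ 2) (1 + (l.natAbs : ℝ≥0) ^ 2) +
          2 * max (1 + (k.natAbs : ℝ≥0) ^ 2) (1 + (l.natAbs : ℝ≥0) ^ 2) := by
          gcongr
          · exact le_max_left _ _
          · exact le_max_right _ _
      _ = _ := by ring
  rw [wsob]
  refine (NNReal.rpow_le_rpow h1 hs).trans ?_
  rw [NNReal.mul_rpow]
  gcongr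
  rcases max_cases (1 + (k.natAbs : ℝ≥0) ^ 2) (1 + (l.natAbs : ℝ≥0) ^ 2) with h | h
  · rw [h.1]; exact le_self_add
  · rw [h.1]; exact le_add_self

theorem wsob_half_mul_sq (s : ℝ) (n : ℤ) : wsob (s / 2) n ^ 2 = wsob s n := by
  rw [wsob, wsob, ← NNReal.rpow_natCast, ← NNReal.rpow_mul]
  norm_num

/-- The constant of the product estimate in `H^s`. -/
def mulConst (s : ℝ) : ℝ≥0 := 2 * (4 ^ (s / 2)) ^ 2

/-- The tame product estimate in `H^s`. -/
theorem wsum_mul_le {s : ℝ} (hs : 0 ≤ s) {f g h : L2}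
    (e : h =ᵐ[AddCircle.haarAddCircle] fun x => f x * g x) :
    wsum (wsob s) h ≤
      mulConst s * (wsum (wsob s) f * wien g ^ 2 + wsum (wsob s) g * wien f ^ 2) := by
  set c : ℝ≥0 := 4 ^ (s / 2) with hc
  set v : ℤ → ℝ≥0∞ := fun n => (wsob (s / 2) n : ℝ≥0∞) with hv
  have hv2 : ∀ n, v n ^ 2 = wsob s n := fun n => by
    rw [hv, ← ENNReal.coe_pow, wsob_half_mul_sq]
  have hw : ∀ f : L2, wsum (wsob s) f = ∑' n, (v n * absCoeff f n) ^ 2 := fun f => by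
    simp only [mul_pow, hv2]
    rfl
  have hpt : ∀ n, v n * absCoeff h n ≤
      c * (conv (fun k => v k * absCoeff f k) (absCoeff g) n +
        conv (fun k => v k * absCoeff g k) (absCoeff f) n) := by
    intro n
    rw [conv_comm (fun k => v k * absCoeff g k)]
    refine (mul_le_mul' le_rfl (absCoeff_le_conv e n)).trans ?_
    simp only [conv]
    rw [← ENNReal.tsum_add, ← ENNReal.tsum_mul_left, ← ENNReal.tsum_mul_left]
    refine ENNReal.tsum_le_tsum fun k => ?_
    have : v n ≤ c * (v k + v (n - k)) := by
      have := wsob_add_le (by positivity : 0 ≤ s / 2) k (n - k)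
      rw [add_sub_cancel] at this
      simp only [hv, hc]
      exact_mod_cast this
    refine (mul_le_mul' this le_rfl).trans (le_of_eq ?_)
    ring
  rw [hw h]
  calc ∑' n, (v n * absCoeff h n) ^ 2
      ≤ ∑' n, mulConst s * (conv (fun k => v k * absCoeff f k) (absCoeff g) n ^ 2 +
          conv (fun k => v k * absCoeff g k) (absCoeff f) n ^ 2) := by
        refine ENNReal.tsum_le_tsum fun n => ?_
        refine (pow_le_pow_left' (hpt n) 2).trans ?_
        rw [mul_pow]
        refine (mul_le_mul' le_rfl (ENNReal_add_sq_le _ _)).trans (le_of_eq ?_)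
        rw [mulConst]
        push_cast
        ring
    _ ≤ _ := by
        rw [ENNReal.tsum_mul_left, ENNReal.tsum_add, hw, hw]
        gcongr <;> exact tsum_conv_sq_le _ _

theorem summable_inv_wsob {s : ℝ} (hs : 1 / 2 < s) : Summable fun n : ℤ => (wsob s n)⁻¹ := by
  rw [← NNReal.summable_coe]
  refine Summable.of_norm_bounded_eventually
    (Real.summable_abs_int_rpow (b := 2 * s) (by linarith)) ?_
  rw [eventually_cofinite]
  refine (Set.finite_singleton (0 : ℤ)).subset fun n hn => ?_
  by_contra h0
  refine hn ?_
  have hn0 : (0 : ℝ) < |(n : ℝ)| := by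
    simp only [abs_pos, ne_eq, Int.cast_eq_zero]
    exact h0
  rw [NNReal.coe_inv, coe_wsob, Real.norm_of_nonneg (by positivity), Real.rpow_neg hn0.le,
    Real.rpow_mul hn0.le, Real.rpow_two]
  have hsq : 0 < |(n : ℝ)| ^ 2 := by positivity
  rw [sq_abs] at hsq ⊢
  gcongr
  · exact le_add_of_nonneg_left zero_le_one

/-- The constant of the embedding of `H^s` into the Wiener algebra. -/
def wienConst (s : ℝ) : ℝ≥0 := ∑' n : ℤ, (wsob s n)⁻¹

theorem wsob_ne_zero (s : ℝ) (n : ℤ) : wsob s n ≠ 0 := by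
  rw [wsob]
  exact (NNReal.rpow_pos (by positivity)).ne'

theorem tsum_inv_wsob {s : ℝ} (hs : 1 / 2 < s) :
    ∑' n : ℤ, ((wsob s n : ℝ≥0∞))⁻¹ = wienConst s := by
  rw [wienConst, ENNReal.coe_tsum (summable_inv_wsob hs)]
  exact tsum_congr fun n => (ENNReal.coe_inv (wsob_ne_zero s n)).symm

/-- The embedding of `H^s` into the Wiener algebra. -/
theorem wien_sq_le {s : ℝ} (hs : 1 / 2 < s) (f : L2) :
    wien f ^ 2 ≤ wienConst s * wsum (wsob s) f := by
  have h := tsum_absCoeff_sq_le (wsob_ne_zero s) Set.univ f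
  rwa [tsum_univ, tsum_univ fun n => ((wsob s n : ℝ≥0∞))⁻¹, tsum_inv_wsob hs] at h

theorem wsob_mono {s s' : ℝ} (h : s ≤ s') (n : ℤ) : wsob s n ≤ wsob s' n :=
  NNReal.rpow_le_rpow_of_exponent_le (by simp) h

variable {s : ℝ}

theorem wsum_wq_ne_top_of_half_le (hs : 1 / 2 ≤ s) (f : Hs s) : wsum wq f.toL2 ≠ ⊤ := by
  have h : wsum wq f.toL2 ≤ wsum (fun n => 2 * wsob s n) f.toL2 :=
    wsum_mono fun n _ => (wq_le_wsob_half n).trans (by gcongr; exact wsob_mono hs n)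
  refine ne_top_of_le_ne_top ?_ h
  rw [wsum_const_mul, ← Hs.enorm_sq_eq]
  exact ENNReal.mul_ne_top ENNReal.coe_ne_top (ENNReal.pow_ne_top enorm_ne_top)

theorem memLp_mul {f g : L2} (hf : wsum wq f ≠ ⊤) (hg : wsum wq g ≠ ⊤) :
    MemLp (fun x => f x * g x) 2 (AddCircle.haarAddCircle : Measure Torus) := by
  have h : MemLp (fun x => f x * g x) 3 (AddCircle.haarAddCircle : Measure Torus) :=
    MemLp.mul (p := 6) (q := 6) (memLp_six hg) (memLp_six hf)
  exact h.mono_exponent (by norm_num)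

/-- The product of two elements of `H^s`, in `L²`. -/
def mulL2 (hs : 1 / 2 < s) (f g : Hs s) : L2 :=
  (memLp_mul (wsum_wq_ne_top_of_half_le hs.le f) (wsum_wq_ne_top_of_half_le hs.le g)).toLp

theorem coeFn_mulL2 (hs : 1 / 2 < s) (f g : Hs s) :
    mulL2 hs f g =ᵐ[AddCircle.haarAddCircle] fun x => f.toL2 x * g.toL2 x :=
  MemLp.coeFn_toLp _

theorem wsum_mulL2_le (hs : 1 / 2 < s) (f g : Hs s) : wsum (wsob s) (mulL2 hs f g) ≤
    mulConst s * (‖f‖ₑ ^ 2 * wien g.toL2 ^ 2 + ‖g‖ₑ ^ 2 * wien f.toL2 ^ 2) := by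
  rw [Hs.enorm_sq_eq, Hs.enorm_sq_eq]
  exact wsum_mul_le (by linarith) (coeFn_mulL2 hs f g)

/-- The algebra property of `H^s`. -/
theorem wsum_mulL2_le' (hs : 1 / 2 < s) (f g : Hs s) : wsum (wsob s) (mulL2 hs f g) ≤
    (2 * mulConst s * wienConst s : ℝ≥0) * (‖f‖ₑ ^ 2 * ‖g‖ₑ ^ 2) := by
  refine (wsum_mulL2_le hs f g).trans ?_
  have hf := wien_sq_le hs f.toL2
  have hg := wien_sq_le hs g.toL2
  rw [← Hs.enorm_sq_eq] at hf hg
  calc _ ≤ (mulConst s : ℝ≥0∞) * (‖f‖ₑ ^ 2 * (wienConst s * ‖g‖ₑ ^ 2) +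
        ‖g‖ₑ ^ 2 * (wienConst s * ‖f‖ₑ ^ 2)) := by gcongr
    _ = _ := by push_cast; ring

theorem mulL2_mem (hs : 1 / 2 < s) (f g : Hs s) : mulL2 hs f g ∈ sobolev s := by
  rw [← wsum_ne_top_iff]
  refine ne_top_of_le_ne_top ?_ (wsum_mulL2_le' hs f g)
  exact ENNReal.mul_ne_top ENNReal.coe_ne_top (ENNReal.mul_ne_top
    (ENNReal.pow_ne_top enorm_ne_top) (ENNReal.pow_ne_top enorm_ne_top))

/-- The element of `H^s` given by an element of `L²`. -/
def Hs.ofL2 (f : L2) (hf : f ∈ sobolev s) : Hs s := ⟨f, hf⟩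

theorem Hs.toL2_ofL2 (f : L2) (hf : f ∈ sobolev s) : (Hs.ofL2 f hf).toL2 = f := rfl

theorem Hs.toL2_injective : Function.Injective (Hs.toL2 : Hs s → L2) := Subtype.val_injective

theorem norm_le_of_enorm_sq_le {E : Type*} [SeminormedAddCommGroup E] {x : E} {c y : ℝ≥0}
    (h : ‖x‖ₑ ^ 2 ≤ c * (y : ℝ≥0∞) ^ 2) : ‖x‖ ≤ Real.sqrt c * y := by
  rw [enorm_eq_nnnorm] at h
  have h' : ‖x‖ ^ 2 ≤ c * (y : ℝ) ^ 2 := by exact_mod_cast h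
  rw [← Real.sqrt_sq y.coe_nonneg, ← Real.sqrt_mul c.coe_nonneg]
  exact Real.le_sqrt_of_sq_le h'

/-- For `s > 1/2` the product is a continuous bilinear map on `H^s`. -/
def mulHs (hs : 1 / 2 < s) : Hs s →L[ℂ] Hs s →L[ℂ] Hs s :=
  LinearMap.mkContinuous₂
    (LinearMap.mk₂ ℂ (fun f g => Hs.ofL2 (mulL2 hs f g) (mulL2_mem hs f g))
      (fun f f' g => Hs.toL2_injective <| Lp.ext <| by
        rw [map_add, Hs.toL2_ofL2, Hs.toL2_ofL2, Hs.toL2_ofL2]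
        filter_upwards [coeFn_mulL2 hs (f + f') g, coeFn_mulL2 hs f g, coeFn_mulL2 hs f' g,
          Lp.coeFn_add (mulL2 hs f g) (mulL2 hs f' g), Lp.coeFn_add f.toL2 f'.toL2]
          with x h1 h2 h3 h4 h5
        rw [h1, h4, map_add, h5, Pi.add_apply, Pi.add_apply, h2, h3, add_mul])
      (fun c f g => Hs.toL2_injective <| Lp.ext <| by
        rw [map_smul, Hs.toL2_ofL2, Hs.toL2_ofL2]
        filter_upwards [coeFn_mulL2 hs (c • f) g, coeFn_mulL2 hs f g,
          Lp.coeFn_smul c (mulL2 hs f g), Lp.coeFn_smul c f.toL2] with x h1 h2 h3 h4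
        rw [h1, h3, map_smul, h4, Pi.smul_apply, Pi.smul_apply, h2, smul_mul_assoc])
      (fun f g g' => Hs.toL2_injective <| Lp.ext <| by
        rw [map_add, Hs.toL2_ofL2, Hs.toL2_ofL2, Hs.toL2_ofL2]
        filter_upwards [coeFn_mulL2 hs f (g + g'), coeFn_mulL2 hs f g, coeFn_mulL2 hs f g',
          Lp.coeFn_add (mulL2 hs f g) (mulL2 hs f g'), Lp.coeFn_add g.toL2 g'.toL2]
          with x h1 h2 h3 h4 h5
        rw [h1, h4, map_add, h5, Pi.add_apply, Pi.add_apply, h2, h3, mul_add])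
      (fun c f g => Hs.toL2_injective <| Lp.ext <| by
        rw [map_smul, Hs.toL2_ofL2, Hs.toL2_ofL2]
        filter_upwards [coeFn_mulL2 hs f (c • g), coeFn_mulL2 hs f g,
          Lp.coeFn_smul c (mulL2 hs f g), Lp.coeFn_smul c g.toL2] with x h1 h2 h3 h4
        rw [h1, h3, map_smul, h4, Pi.smul_apply, Pi.smul_apply, h2, mul_smul_comm]))
    (Real.sqrt (2 * mulConst s * wienConst s : ℝ≥0)) fun f g => by
      have h := wsum_mulL2_le' hs f g
      rw [← Hs.toL2_ofL2 (mulL2 hs f g) (mulL2_mem hs f g), ← Hs.enorm_sq_eq, ← mul_pow,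
        enorm_eq_nnnorm, enorm_eq_nnnorm, enorm_eq_nnnorm, ← ENNReal.coe_mul,
        ← enorm_eq_nnnorm] at h
      have := norm_le_of_enorm_sq_le h
      rw [mul_assoc]
      exact_mod_cast this

theorem toL2_mulHs (hs : 1 / 2 < s) (f g : Hs s) : (mulHs hs f g).toL2 = mulL2 hs f g := rfl

theorem enorm_mulHs_sq_le (hs : 1 / 2 < s) (f g : Hs s) : ‖mulHs hs f g‖ₑ ^ 2 ≤
    mulConst s * (‖f‖ₑ ^ 2 * wien g.toL2 ^ 2 + ‖g‖ₑ ^ 2 * wien f.toL2 ^ 2) := by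
  rw [Hs.enorm_sq_eq (mulHs hs f g), toL2_mulHs]
  exact wsum_mulL2_le hs f g

theorem wien_mulHs_le (hs : 1 / 2 < s) (f g : Hs s) :
    wien (mulHs hs f g).toL2 ≤ wien f.toL2 * wien g.toL2 := by
  rw [toL2_mulHs]
  exact wien_mul_le (coeFn_mulL2 hs f g)

theorem wsum_conjLp (f : L2) : wsum (wsob s) (conjLp 2 f) = wsum (wsob s) f := by
  rw [wsum, wsum, ← (Equiv.neg ℤ).tsum_eq]
  refine tsum_congr fun n => ?_
  rw [Equiv.neg_apply, coeff_conjLp, neg_neg, enorm_eq_nnnorm, nnnorm_star, ← enorm_eq_nnnorm,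
    wsob, wsob, Int.natAbs_neg]

theorem wien_conjLp (f : L2) : wien (conjLp 2 f) = wien f := by
  rw [wien, wien, ← (Equiv.neg ℤ).tsum_eq]
  refine tsum_congr fun n => ?_
  rw [Equiv.neg_apply, absCoeff, coeff_conjLp, neg_neg, enorm_eq_nnnorm, nnnorm_star,
    ← enorm_eq_nnnorm, absCoeff]

theorem conjLp_mem {f : L2} (hf : f ∈ sobolev s) : conjLp 2 f ∈ sobolev s := by
  rw [← wsum_ne_top_iff, wsum_conjLp, wsum_ne_top_iff]
  exact hf

theorem Hs.toL2_real_smul (r : ℝ) (f : Hs s) : (r • f).toL2 = r • f.toL2 := by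
  rw [← Complex.coe_smul r f, map_smul, Complex.coe_smul]
  rfl

/-- Complex conjugation on `H^s`, as a real-linear continuous map. -/
def conjHs (s : ℝ) : Hs s →L[ℝ] Hs s :=
  LinearMap.mkContinuous
    { toFun := fun f => Hs.ofL2 (conjLp 2 f.toL2) (conjLp_mem f.2)
      map_add' := fun f g => Hs.toL2_injective <| by
        change conjLp 2 (Hs.toL2 (f + g)) = conjLp 2 f.toL2 + conjLp 2 g.toL2
        rw [map_add, map_add]
      map_smul' := fun r f => Hs.toL2_injective <| by
        change conjLp 2 (Hs.toL2 (r • f)) =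
          Hs.toL2 (r • Hs.ofL2 (conjLp 2 f.toL2) (conjLp_mem f.2))
        rw [Hs.toL2_real_smul, Hs.toL2_real_smul, Hs.toL2_ofL2, map_smul] } 1 fun f => by
    have h := wsum_conjLp (s := s) f.toL2
    rw [← Hs.toL2_ofL2 (conjLp 2 f.toL2) (conjLp_mem f.2), ← Hs.enorm_sq_eq,
      ← Hs.enorm_sq_eq f] at h
    rw [one_mul, ← enorm_le_iff_norm_le, ← ENNReal.pow_le_pow_left_iff two_ne_zero]
    exact h.le

theorem toL2_conjHs (f : Hs s) : (conjHs s f).toL2 = conjLp 2 f.toL2 := rfl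

theorem enorm_conjHs_sq (f : Hs s) : ‖conjHs s f‖ₑ ^ 2 = ‖f‖ₑ ^ 2 := by
  rw [Hs.enorm_sq_eq (conjHs s f), toL2_conjHs, wsum_conjLp, Hs.enorm_sq_eq]

theorem modeProj_mem (A : Set ℤ) {f : L2} (hf : f ∈ sobolev s) : modeProj A f ∈ sobolev s := by
  rw [← wsum_ne_top_iff] at hf ⊢
  exact ne_top_of_le_ne_top hf (wsum_modeProj_le A _ f)

/-- The Szegő projector `H^s → H^s_+`. -/
def projHs (s : ℝ) : Hs s →L[ℂ] HsPlus s :=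
  LinearMap.mkContinuous
    { toFun := fun f => (⟨Hs.ofL2 (modeProj (Set.Ici 0) f.toL2) (modeProj_mem _ f.2),
        fun n hn => coeff_modeProj_of_notMem (by simpa using hn) _⟩ : HsPlus s)
      map_add' := fun f g => Subtype.ext <| Hs.toL2_injective <| by
        change modeProj _ (Hs.toL2 (f + g)) = modeProj _ f.toL2 + modeProj _ g.toL2
        rw [map_add, map_add]
      map_smul' := fun c f => Subtype.ext <| Hs.toL2_injective <| by
        change modeProj _ (Hs.toL2 (c • f)) = c • modeProj _ f.toL2
        rw [map_smul, map_smul] } 1 fun f => by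
    have h := wsum_modeProj_le (Set.Ici 0) (wsob s) f.toL2
    rw [← Hs.toL2_ofL2 (modeProj (Set.Ici 0) f.toL2) (modeProj_mem _ f.2), ← Hs.enorm_sq_eq,
      ← Hs.enorm_sq_eq f] at h
    rw [one_mul, ← enorm_le_iff_norm_le, ← ENNReal.pow_le_pow_left_iff two_ne_zero]
    exact h

theorem toL2_projHs (f : Hs s) :
    Hs.toL2 (projHs s f : Hs s) = modeProj (Set.Ici 0) f.toL2 := rfl

theorem norm_projHs_le (f : Hs s) : ‖projHs s f‖ ≤ ‖f‖ := by
  have h := wsum_modeProj_le (Set.Ici 0) (wsob s) f.toL2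
  rw [← toL2_projHs, ← Hs.enorm_sq_eq, ← Hs.enorm_sq_eq f,
    ENNReal.pow_le_pow_left_iff two_ne_zero, enorm_le_iff_norm_le] at h
  exact h

/-! ### The nonlinearity in `H^s` for `s > 1/2` -/

/-- The expression `f ḡ h` in `H^s`. -/
def triHs (hs : 1 / 2 < s) (f g h : Hs s) : Hs s := mulHs hs (mulHs hs f (conjHs s g)) h

theorem coeFn_triHs (hs : 1 / 2 < s) (f g h : Hs s) :
    (triHs hs f g h).toL2 =ᵐ[AddCircle.haarAddCircle]
      fun x => f.toL2 x * star (g.toL2 x) * h.toL2 x := by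
  rw [triHs, toL2_mulHs]
  filter_upwards [coeFn_mulL2 hs (mulHs hs f (conjHs s g)) h, coeFn_mulL2 hs f (conjHs s g),
    coeFn_conjLp g.toL2] with x h1 h2 h3
  rw [h1, toL2_mulHs, h2, toL2_conjHs, h3]

theorem contDiff_triHs (hs : 1 / 2 < s) {E : Type*} [NormedAddCommGroup E] [NormedSpace ℝ E]
    {n : WithTop ℕ∞} {f g h : E → Hs s} (hf : ContDiff ℝ n f) (hg : ContDiff ℝ n g)
    (hh : ContDiff ℝ n h) : ContDiff ℝ n fun x => triHs hs (f x) (g x) (h x) := by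
  have hc : ContDiff ℝ n fun x => conjHs s (g x) := (conjHs s).contDiff.comp hg
  have h1 := (((mulHs hs).bilinearRestrictScalars ℝ).contDiff.comp hf).clm_apply hc
  exact (((mulHs hs).bilinearRestrictScalars ℝ).contDiff.comp h1).clm_apply hh

theorem enorm_triHs_sq_le (hs : 1 / 2 < s) {f g h : Hs s} {y W : ℝ≥0∞}
    (hf : ‖f‖ₑ ≤ y) (hg : ‖g‖ₑ ≤ y) (hh : ‖h‖ₑ ≤ y)
    (wf : wien f.toL2 ≤ W) (wg : wien g.toL2 ≤ W) (wh : wien h.toL2 ≤ W) :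
    ‖triHs hs f g h‖ₑ ^ 2 ≤
      (mulConst s * (2 * mulConst s + 1) : ℝ≥0) * (W ^ 2 * y) ^ 2 := by
  have wg' : wien (conjHs s g).toL2 ≤ W := by rwa [toL2_conjHs, wien_conjLp]
  have hg' : ‖conjHs s g‖ₑ ^ 2 ≤ y ^ 2 := by
    rw [enorm_conjHs_sq]
    gcongr
  have h1 : ‖mulHs hs f (conjHs s g)‖ₑ ^ 2 ≤ mulConst s * (y ^ 2 * W ^ 2 + y ^ 2 * W ^ 2) :=
    (enorm_mulHs_sq_le hs f (conjHs s g)).trans (by gcongr)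
  have h2 : wien (mulHs hs f (conjHs s g)).toL2 ≤ W * W :=
    (wien_mulHs_le hs _ _).trans (by gcongr)
  refine (enorm_mulHs_sq_le hs _ h).trans ?_
  calc _ ≤ (mulConst s : ℝ≥0∞) * (mulConst s * (y ^ 2 * W ^ 2 + y ^ 2 * W ^ 2) * W ^ 2 +
        y ^ 2 * (W * W) ^ 2) := by gcongr
    _ = _ := by push_cast; ring

/-- The trilinear expressions on `H^{1/2}` and on `H^s` agree. -/
theorem tri_eq_toL2_triHs (hs : 1 / 2 < s) {f g h : Hs (1 / 2)} {f' g' h' : Hs s}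
    (hf : f.toL2 = f'.toL2) (hg : g.toL2 = g'.toL2) (hh : h.toL2 = h'.toL2) :
    tri f g h = (triHs hs f' g' h').toL2 := by
  refine Lp.ext ((coeFn_tri f g h).trans ?_)
  rw [hf, hg, hh]
  exact (coeFn_triHs hs f' g' h').symm

/-- The vector field of the equation on `H^s_+`. -/
def szegoFieldHs (hs : 1 / 2 < s) (V : HsPlusMat M N s) : HsPlusMat M N s :=
  WithLp.toLp 2 fun p => -Complex.I • projHs s (∑ b, ∑ a,
    triHs hs (V (p.1, a) : Hs s) (V (b, a) : Hs s) (V (b, p.2) : Hs s))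

theorem szegoFieldHs_apply (hs : 1 / 2 < s) (V : HsPlusMat M N s) (p : Fin M × Fin N) :
    szegoFieldHs hs V p = -Complex.I • projHs s (∑ b, ∑ a,
      triHs hs (V (p.1, a) : Hs s) (V (b, a) : Hs s) (V (b, p.2) : Hs s)) := rfl

/-- The vector fields on `H^{1/2}` and on `H^s` agree. -/
theorem toL2Mat_szegoFieldHs (hs : 1 / 2 < s) {U : HsPlusMat M N (1 / 2)} {V : HsPlusMat M N s}
    (h : toL2Mat U = toL2Mat V) : toL2Mat (szegoFieldHs hs V) = szegoField U := by
  have he : ∀ q, Hs.toL2 (U q : Hs (1 / 2)) = Hs.toL2 (V q : Hs s) := fun q =>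
    congrFun (congrArg WithLp.ofLp h) q
  ext1 p
  rw [toL2Mat_apply, szegoFieldHs_apply, szegoField, PiLp.smul_apply, projMat_apply, cubicL2_apply]
  rw [Submodule.coe_smul, map_smul, toL2_projHs]
  congr 2
  rw [map_sum]
  refine Finset.sum_congr rfl fun b _ => ?_
  rw [map_sum]
  exact Finset.sum_congr rfl fun a _ => (tri_eq_toL2_triHs hs (he _) (he _) (he _)).symm

theorem contDiff_szegoFieldHs (hs : 1 / 2 < s) {n : WithTop ℕ∞} :
    ContDiff ℝ n (szegoFieldHs hs : HsPlusMat M N s → HsPlusMat M N s) := by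
  refine (contDiff_piLp (ι := Fin M × Fin N) (𝕜 := ℝ) (E := fun _ => HsPlus s)
    (H := HsPlusMat M N s) 2).mpr fun p => ?_
  change ContDiff ℝ n fun V : HsPlusMat M N s => -Complex.I • projHs s (∑ b, ∑ a,
    triHs hs (V (p.1, a) : Hs s) (V (b, a) : Hs s) (V (b, p.2) : Hs s))
  have h1 : ContDiff ℝ n fun V : HsPlusMat M N s => ∑ b, ∑ a,
      triHs hs (V (p.1, a) : Hs s) (V (b, a) : Hs s) (V (b, p.2) : Hs s) :=
    ContDiff.sum fun b _ => ContDiff.sum fun a _ =>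
      contDiff_triHs hs (contDiff_entry _) (contDiff_entry _) (contDiff_entry _)
  exact (((-Complex.I) • projHs s).restrictScalars ℝ).contDiff.comp h1

/-- The tame estimate for the vector field. -/
theorem exists_norm_szegoFieldHs_le (M N : ℕ) (hs : 1 / 2 < s) : ∃ C : ℝ, 0 ≤ C ∧
    ∀ (V : HsPlusMat M N s) (W : ℝ≥0), (∀ p, wien (toL2Mat V p) ≤ W) →
      ‖szegoFieldHs hs V‖ ≤ C * ((W : ℝ) ^ 2 * ‖V‖) := by
  set c := Real.sqrt (mulConst s * (2 * mulConst s + 1) : ℝ≥0) with hc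
  refine ⟨∑ _p : Fin M × Fin N, ∑ _b : Fin M, ∑ _a : Fin N, c, by positivity, fun V W hW => ?_⟩
  have hV : ∀ p, ‖(V p : Hs s)‖ₑ ≤ (‖V‖₊ : ℝ≥0∞) := fun p => by
    rw [← enorm_eq_nnnorm, enorm_le_iff_norm_le]
    exact PiLp.norm_apply_le V p
  have ht : ∀ p q r, ‖triHs hs (V p : Hs s) (V q : Hs s) (V r : Hs s)‖ ≤
      c * ((W : ℝ) ^ 2 * ‖V‖) := by
    intro p q r
    have h := enorm_triHs_sq_le hs (hV p) (hV q) (hV r) (hW p) (hW q) (hW r)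
    have h' := norm_le_of_enorm_sq_le (y := W ^ 2 * ‖V‖₊) (by exact_mod_cast h)
    exact_mod_cast h'
  refine (norm_le_sum_norm _).trans ?_
  simp only [Finset.sum_mul]
  refine Finset.sum_le_sum fun p _ => ?_
  rw [szegoFieldHs_apply, norm_smul, norm_neg, Complex.norm_I, one_mul]
  refine (norm_projHs_le _).trans ((norm_sum_le _ _).trans (Finset.sum_le_sum fun b _ => ?_))
  exact (norm_sum_le _ _).trans (Finset.sum_le_sum fun a _ => ht _ _ _)

theorem exists_norm_szegoFieldHs_le_pow (M N : ℕ) (hs : 1 / 2 < s) : ∃ C : ℝ, 0 ≤ C ∧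
    ∀ V : HsPlusMat M N s, ‖szegoFieldHs hs V‖ ≤ C * ‖V‖ ^ 3 := by
  obtain ⟨C, hC, h⟩ := exists_norm_szegoFieldHs_le M N hs
  refine ⟨C * wienConst s, by positivity, fun V => ?_⟩
  refine (h V (NNReal.sqrt (wienConst s) * ‖V‖₊) fun p => ?_).trans (le_of_eq ?_)
  · rw [← ENNReal.pow_le_pow_left_iff two_ne_zero]
    refine (wien_sq_le hs _).trans ?_
    rw [← ENNReal.coe_pow, mul_pow, NNReal.sq_sqrt, ENNReal.coe_mul, ENNReal.coe_pow,
      ← enorm_eq_nnnorm, HsPlusMat.enorm_sq_eq]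
    gcongr
    exact wsum_le_energy _ _ _
  · push_cast
    rw [mul_pow, Real.sq_sqrt (wienConst s).coe_nonneg]
    ring

/-! ### The logarithmic bound of the Wiener norm -/

theorem tsum_inv_wsob_Ici_le {θ : ℝ} (hθ : 0 ≤ θ) (hs : 1 / 2 < s - θ) {K : ℕ} (hK : K ≠ 0) :
    ∑' n : Set.Ici (K : ℤ), ((wsob s n : ℝ≥0∞))⁻¹ ≤
      ((((K : ℝ≥0) ^ (2 * θ))⁻¹ * wienConst (s - θ) : ℝ≥0) : ℝ≥0∞) := by
  have hK0 : (0 : ℝ≥0) < K := by positivity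
  have hKp : (0 : ℝ≥0) < (K : ℝ≥0) ^ (2 * θ) := NNReal.rpow_pos hK0
  have h : ∀ n : Set.Ici (K : ℤ), ((wsob s n : ℝ≥0∞))⁻¹ ≤
      ((((K : ℝ≥0) ^ (2 * θ))⁻¹ : ℝ≥0) : ℝ≥0∞) * ((wsob (s - θ) n : ℝ≥0∞))⁻¹ := by
    rintro ⟨n, hn⟩
    have hn' : (K : ℝ≥0) ≤ n.natAbs := by
      have : (K : ℤ) ≤ n := hn
      exact_mod_cast (by omega : K ≤ n.natAbs)
    have h1 : (K : ℝ≥0) ^ (2 * θ) * wsob (s - θ) n ≤ wsob s n := by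
      have e : wsob s n = (1 + (n.natAbs : ℝ≥0) ^ 2) ^ θ * wsob (s - θ) n := by
        rw [wsob, wsob, ← NNReal.rpow_add (by positivity), add_sub_cancel]
      rw [e, NNReal.rpow_mul, NNReal.rpow_two]
      gcongr
      exact (pow_le_pow_left' hn' 2).trans le_add_self
    rw [← ENNReal.coe_inv (wsob_ne_zero _ _), ← ENNReal.coe_inv (wsob_ne_zero _ _),
      ← ENNReal.coe_mul, ENNReal.coe_le_coe, ← mul_inv]
    exact inv_anti₀ (mul_pos hKp (pos_iff_ne_zero.mpr (wsob_ne_zero _ _))) h1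
  refine (ENNReal.tsum_le_tsum h).trans ?_
  rw [ENNReal.tsum_mul_left, ENNReal.coe_mul, ← tsum_inv_wsob hs]
  exact mul_le_mul' le_rfl (ENNReal.tsum_comp_le_tsum_of_injective Subtype.val_injective
    fun n : ℤ => ((wsob (s - θ) n : ℝ≥0∞))⁻¹)

/-- The Wiener norm, with the frequencies below `K` estimated by the `H^{1/2}` energy and the others
by the `H^s` norm. -/
theorem wien_sq_le_log {θ : ℝ} (hθ : 0 ≤ θ) (hs : 1 / 2 < s - θ) {K : ℕ} (hK : K ≠ 0) {f : L2}
    (hf : ∀ n < 0, coeff f n = 0) : wien f ^ 2 ≤ 2 * (lg K * wsum wq f +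
      ((((K : ℝ≥0) ^ (2 * θ))⁻¹ * wienConst (s - θ) : ℝ≥0) : ℝ≥0∞) * wsum (wsob s) f) := by
  have hsplit : wien f ≤ ∑' n : Set.Ico 0 (K : ℤ), absCoeff f n +
      ∑' n : Set.Ici (K : ℤ), absCoeff f n := by
    refine le_trans (le_of_eq ?_) (ENNReal.tsum_union_le (absCoeff f) _ _)
    refine (tsum_subtype_eq_of_support_subset fun n hn => ?_).symm
    rcases lt_or_ge n 0 with h0 | h0
    · simp [absCoeff, hf n h0] at hn
    · rcases lt_or_ge n K with h1 | h1
      · exact Or.inl ⟨h0, h1⟩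
      · exact Or.inr h1
  refine (pow_le_pow_left' hsplit 2).trans ((ENNReal_add_sq_le _ _).trans ?_)
  gcongr
  · refine (tsum_absCoeff_sq_le wq_ne_zero _ f).trans ?_
    gcongr
    exact tsum_inv_wq_le K
  · refine (tsum_absCoeff_sq_le (wsob_ne_zero s) _ f).trans ?_
    gcongr
    exact tsum_inv_wsob_Ici_le hθ hs hK

/-- On sets of bounded `H^{1/2}` energy the vector field grows at most like `y log y` in the `H^s`
norm. -/
theorem exists_norm_szegoFieldHs_le_log (M N : ℕ) (hs : 1 / 2 < s) (R : ℝ≥0) : ∃ C : ℝ, 0 ≤ C ∧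
    ∀ V : HsPlusMat M N s, energy wq (toL2Mat V) ≤ R → 1 ≤ ‖V‖ →
      ‖szegoFieldHs hs V‖ ≤ C * ((1 + Real.log ‖V‖) * ‖V‖) := by
  obtain ⟨C, hC, h⟩ := exists_norm_szegoFieldHs_le M N hs
  set θ := (s - 1 / 2) / 2 with hθ
  have hθ0 : 0 < θ := by rw [hθ]; linarith
  have hsθ : 1 / 2 < s - θ := by rw [hθ]; linarith
  set D := wienConst (s - θ) with hD
  refine ⟨C * (2 * ((2 + θ⁻¹) * R + D)), by positivity, fun V hR hV => ?_⟩
  set y := ‖V‖ with hy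
  have hy0 : 0 < y := by linarith
  have hlog : 0 ≤ Real.log y := Real.log_nonneg hV
  -- frequencies are split at `K ≈ y^{1/θ}`, so that the high frequencies contribute `O(1)`
  set z := y ^ θ⁻¹ with hz
  have hz1 : 1 ≤ z := Real.one_le_rpow hV (by positivity)
  set K := ⌈z⌉₊ with hKdef
  have hK : K ≠ 0 := (Nat.ceil_pos.mpr (by linarith)).ne'
  have hzK : z ≤ K := Nat.le_ceil z
  have hK2 : (K : ℝ) ≤ 2 * z := by
    have := (Nat.ceil_lt_add_one (by linarith : 0 ≤ z)).le
    linarith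
  have hlogK : Real.log K ≤ 1 + θ⁻¹ * Real.log y := by
    calc Real.log K ≤ Real.log (2 * z) := Real.log_le_log (by positivity) hK2
      _ = Real.log 2 + θ⁻¹ * Real.log y := by
          rw [Real.log_mul two_ne_zero (by positivity), hz, Real.log_rpow hy0]
      _ ≤ _ := by
          gcongr
          have := Real.log_two_lt_d9
          linarith
  have hyK : y ^ 2 ≤ (K : ℝ) ^ (2 * θ) := by
    calc y ^ 2 = z ^ (2 * θ) := by
          rw [hz, ← Real.rpow_mul hy0.le, mul_comm 2 θ, ← mul_assoc, inv_mul_cancel₀ hθ0.ne',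
            one_mul, Real.rpow_two]
      _ ≤ _ := Real.rpow_le_rpow (by linarith) hzK (by linarith)
  have hyK' : ((K : ℝ≥0) ^ (2 * θ))⁻¹ * ‖V‖₊ ^ 2 ≤ 1 := by
    rw [← NNReal.coe_le_coe]
    push_cast
    rw [← hy, inv_mul_le_iff₀ (by positivity), mul_one]
    exact hyK
  set W2 : ℝ≥0 := 2 * (lg K * R + D) with hW2
  have hwien : ∀ p, wien (toL2Mat V p) ≤ (NNReal.sqrt W2 : ℝ≥0∞) := by
    intro p
    rw [← ENNReal.pow_le_pow_left_iff two_ne_zero, ← ENNReal.coe_pow, NNReal.sq_sqrt]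
    refine (wien_sq_le_log hθ0.le hsθ hK fun n hn => coeff_toL2Mat_of_neg V p hn).trans ?_
    have h1 : wsum wq (toL2Mat V p) ≤ R := (wsum_le_energy _ _ _).trans hR
    have h2 : wsum (wsob s) (toL2Mat V p) ≤ ((‖V‖₊ ^ 2 : ℝ≥0) : ℝ≥0∞) := by
      rw [ENNReal.coe_pow, ← enorm_eq_nnnorm, HsPlusMat.enorm_sq_eq]
      exact wsum_le_energy _ _ _
    have h3 : ((((K : ℝ≥0) ^ (2 * θ))⁻¹ * D : ℝ≥0) : ℝ≥0∞) * wsum (wsob s) (toL2Mat V p) ≤ D := by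
      refine (mul_le_mul' le_rfl h2).trans ?_
      rw [← ENNReal.coe_mul, ENNReal.coe_le_coe, mul_right_comm]
      exact mul_le_of_le_one_left zero_le hyK'
    refine (mul_le_mul' le_rfl (add_le_add (mul_le_mul' le_rfl h1) h3)).trans (le_of_eq ?_)
    rw [hW2]
    push_cast
    rfl
  refine (h V _ hwien).trans ?_
  have e : ((NNReal.sqrt W2 : ℝ≥0) : ℝ) ^ 2 = 2 * ((1 + Real.log K) * R + D) := by
    rw [← NNReal.coe_pow, NNReal.sq_sqrt, hW2]
    push_cast
    rw [coe_lg]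
  rw [e, mul_assoc C, ← mul_assoc (2 * ((2 + θ⁻¹) * (R : ℝ) + D))]
  refine mul_le_mul_of_nonneg_left (mul_le_mul_of_nonneg_right ?_ hy0.le) hC
  have hθi : 0 ≤ θ⁻¹ := by positivity
  have hR0 : (0 : ℝ) ≤ R := R.coe_nonneg
  have hD0 : (0 : ℝ) ≤ D := D.coe_nonneg
  have h1 : 1 + Real.log K ≤ (2 + θ⁻¹) * (1 + Real.log y) := by nlinarith
  have h2 : (1 + Real.log K) * (R : ℝ) ≤ (2 + θ⁻¹) * (1 + Real.log y) * R :=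
    mul_le_mul_of_nonneg_right h1 hR0
  nlinarith [mul_nonneg hD0 hlog]

/-! ### Propagation of regularity -/

/-- A barrier argument: a trajectory whose speed is at most `C (1 + log y) y` when its norm is
`y ≥ 1` grows at most doubly exponentially. -/
theorem norm_le_exp_exp {E : Type*} [NormedAddCommGroup E] [NormedSpace ℝ E] {f f' : ℝ → E}
    {C c T : ℝ} (hC : 0 ≤ C) (hc : 1 ≤ c) (h0 : ‖f 0‖ ≤ Real.exp c)
    (hd : ∀ t ∈ Set.Icc 0 T, HasDerivAt f (f' t) t)
    (hf' : ∀ t ∈ Set.Icc 0 T, 1 ≤ ‖f t‖ → ‖f' t‖ ≤ C * ((1 + Real.log ‖f t‖) * ‖f t‖)) :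
    ∀ t ∈ Set.Icc 0 T, ‖f t‖ ≤ Real.exp (c * Real.exp ((2 * C + 1) * t)) := by
  have hB : ∀ t, HasDerivAt (fun t => Real.exp (c * Real.exp ((2 * C + 1) * t)))
      (Real.exp (c * Real.exp ((2 * C + 1) * t)) *
        (c * (Real.exp ((2 * C + 1) * t) * (2 * C + 1)))) t := by
    intro t
    have h1 : HasDerivAt (fun t : ℝ => (2 * C + 1) * t) (2 * C + 1) t := by
      simpa using (hasDerivAt_id t).const_mul (2 * C + 1)
    exact (h1.exp.const_mul c).exp
  intro t ht
  refine image_norm_le_of_norm_deriv_right_lt_deriv_boundary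
    (fun t ht => (hd t ht).continuousAt.continuousWithinAt)
    (fun t ht => (hd t ⟨ht.1, ht.2.le⟩).hasDerivWithinAt) (by simpa using h0) hB ?_ ht
  intro t ht he
  set l := c * Real.exp ((2 * C + 1) * t) with hl
  have hl1 : 1 ≤ l := by
    have : 1 ≤ Real.exp ((2 * C + 1) * t) :=
      Real.one_le_exp (mul_nonneg (by linarith) ht.1)
    nlinarith
  have hE : 0 < Real.exp l := Real.exp_pos l
  have h1 : 1 ≤ ‖f t‖ := by
    rw [he]
    exact Real.one_le_exp (by linarith)
  have h2 := hf' t ⟨ht.1, ht.2.le⟩ h1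
  rw [he, Real.log_exp] at h2
  refine h2.trans_lt ?_
  have h3 : c * (Real.exp ((2 * C + 1) * t) * (2 * C + 1)) = l * (2 * C + 1) := by rw [hl]; ring
  rw [h3]
  nlinarith [mul_nonneg hC hE.le, mul_nonneg (mul_nonneg hC hE.le) (sub_nonneg.mpr hl1),
    mul_le_mul_of_nonneg_left hl1 hE.le]

theorem norm_trunc_le {K : ℕ} {U : L2Mat M N} {V : HsPlusMat M N s}
    (h : energy (wsob s) (projMat (Set.Ico 0 (K : ℤ)) U) ≤ energy (wsob s) (toL2Mat V)) :
    ‖trunc K s U‖ ≤ ‖V‖ := by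
  refine norm_le_of_energy_le ?_
  rwa [toL2Mat_trunc]

theorem norm_trunc_toL2Mat_le (K : ℕ) (V : HsPlusMat M N s) :
    ‖trunc K s (toL2Mat V)‖ ≤ ‖V‖ := norm_trunc_le (energy_projMat_le _ _ _)

/-- The `H^s` norm is the supremum of the norms of the truncations. -/
theorem norm_le_of_forall_norm_trunc_le {V : HsPlusMat M N s} {B : ℝ}
    (h : ∀ K : ℕ, ‖trunc K s (toL2Mat V)‖ ≤ B) : ‖V‖ ≤ B := by
  have hB : 0 ≤ B := (norm_nonneg _).trans (h 0)
  have hlim : Tendsto (fun K => toL2Mat (trunc K s (toL2Mat V))) atTop (𝓝 (toL2Mat V)) := by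
    have := tendsto_projMat_Ico (toL2Mat V)
    rw [projMat_Ici_toL2Mat] at this
    simpa only [toL2Mat_trunc] using this
  have hE : energy (wsob s) (toL2Mat V) ≤ ((B.toNNReal : ℝ≥0) : ℝ≥0∞) ^ 2 := by
    refine energy_le_of_tendsto (tendsto_coeff hlim) (.of_forall fun K => ?_)
    rw [← HsPlusMat.enorm_sq_eq]
    gcongr
    rw [enorm_eq_nnnorm, ENNReal.coe_le_coe]
    exact NNReal.le_toNNReal_of_coe_le (h K)
  rw [← HsPlusMat.enorm_sq_eq, ENNReal.pow_le_pow_left_iff two_ne_zero, enorm_eq_nnnorm,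
    ENNReal.coe_le_coe, ← NNReal.coe_le_coe, Real.coe_toNNReal _ hB] at hE
  exact hE

/-- The `H^s` norms of the Galerkin approximations are bounded uniformly on compact time
intervals. -/
theorem IsGalerkinSeq.exists_norm_trunc_le (hs : 1 / 2 < s) {U₀ : HsPlusMat M N (1 / 2)}
    {V₀ : HsPlusMat M N s} (h₀ : toL2Mat U₀ = toL2Mat V₀) {u : ℕ → ℝ → HsPlusMat M N (1 / 2)}
    (h : IsGalerkinSeq U₀ 0 u) (T : ℝ) : ∃ B : ℝ≥0, ∀ᶠ n : ℕ in atTop, ∀ t ∈ Set.Icc (-T) T,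
      energy (wsob s) (toL2Mat (u n t)) ≤ (B : ℝ≥0∞) ^ 2 := by
  obtain ⟨C, hC, hF⟩ := exists_norm_szegoFieldHs_le_log M N hs (energy wq (toL2Mat U₀)).toNNReal
  set c : ℝ := 1 + ‖V₀‖ with hc
  set B : ℝ := Real.exp (c * Real.exp ((2 * C + 1) * T)) with hB
  refine ⟨B.toNNReal, ?_⟩
  filter_upwards [eventually_subset_Ioo 0 (-T) T] with n hn
  intro t ht
  have hT : 0 ≤ T := by linarith [ht.1.trans ht.2]
  rw [Set.uIcc_of_le (by linarith)] at hn
  set V : ℝ → HsPlusMat M N s := fun τ => trunc n s (toL2Mat (u n τ)) with hVdef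
  have htoV : ∀ τ ∈ Set.Icc (-T) T, toL2Mat (V τ) = toL2Mat (u n τ) := fun τ hτ => by
    rw [hVdef, toL2Mat_trunc, projMat_eq_self ((h.isFlow n).modes τ (hn hτ))]
  set V' : ℝ → HsPlusMat M N s := fun τ => trunc n s
    (-Complex.I • projMat (Set.Ico 0 (n : ℤ)) (cubicL2 (u n τ))) with hV'def
  have hderiv : ∀ τ ∈ Set.Icc (-T) T, HasDerivAt V (V' τ) τ := fun τ hτ =>
    ((trunc n s).restrictScalars ℝ).hasFDerivAt.comp_hasDerivAt τ ((h.isFlow n).deriv τ (hn hτ))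
  have hV' : ∀ τ ∈ Set.Icc (-T) T, 1 ≤ ‖V τ‖ → ‖V' τ‖ ≤ C * ((1 + Real.log ‖V τ‖) * ‖V τ‖) := by
    intro τ hτ h1
    have hle : ‖V' τ‖ ≤ ‖szegoFieldHs hs (V τ)‖ := by
      refine norm_trunc_le ?_
      rw [toL2Mat_szegoFieldHs hs (htoV τ hτ).symm, szegoField, ← map_smul, ← map_smul]
      refine (energy_projMat_le _ _ _).trans ?_
      refine Finset.sum_le_sum fun p _ => wsum_mono_coeff fun m => ?_
      simp only [projMat_apply]
      by_cases hm : m ∈ Set.Ico 0 (n : ℤ)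
      · have hm' : m ∈ Set.Ici (0 : ℤ) := hm.1
        rw [coeff_modeProj_of_mem hm, coeff_modeProj_of_mem hm']
      · rw [coeff_modeProj_of_notMem hm, norm_zero]
        exact norm_nonneg _
    refine hle.trans (hF (V τ) ?_ h1)
    rw [energy_wq_eq_coe, htoV τ hτ]
    exact h.energy_le (hn hτ)
  have h0 : ‖V 0‖ ≤ Real.exp c := by
    have : ‖V 0‖ ≤ ‖V₀‖ := by
      refine norm_trunc_le ((energy_projMat_le _ _ _).trans ?_)
      rw [h.initial n, h₀]
      exact energy_projMat_le _ _ _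
    have := Real.add_one_le_exp c
    linarith
  have hc1 : 1 ≤ c := by have := norm_nonneg V₀; linarith
  have hbound : ‖V t‖ ≤ B := by
    have hmono : ∀ τ ≤ T, Real.exp (c * Real.exp ((2 * C + 1) * τ)) ≤ B := fun τ hτ => by
      rw [hB]
      gcongr
    rcases le_total 0 t with h0t | h0t
    · exact (norm_le_exp_exp hC hc1 h0 (fun τ hτ => hderiv τ ⟨by linarith [hτ.1], hτ.2⟩)
        (fun τ hτ => hV' τ ⟨by linarith [hτ.1], hτ.2⟩) t ⟨h0t, ht.2⟩).trans (hmono t ht.2)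
    · -- negative times are treated by reflection
      have hneg : ∀ τ ∈ Set.Icc 0 T, -τ ∈ Set.Icc (-T) T := fun τ hτ =>
        ⟨by linarith [hτ.2], by linarith [hτ.1]⟩
      have hd : ∀ τ ∈ Set.Icc 0 T, HasDerivAt (fun τ => V (-τ)) (-V' (-τ)) τ := fun τ hτ => by
        have := (hderiv (-τ) (hneg τ hτ)).scomp τ (hasDerivAt_neg τ)
        rw [neg_one_smul] at this
        exact this
      have := norm_le_exp_exp (f := fun τ => V (-τ)) hC hc1 (by simpa using h0) hd
        (fun τ hτ h1 => by rw [norm_neg]; exact hV' (-τ) (hneg τ hτ) h1) (-t)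
        ⟨by linarith, by linarith [ht.1]⟩
      rw [neg_neg] at this
      exact this.trans (hmono (-t) (by linarith [ht.1]))
  rw [← htoV t ht, ← HsPlusMat.enorm_sq_eq, enorm_eq_nnnorm]
  gcongr
  exact NNReal.le_toNNReal_of_coe_le hbound

/-- The solution stays in `H^s`, with bounds on compact time intervals. -/
theorem exists_toL2Mat_eq_flow (hs : 1 / 2 < s) {U₀ : HsPlusMat M N (1 / 2)}
    {V₀ : HsPlusMat M N s} (h₀ : toL2Mat U₀ = toL2Mat V₀) :
    ∃ V : ℝ → HsPlusMat M N s, (∀ t, toL2Mat (V t) = toL2Mat (flow U₀ t)) ∧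
      ∀ T, ∃ B, ∀ t ∈ Set.Icc (-T) T, ‖V t‖ ≤ B := by
  obtain ⟨u, hu⟩ := exists_isGalerkinSeq U₀ 0
  have hE : ∀ T, ∃ B : ℝ≥0, ∀ t ∈ Set.Icc (-T) T,
      energy (wsob s) (toL2Mat (flow U₀ t)) ≤ (B : ℝ≥0∞) ^ 2 := by
    intro T
    obtain ⟨B, hB⟩ := hu.exists_norm_trunc_le hs h₀ T
    refine ⟨B, fun t ht => energy_le_of_tendsto (tendsto_coeff (hu.tendsto_flow t)) ?_⟩
    filter_upwards [hB] with n hn using hn t ht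
  have hex : ∀ t, ∃ V : HsPlusMat M N s, toL2Mat V = toL2Mat (flow U₀ t) := by
    intro t
    obtain ⟨B, hB⟩ := hE |t|
    exact exists_toL2Mat_eq (fun p n hn => coeff_toL2Mat_of_neg _ p hn)
      (ne_top_of_le_ne_top (ENNReal.pow_ne_top ENNReal.coe_ne_top)
        (hB t ⟨neg_abs_le t, le_abs_self t⟩))
  choose V hV using hex
  refine ⟨V, hV, fun T => ?_⟩
  obtain ⟨B, hB⟩ := hE T
  refine ⟨B, fun t ht => ?_⟩
  have := hB t ht
  rw [← hV, ← HsPlusMat.enorm_sq_eq, ENNReal.pow_le_pow_left_iff two_ne_zero, enorm_eq_nnnorm,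
    ENNReal.coe_le_coe] at this
  exact_mod_cast this

/-- A mean value inequality in `H^s` for functions that are only known to be differentiable in
`L²`: it holds for all truncations to finitely many modes. -/
theorem norm_sub_le_of_hasDerivAt_toL2Mat {V G : ℝ → HsPlusMat M N s} {a b B : ℝ}
    (hd : ∀ t ∈ Set.uIcc a b, HasDerivAt (fun τ => toL2Mat (V τ)) (toL2Mat (G t)) t)
    (hG : ∀ t ∈ Set.uIcc a b, ‖G t‖ ≤ B) : ‖V b - V a‖ ≤ B * |b - a| := by
  refine norm_le_of_forall_norm_trunc_le fun K => ?_
  rw [toL2Mat_sub, (trunc K s).map_sub, ← Real.norm_eq_abs]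
  exact (convex_uIcc a b).norm_image_sub_le_of_norm_hasDerivWithin_le
    (f := fun τ => trunc K s (toL2Mat (V τ))) (f' := fun τ => trunc K s (toL2Mat (G τ)))
    (fun τ hτ => (((trunc K s).restrictScalars ℝ).hasFDerivAt.comp_hasDerivAt τ
      (hd τ hτ)).hasDerivWithinAt)
    (fun τ hτ => (norm_trunc_toL2Mat_le K (G τ)).trans (hG τ hτ))
    Set.left_mem_uIcc Set.right_mem_uIcc

/-- A function that is differentiable in `L²`, with a derivative that is continuous in `H^s`, is
differentiable in `H^s`. -/
theorem hasDerivAt_of_hasDerivAt_toL2Mat (hs : 0 ≤ s) {V G : ℝ → HsPlusMat M N s}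
    (hd : ∀ t, HasDerivAt (fun τ => toL2Mat (V τ)) (toL2Mat (G t)) t) (hG : Continuous G) (t : ℝ) :
    HasDerivAt V (G t) t := by
  rw [hasDerivAt_iff_isLittleO, Asymptotics.isLittleO_iff]
  intro ε hε
  obtain ⟨δ, hδ, h⟩ := Metric.continuousAt_iff.mp (hG.continuousAt (x := t)) ε hε
  filter_upwards [Metric.ball_mem_nhds t hδ] with r hr
  have hlin : ∀ x : ℝ, toL2Mat (V x - (x - t) • G t) = toL2Mat (V x) - (x - t) • toL2Mat (G t) := by
    intro x
    have := ((toL2MatL hs (M := M) (N := N)).restrictScalars ℝ).map_smul (x - t) (G t)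
    rw [toL2Mat_sub]
    exact congrArg _ this
  have hmv := norm_sub_le_of_hasDerivAt_toL2Mat (V := fun x => V x - (x - t) • G t)
    (G := fun x => G x - G t) (a := t) (b := r) (B := ε) (fun x _ => by
      simp only [hlin]
      rw [toL2Mat_sub]
      have h1 : HasDerivAt (fun x : ℝ => (x - t) • toL2Mat (G t)) (toL2Mat (G t)) x := by
        simpa using ((hasDerivAt_id x).sub_const t).smul_const (toL2Mat (G t))
      exact (hd x).sub h1) (fun x hx => by
      rw [← dist_eq_norm]
      refine (h ?_).le
      exact (convex_ball t δ).ordConnected.uIcc_subset (Metric.mem_ball_self hδ) hr hx)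
  rw [Real.norm_eq_abs]
  simpa [sub_right_comm] using hmv

/-- A solution of an autonomous differential equation with smooth vector field is smooth. -/
theorem contDiff_of_hasDerivAt {E : Type*} [NormedAddCommGroup E] [NormedSpace ℝ E] {f : ℝ → E}
    {F : E → E} (hF : ∀ n : ℕ, ContDiff ℝ n F) (hf : ∀ t, HasDerivAt f (F (f t)) t) :
    ContDiff ℝ ∞ f := by
  rw [contDiff_infty]
  intro n
  induction n with
  | zero =>
    exact contDiff_zero.mpr (continuous_iff_continuousAt.mpr fun t => (hf t).continuousAt)
  | succ n ih =>
    push_cast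
    rw [contDiff_succ_iff_deriv]
    refine ⟨fun t => (hf t).differentiableAt, by simp, ?_⟩
    rw [funext fun t => (hf t).deriv]
    exact (hF n).comp ih

/-- If the data belong to `H^s`, then the solution is a smooth function of time with values in `H^s`. -/
theorem exists_contDiff_flow (hs : 1 / 2 < s) {U₀ : HsPlusMat M N (1 / 2)}
    {V₀ : HsPlusMat M N s} (h₀ : toL2Mat U₀ = toL2Mat V₀) :
    ∃ V : ℝ → HsPlusMat M N s, ContDiff ℝ ∞ V ∧ ∀ t, toL2Mat (V t) = toL2Mat (flow U₀ t) := by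
  obtain ⟨V, hV, hbound⟩ := exists_toL2Mat_eq_flow hs h₀
  obtain ⟨C, hC, hF⟩ := exists_norm_szegoFieldHs_le_pow M N hs
  have hd : ∀ t, HasDerivAt (fun τ => toL2Mat (V τ)) (toL2Mat (szegoFieldHs hs (V t))) t := by
    intro t
    rw [toL2Mat_szegoFieldHs hs (hV t).symm]
    simp only [hV]
    exact (isFlow_flow U₀).deriv t trivial
  have hcont : Continuous V := by
    refine continuous_iff_continuousAt.mpr fun t => ?_
    obtain ⟨B, hB⟩ := hbound (|t| + 1)
    have hsub : Metric.ball t 1 ⊆ Set.Icc (-(|t| + 1)) (|t| + 1) := by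
      intro r hr
      rw [Metric.mem_ball, Real.dist_eq, abs_lt] at hr
      exact ⟨by linarith [neg_abs_le t], by linarith [le_abs_self t]⟩
    rw [ContinuousAt, tendsto_iff_norm_sub_tendsto_zero]
    refine squeeze_zero' (g := fun r => C * B ^ 3 * |r - t|) (.of_forall fun r => norm_nonneg _)
      ?_ ?_
    · filter_upwards [Metric.ball_mem_nhds t one_pos] with r hr
      refine norm_sub_le_of_hasDerivAt_toL2Mat (fun x _ => hd x) fun x hx => (hF (V x)).trans ?_
      have hx' := (convex_ball t 1).ordConnected.uIcc_subset (Metric.mem_ball_self one_pos) hr hx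
      gcongr
      exact hB x (hsub hx')
    · have : Continuous fun r : ℝ => C * B ^ 3 * |r - t| := by fun_prop
      simpa using this.tendsto t
  refine ⟨V, contDiff_of_hasDerivAt (F := szegoFieldHs hs)
    (fun n => contDiff_szegoFieldHs hs) ?_, hV⟩
  exact hasDerivAt_of_hasDerivAt_toL2Mat (by linarith) hd
    ((contDiff_szegoFieldHs hs (n := 0)).continuous.comp hcont)

end MatrixSzego

end

theorem proposition1 (M N : ℕ) :
    (∀ U₀ : MatrixSzego.HsPlusMat M N (1 / 2),
      ∃! U : C(ℝ, MatrixSzego.HsPlusMat M N (1 / 2)),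
        MatrixSzego.IsSolution U ∧ U 0 = U₀) ∧
    (∀ T : ℝ, 0 < T →
      ∃ Φ : MatrixSzego.HsPlusMat M N (1 / 2) →
          C(Set.Icc (-T) T, MatrixSzego.HsPlusMat M N (1 / 2)),
        Continuous Φ ∧
        ∀ U : C(ℝ, MatrixSzego.HsPlusMat M N (1 / 2)), MatrixSzego.IsSolution U →
          Φ (U 0) = U.restrict (Set.Icc (-T) T)) ∧
    (∀ s : ℝ, 1 / 2 < s → ∀ V₀ : MatrixSzego.HsPlusMat M N s,
      ∀ U : C(ℝ, MatrixSzego.HsPlusMat M N (1 / 2)), MatrixSzego.IsSolution U →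
        MatrixSzego.toL2Mat (U 0) = MatrixSzego.toL2Mat V₀ →
        ∃ V : ℝ → MatrixSzego.HsPlusMat M N s, ContDiff ℝ ∞ V ∧
          ∀ t : ℝ, MatrixSzego.toL2Mat (V t) = MatrixSzego.toL2Mat (U t)) := by
  refine ⟨MatrixSzego.existsUnique_solution,
    fun T _ => MatrixSzego.exists_continuous_flowMap M N T, fun s hs V₀ U hU h₀ => ?_⟩
  rw [MatrixSzego.eq_flow hU U.continuous]
  exact MatrixSzego.exists_contDiff_flow hs h₀
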